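/- Let $q\in\mathbb C$ with $0<|q|<1$, let $\lambda\in\mathbb C$ and $q^\lambda=e^{\lambda\log q}$ (principal branch). Let $m\ge 1$, let $B_1,\dots,B_N,B_\infty\in \mathrm M_m(\mathbb C)$, let $b_1,\dots,b_N\in\mathbb C\setminus\{0\}$ be distinct, and let $E_{\boldsymbol B,\boldsymbol b}$ be the $q$-difference equation $Y(qx)=B(x)Y(x)$, $B(x)=B_\infty+\sum_{i=1}^N\frac{B_i}{1-x/b_i}$. Put $B_0=1_m-\sum_{i=1}^N B_i-B_\infty$ and $\mathcal V=\mathbb C^m$. *Canonical form, Fuchsian type.* Two systems $Y(qx)=R(x)Y(x)$ and $Y(qx)=R'(x)Y(x)$ with rational coefficients are gauge equivalent if $R'(x)=Q(x)\,P R(x)P^{-1}$ with $P\in \mathrm{GL}_m(\mathbb C)$ and a nonzero scalar rational function $Q$. A canonical form of $E_R: Y(qx)=R(x)Y(x)$ is a gauge equivalent system with polynomial coefficient $A(x)=\sum_{k=0}^{N}A_kx^k$ such that $A_0\neq0$, $A_\infty:=A_N\ne0$ and $A(a)\neq 0$ for all $a\in\mathbb C$ (here $N$ is the degree of the canonical form).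 A polynomial system is of Fuchsian type if $A_0$ and $A_\infty$ are invertible. *Rigidity index.* Let $A(x)$ be a Fuchsian canonical form of $E_R$. For $\xi=0,\infty$ and each eigenvalue $\alpha_i^\xi$ of $A_\xi$ let $(m^\xi_{i,j})_j$ be the conjugate of the partition formed by the sizes of the Jordan cells of $A_\xi$ with eigenvalue $\alpha_i^\xi$. Let $d_1,\dots,d_m$, $d_{i+1}\mid d_i$, be the elementary divisors of $A(x)$, i.e. $A(x)$ is equivalent over $\mathbb C[x]$ to $\mathrm{diag}(d_1,\dots,d_m)$, and for each zero $a_i$ of $\det A(x)$ let $(n^i_j)_j$ be the conjugate of the partition formed by the orders of the zero $a_i$ of $d_1,\dots,d_m$. Then $$\mathrm{idx}(E_R)=\sum_{\xi=0,\infty}\sum_{i}\sum_j (m^\xi_{i,j})^2+\sum_i\sum_j(n^i_j)^2-m^2N .$$ *$q$-middle convolution.* Let $F_i$ ($1\le i\le N$) be the endomorphism of $\mathcal V^{N+1}$ (components indexed by $0,\dots,N$) whose block row of index $i$ is $(B_0,\dots,B_i-(1-q^\lambda)1_m,\dots,B_N)$ and whose other block rows vanish; let $\widehat F$ have all block rows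 equal to $(B_0,\dots,B_N)$ and $F_\infty=1-\widehat F$. Put $\mathcal K=\bigoplus_{i=0}^N\ker B_i$ and $\mathcal L=\ker(\widehat F-(1-q^\lambda)1)$; both are invariant under $F_1,\dots,F_N,F_\infty$. Then $mc_\lambda(E_{\boldsymbol B,\boldsymbol b})=E_{\overline{\boldsymbol F},\boldsymbol b}$, where $\overline F_k$ is the matrix, in any basis, of the map induced by $F_k$ on $\mathcal V^{N+1}/(\mathcal K+\mathcal L)$. **Theorem.** Suppose that the polynomial system with coefficient $A(x)=\prod_{i=1}^N(1-\frac x{b_i})\,B(x)=\sum_{k=0}^NA_kx^k$ is of Fuchsian type, i.e. $A_0$ and $A_N$ are invertible, and that for all $i\in\{0,\dots,N\}$ and $\tau\in\mathbb C$ $$(\ast)\ \ \bigcap_{j\ne i}\ker B_j\cap\ker(B_i+\tau 1_m)=0,\qquad (\ast\ast)\ \ \sum_{j\neq i}\operatorname{im}B_j+\operatorname{im}(B_i+\tau 1_m)=\mathcal V .$$ Let $E_R$ be any equation gauge equivalent to $E_{\boldsymbol B,\boldsymbol b}$. Then the rigidity indices of $E_R$ and of $mc_\lambda(E_{\boldsymbol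 B,\boldsymbol b})$ are well defined (each has a Fuchsian canonical form, and the index does not depend on the choice of one), and $$\mathrm{idx}\bigl(mc_\lambda(E_{\boldsymbol B,\boldsymbol b})\bigr)=\mathrm{idx}(E_R).$$ -/

import Mathlib

open Polynomial

/-- The data `(B, b)` of an equation `E_{B,b} : Y(qx) = B(x) Y(x)`,
`B(x) = B_∞ + ∑ᵢ Bᵢ / (1 - x / bᵢ)`, with `b₁, …, b_N` distinct and nonzero.
The rows and columns of the matrices are indexed by `ι`. -/
structure QEquation (N : ℕ) (ι : Type) where
  B : Fin N → Matrix ι ι ℂ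
  Binf : Matrix ι ι ℂ
  b : Fin N → ℂ
  b_ne_zero : ∀ i, b i ≠ 0
  b_injective : Function.Injective b

namespace QEquation

variable {N : ℕ} {ι : Type} [Fintype ι] [DecidableEq ι]

/-- `B₀ = 1 - ∑ᵢ Bᵢ - B_∞`. -/
def Bzero (E : QEquation N ι) : Matrix ι ι ℂ :=
  1 - ∑ i, E.B i - E.Binf

/-- The family `B₀, B₁, …, B_N`. -/
def Bfull (E : QEquation N ι) : Fin (N + 1) → Matrix ι ι ℂ :=
  Fin.cons E.Bzero E.B

/-- The rational coefficient matrix `B(x) = B_∞ + ∑ᵢ Bᵢ / (1 - x / bᵢ)`. -/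
noncomputable def coeff (E : QEquation N ι) : Matrix ι ι (RatFunc ℂ) :=
  E.Binf.map RatFunc.C +
    ∑ i, (1 - RatFunc.X / RatFunc.C (E.b i))⁻¹ • (E.B i).map RatFunc.C

/-- The polynomial matrix `A(x) = T(x) B(x)`, `T(x) = ∏ᵢ (1 - x / bᵢ)`. -/
noncomputable def polyCoeff (E : QEquation N ι) : Matrix ι ι ℂ[X] :=
  (∏ i, (1 - C (E.b i)⁻¹ * X)) • E.Binf.map C +
    ∑ i, (∏ j ∈ Finset.univ.erase i, (1 - C (E.b j)⁻¹ * X)) • (E.B i).map C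

/-- The condition `(∗)`. -/
def StarKer (E : QEquation N ι) : Prop :=
  ∀ (i : Fin (N + 1)) (τ : ℂ),
    (⨅ j ∈ Finset.univ.erase i, LinearMap.ker (Matrix.toLin' (E.Bfull j))) ⊓
      LinearMap.ker (Matrix.toLin' (E.Bfull i + τ • (1 : Matrix ι ι ℂ))) = ⊥

/-- The condition `(∗∗)`. -/
def StarIm (E : QEquation N ι) : Prop :=
  ∀ (i : Fin (N + 1)) (τ : ℂ),
    (⨆ j ∈ Finset.univ.erase i, LinearMap.range (Matrix.toLin' (E.Bfull j))) ⊔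
      LinearMap.range (Matrix.toLin' (E.Bfull i + τ • (1 : Matrix ι ι ℂ))) = ⊤

/-- The matrix `F̂`, all of whose block rows are `(B₀ B₁ … B_N)`. A vector of
`𝒱^{N+1}` is a function on `Fin (N + 1) × ι`. -/
def Fhat (E : QEquation N ι) : Matrix (Fin (N + 1) × ι) (Fin (N + 1) × ι) ℂ :=
  Matrix.of fun r s => E.Bfull s.1 r.2 s.2

/-- The `q`-convolution `c_λ`: the only nonzero block row of `F_k` is the one of index `k`
(counted from `0`), and it is `(B₀ … B_k - (1 - q^λ) … B_N)`; `F_∞ = 1 - F̂`. -/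
noncomputable def conv (E : QEquation N ι) (q lam : ℂ) :
    QEquation N (Fin (N + 1) × ι) where
  B k := Matrix.of fun r s =>
    if r.1 = k.succ then
      (if s.1 = k.succ then E.Bfull s.1 - (1 - q ^ lam) • (1 : Matrix ι ι ℂ)
        else E.Bfull s.1) r.2 s.2
    else 0
  Binf := 1 - E.Fhat
  b := E.b
  b_ne_zero := E.b_ne_zero
  b_injective := E.b_injective

/-- `𝒦 = ⨁ᵢ ker Bᵢ`, the vectors whose `i`-th component is in `ker Bᵢ` for `i = 0, …, N`. -/
def K (E : QEquation N ι) : Submodule ℂ (Fin (N + 1) × ι → ℂ) where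
  carrier := {v | ∀ i, (E.Bfull i).mulVec (fun j => v (i, j)) = 0}
  zero_mem' i := (E.Bfull i).mulVec_zero
  add_mem' {v w} hv hw i := by
    have := (E.Bfull i).mulVec_add (fun j => v (i, j)) (fun j => w (i, j))
    rw [hv i, hw i, add_zero] at this
    exact this
  smul_mem' c v hv i := by
    have := (E.Bfull i).mulVec_smul c (fun j => v (i, j))
    rw [hv i, smul_zero] at this
    exact this

/-- `ℒ = ker (F̂ - (1 - q^λ))`. -/
noncomputable def L (E : QEquation N ι) (q lam : ℂ) :
    Submodule ℂ (Fin (N + 1) × ι → ℂ) :=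
  LinearMap.ker (Matrix.toLin' (E.Fhat - (1 - q ^ lam) • 1))

theorem Fhat_mulVec (E : QEquation N ι) (v : Fin (N + 1) × ι → ℂ) (r : Fin (N + 1) × ι) :
    E.Fhat.mulVec v r = ∑ i, (E.Bfull i).mulVec (fun j => v (i, j)) r.2 := by
  simp only [Matrix.mulVec, dotProduct, Fhat, Matrix.of_apply, Fintype.sum_prod_type]

theorem conv_B_mulVec (E : QEquation N ι) (q lam : ℂ) (k : Fin N)
    (v : Fin (N + 1) × ι → ℂ) (r : Fin (N + 1) × ι) :
    ((E.conv q lam).B k).mulVec v r =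
      if r.1 = k.succ then E.Fhat.mulVec v r - (1 - q ^ lam) * v r else 0 := by
  by_cases h : r.1 = k.succ
  · rw [if_pos h, Fhat_mulVec]
    simp only [Matrix.mulVec, dotProduct, conv, Matrix.of_apply, Fintype.sum_prod_type, if_pos h]
    rw [Fin.sum_univ_succAbove _ k.succ,
      Fin.sum_univ_succAbove (fun i => ∑ j, E.Bfull i r.2 j * v (i, j)) k.succ]
    simp only [if_true, Fin.succAbove_ne, if_false, Matrix.sub_apply, Matrix.smul_apply,
      Matrix.one_apply, smul_eq_mul, sub_mul, Finset.sum_sub_distrib]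
    have : v r = v (k.succ, r.2) := by rw [← h]
    simp [this, mul_ite]
    ring
  · rw [if_neg h]
    simp only [Matrix.mulVec, dotProduct, conv, Matrix.of_apply, if_neg h, zero_mul,
      Finset.sum_const_zero]

theorem Fhat_mulVec_of_mem_K (E : QEquation N ι) {v : Fin (N + 1) × ι → ℂ} (hv : v ∈ E.K) :
    E.Fhat.mulVec v = 0 := by
  ext r
  rw [Fhat_mulVec]
  exact Finset.sum_eq_zero fun i _ => congrFun (hv i) r.2

theorem mem_L_iff (E : QEquation N ι) (q lam : ℂ) (v : Fin (N + 1) × ι → ℂ) :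
    v ∈ E.L q lam ↔ E.Fhat.mulVec v = (1 - q ^ lam) • v := by
  rw [L, LinearMap.mem_ker, Matrix.toLin'_apply, Matrix.sub_mulVec, Matrix.smul_mulVec,
    Matrix.one_mulVec, sub_eq_zero]

/-- `𝒦 + ℒ` is invariant under `F_1, …, F_N`. -/
theorem invariant_B (E : QEquation N ι) (q lam : ℂ) (k : Fin N) :
    E.K ⊔ E.L q lam ≤
      (E.K ⊔ E.L q lam).comap (Matrix.toLin' ((E.conv q lam).B k)) := by
  refine sup_le (fun v hv => ?_) (fun v hv => ?_)
  · refine Submodule.mem_sup_left (fun i => ?_)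
    have h0 := E.Fhat_mulVec_of_mem_K hv
    have : (fun j => (Matrix.toLin' ((E.conv q lam).B k)) v (i, j)) =
        (if i = k.succ then -(1 - q ^ lam) else 0) • (fun j => v (i, j)) := by
      ext j
      rw [Matrix.toLin'_apply, conv_B_mulVec, h0]
      by_cases h : i = k.succ
      · simp only [h, if_true, Pi.zero_apply, Pi.smul_apply, smul_eq_mul]
        ring
      · simp [h]
    rw [this, Matrix.mulVec_smul, hv i, smul_zero]
  · rw [mem_L_iff] at hv
    have : Matrix.toLin' ((E.conv q lam).B k) v = 0 := by
      ext r
      rw [Matrix.toLin'_apply, conv_B_mulVec, hv]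
      simp
    rw [Submodule.mem_comap, this]
    exact Submodule.zero_mem _

/-- `𝒦 + ℒ` is invariant under `F_∞`. -/
theorem invariant_Binf (E : QEquation N ι) (q lam : ℂ) :
    E.K ⊔ E.L q lam ≤
      (E.K ⊔ E.L q lam).comap (Matrix.toLin' (E.conv q lam).Binf) := by
  have key : ∀ v, Matrix.toLin' (E.conv q lam).Binf v = v - E.Fhat.mulVec v := fun v => by
    rw [Matrix.toLin'_apply]
    change (1 - E.Fhat).mulVec v = _
    rw [Matrix.sub_mulVec, Matrix.one_mulVec]
  refine sup_le (fun v hv => ?_) (fun v hv => ?_)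
  · rw [Submodule.mem_comap, key, E.Fhat_mulVec_of_mem_K hv, sub_zero]
    exact Submodule.mem_sup_left hv
  · have h := (E.mem_L_iff q lam v).1 hv
    rw [Submodule.mem_comap, key, h]
    exact Submodule.mem_sup_right (Submodule.sub_mem _ hv (Submodule.smul_mem _ _ hv))

/-- The space `mc_λ(𝒱) = 𝒱^{N+1} / (𝒦 + ℒ)`. -/
abbrev McSpace (E : QEquation N ι) (q lam : ℂ) : Type :=
  (Fin (N + 1) × ι → ℂ) ⧸ (E.K ⊔ E.L q lam)

/-- The `q`-middle convolution `mc_λ`: the matrices, in a basis `v` of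
`𝒱^{N+1} / (𝒦 + ℒ)`, of the maps induced by `F_1, …, F_N, F_∞`. -/
noncomputable def middleConv (E : QEquation N ι) (q lam : ℂ) {κ : Type} [Fintype κ]
    [DecidableEq κ] (v : Module.Basis κ ℂ (E.McSpace q lam)) : QEquation N κ where
  B k := LinearMap.toMatrix v v
    (Submodule.mapQ _ _ (Matrix.toLin' ((E.conv q lam).B k)) (E.invariant_B q lam k))
  Binf := LinearMap.toMatrix v v
    (Submodule.mapQ _ _ (Matrix.toLin' (E.conv q lam).Binf) (E.invariant_Binf q lam))
  b := E.b
  b_ne_zero := E.b_ne_zero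
  b_injective := E.b_injective

end QEquation

section Rigidity

variable {n : Type} [Fintype n] [DecidableEq n]

/-- The coefficient `A_k` of `A(x) = ∑ A_k x^k`. -/
noncomputable def matCoeff (A : Matrix n n ℂ[X]) (k : ℕ) : Matrix n n ℂ :=
  A.map fun p => p.coeff k

/-- The polynomial system `Y(qx) = A(x) Y(x)`, `A(x) = ∑_{k ≤ N} A_k x^k`, is of Fuchsian
type: `A₀` and `A_∞ = A_N` are invertible. -/
def IsFuchsianPoly (N : ℕ) (A : Matrix n n ℂ[X]) : Prop :=
  (∀ i j, (A i j).natDegree ≤ N) ∧ IsUnit (matCoeff A 0) ∧ IsUnit (matCoeff A N)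

/-- Gauge equivalence of `Y(qx) = R(x) Y(x)` and `Y(qx) = R'(x) Y(x)` under the
transformations `Y ↦ P Y` with `P` a constant invertible matrix (so `R' = P R P⁻¹`)
and `Y ↦ f Y` with `f(qx) = Q(x) f(x)`, `Q` a nonzero rational function (so `R' = Q R`). -/
def GaugeEquiv (R R' : Matrix n n (RatFunc ℂ)) : Prop :=
  ∃ (P : (Matrix n n ℂ)ˣ) (Q : RatFunc ℂ), Q ≠ 0 ∧
    R' = Q • ((P : Matrix n n ℂ).map RatFunc.C * R * ((P⁻¹ : (Matrix n n ℂ)ˣ) : Matrix n n ℂ).map RatFunc.C)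

/-- `A(x) = ∑_{k ≤ N} A_k x^k` is a canonical form of `Y(qx) = R(x) Y(x)`: it is gauge
equivalent to `R`, `A₀ ≠ 0`, `A_N ≠ 0`, and `A(a) ≠ 0` for every `a ∈ ℂ`. -/
def IsCanonicalForm (R : Matrix n n (RatFunc ℂ)) (N : ℕ) (A : Matrix n n ℂ[X]) : Prop :=
  GaugeEquiv R (A.map (algebraMap ℂ[X] (RatFunc ℂ))) ∧
    (∀ i j, (A i j).natDegree ≤ N) ∧ matCoeff A 0 ≠ 0 ∧ matCoeff A N ≠ 0 ∧
    ∀ a : ℂ, A.map (eval a) ≠ 0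

/-- The Jordan cell `J(α, t)` of size `t` with eigenvalue `α`. -/
def jordanCell (α : ℂ) (t : ℕ) : Matrix (Fin t) (Fin t) ℂ :=
  Matrix.of fun i j => if i = j then α else if (i : ℕ) + 1 = j then 1 else 0

/-- `M ∼ ⨁ᵢ J(αᵢ, tᵢ)`. -/
def IsJordanForm (M : Matrix n n ℂ) {k : ℕ} (α : Fin k → ℂ) (t : Fin k → ℕ) : Prop :=
  (∀ i, 0 < t i) ∧
    ∃ (P : Matrix n (Σ i, Fin (t i)) ℂ) (P' : Matrix (Σ i, Fin (t i)) n ℂ),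
      P * P' = 1 ∧ P' * P = 1 ∧
        M = P * Matrix.blockDiagonal' (fun i => jordanCell (α i) (t i)) * P'

/-- `d₁, …, d_m` (with `d_{i+1} ∣ d_i`) are the elementary divisors of the polynomial matrix
`A(x)`: `A(x)` is equivalent to `diag(d₁, …, d_m)`. -/
def IsElementaryDivisors {m : ℕ} (A : Matrix (Fin m) (Fin m) ℂ[X]) (d : Fin m → ℂ[X]) : Prop :=
  (∀ i j, i ≤ j → d j ∣ d i) ∧
    ∃ P Q : (Matrix (Fin m) (Fin m) ℂ[X])ˣ,
      (P : Matrix (Fin m) (Fin m) ℂ[X]) * A * (Q : Matrix (Fin m) (Fin m) ℂ[X]) =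
        Matrix.diagonal d

/-- The `j`-th part (`j ≥ 1`) of the conjugate of a partition `s` : the number of parts of `s`
that are at least `j`. -/
def conjPart (s : Multiset ℕ) (j : ℕ) : ℕ :=
  (s.filter fun t => j ≤ t).card

/-- The sum of the squares of the parts of the conjugate of the partition `s`. -/
def sumSqConj (s : Multiset ℕ) : ℕ :=
  ∑ j ∈ Finset.Icc 1 s.sup, conjPart s j ^ 2

/-- The contribution `∑ᵢ ∑ⱼ m_{i,j}²` of a matrix similar to `⨁ᵢ J(αᵢ, tᵢ)`: the sum over
the distinct eigenvalues `a` of `sumSqConj` of the sizes of the cells with eigenvalue `a`. -/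
noncomputable def jordanSum {k : ℕ} (α : Fin k → ℂ) (t : Fin k → ℕ) : ℕ :=
  ∑ a ∈ Finset.univ.image α,
    sumSqConj ((Finset.univ.filter fun i => α i = a).val.map t)

/-- The contribution `∑ᵢ ∑ⱼ (n_j^i)²` of `A(x)`, where `d` are its elementary divisors: the
sum over the zeros `a` of `det A(x)` of `sumSqConj` of the orders of `a` as a zero
of `d₁, …, d_m`. -/
noncomputable def divisorSum {m : ℕ} (A : Matrix (Fin m) (Fin m) ℂ[X]) (d : Fin m → ℂ[X]) : ℕ :=
  ∑ a ∈ A.det.roots.toFinset,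
    sumSqConj (Finset.univ.val.map fun i => (d i).rootMultiplicity a)

/-- `r` is the rigidity index of the Fuchsian equation `Y(qx) = R(x) Y(x)`: the equation has a
canonical form `A(x) = ∑_{k ≤ N} A_k x^k`, it is of Fuchsian type, and
`r = ∑_{ξ = 0, ∞} ∑ᵢ ∑ⱼ (m_{i,j}^ξ)² + ∑ᵢ ∑ⱼ (n_j^i)² - m² N`. -/
def IsRigidityIndex {m : ℕ} (R : Matrix (Fin m) (Fin m) (RatFunc ℂ)) (r : ℤ) : Prop :=
  ∃ (N : ℕ) (A : Matrix (Fin m) (Fin m) ℂ[X]), IsCanonicalForm R N A ∧ IsFuchsianPoly N A ∧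
    ∃ (k₀ : ℕ) (α₀ : Fin k₀ → ℂ) (t₀ : Fin k₀ → ℕ) (k₁ : ℕ) (α₁ : Fin k₁ → ℂ) (t₁ : Fin k₁ → ℕ)
      (d : Fin m → ℂ[X]),
      IsJordanForm (matCoeff A 0) α₀ t₀ ∧ IsJordanForm (matCoeff A N) α₁ t₁ ∧
        IsElementaryDivisors A d ∧
        r = (jordanSum α₀ t₀ : ℤ) + jordanSum α₁ t₁ + divisorSum A d - (m : ℤ) ^ 2 * N

theorem sum_jordanCell {M : Type} [AddCommGroup M] [Module ℂ M] (a : ℂ) (t : ℕ) (w : ℕ → M)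
    (h0 : w t = 0) (j : Fin t) :
    ∑ i, jordanCell a t i j • w (t - 1 - (i : ℕ)) =
      a • w (t - 1 - (j : ℕ)) + w (t - 1 - (j : ℕ) + 1) := by
  have h : ∀ i : Fin t, jordanCell a t i j • w (t - 1 - (i : ℕ)) =
      (if i = j then a • w (t - 1 - (i : ℕ)) else 0) +
        (if (i : ℕ) + 1 = j then w (t - 1 - (i : ℕ)) else 0) := by
    intro i
    by_cases h1 : i = j
    · subst h1; simp [jordanCell]
    · by_cases h2 : (i : ℕ) + 1 = j <;> simp [jordanCell, h1, h2]
  rw [Finset.sum_congr rfl fun i _ => h i, Finset.sum_add_distrib]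
  congr 1
  · simp
  · have hj := j.2
    rcases Nat.eq_zero_or_pos (j : ℕ) with h1 | h1
    · rw [Finset.sum_eq_zero fun i _ => if_neg (by omega), show t - 1 - (j : ℕ) + 1 = t by omega, h0]
    · rw [Finset.sum_eq_single ⟨j - 1, by omega⟩]
      · rw [if_pos (by simp; omega)]
        congr 1
        simp
        omega
      · intro i _ hi
        exact if_neg fun h => hi (Fin.ext (by simp; omega))
      · simp

/-- The cyclic module `ℂ[X] / (X - a)^t` has a basis in which `X` acts by a Jordan cell. -/
theorem cyclic_basis (a : ℂ) (t : ℕ) (I : Ideal ℂ[X]) (hI : I = Ideal.span {(X - C a) ^ t}) :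
    ∃ v : Module.Basis (Fin t) ℂ (ℂ[X] ⧸ I),
      ∀ j : Fin t, (X : ℂ[X]) • v j = ∑ i, jordanCell a t i j • v i := by
  have hfin : Module.finrank ℂ (ℂ[X] ⧸ I) = t := by
    rw [hI, finrank_quotient_span_eq_natDegree, (monic_X_sub_C a).natDegree_pow, natDegree_X_sub_C, mul_one]
  let w : ℕ → ℂ[X] ⧸ I := fun k => Ideal.Quotient.mk I ((X - C a) ^ k)
  have hw0 : ∀ k, t ≤ k → w k = 0 := fun k hk => by
    refine Ideal.Quotient.eq_zero_iff_mem.2 ?_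
    rw [hI]
    exact Ideal.mem_span_singleton.2 (pow_dvd_pow _ hk)
  have hspan : ⊤ ≤ Submodule.span ℂ (Set.range fun j : Fin t => w (t - 1 - (j : ℕ))) := by
    intro y _
    obtain ⟨p, rfl⟩ := Ideal.Quotient.mk_surjective y
    have hp := sum_taylor_eq p a
    rw [← hp, Polynomial.sum, map_sum]
    refine Submodule.sum_mem _ fun i _ => ?_
    rw [← Polynomial.smul_eq_C_mul]
    change (((taylor a) p).coeff i) • w i ∈ _
    refine Submodule.smul_mem _ _ ?_
    rcases lt_or_ge i t with h | h
    · refine Submodule.subset_span ⟨⟨t - 1 - i, by omega⟩, ?_⟩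
      simp only
      congr 1
      omega
    · rw [hw0 i h]; exact Submodule.zero_mem _
  refine ⟨basisOfTopLeSpanOfCardEqFinrank _ hspan (by rw [hfin, Fintype.card_fin]), fun j => ?_⟩
  simp only [coe_basisOfTopLeSpanOfCardEqFinrank]
  rw [sum_jordanCell a t w (hw0 t le_rfl)]
  change Ideal.Quotient.mk I (X * (X - C a) ^ _) = Ideal.Quotient.mk I (a • (X - C a) ^ _) +
    Ideal.Quotient.mk I ((X - C a) ^ _)
  rw [← map_add, Polynomial.smul_eq_C_mul]
  congr 1
  ring

/-- Every complex matrix has a Jordan form. -/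
theorem exists_isJordanForm (M : Matrix n n ℂ) :
    ∃ (k : ℕ) (α : Fin k → ℂ) (t : Fin k → ℕ), IsJordanForm M α t := by
  classical
  set f : (n → ℂ) →ₗ[ℂ] (n → ℂ) := Matrix.toLin' M with hf
  have htors : Module.IsTorsion ℂ[X] (Module.AEval' f) := by
    intro x
    refine ⟨⟨minpoly ℂ f, mem_nonZeroDivisors_of_ne_zero
      (minpoly.ne_zero (Algebra.IsIntegral.isIntegral f))⟩, ?_⟩
    obtain ⟨x, rfl⟩ := (Module.AEval'.of f).surjective x
    change minpoly ℂ f • Module.AEval.of ℂ (n → ℂ) f x = 0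
    rw [← Module.AEval.of_aeval_smul, minpoly.aeval, zero_smul, map_zero]
  obtain ⟨ι, _, p, hp, e, ⟨φ⟩⟩ := Module.equiv_directSum_of_isTorsion htors
  have hroot : ∀ i, ∃ a, Ideal.span {p i} = Ideal.span {X - C a} := by
    intro i
    have hd := IsAlgClosed.degree_eq_one_of_irreducible ℂ (hp i)
    obtain ⟨a, ha⟩ := IsAlgClosed.exists_root (p i) (by rw [hd]; simp)
    refine ⟨a, Ideal.span_singleton_eq_span_singleton.2 ?_⟩
    exact ((irreducible_X_sub_C a).associated_of_dvd (hp i) (dvd_iff_isRoot.2 ha)).symm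
  choose a ha using hroot
  have hspan : ∀ i, Submodule.span ℂ[X] {p i ^ e i} = Ideal.span {(X - C (a i)) ^ e i} := by
    intro i
    rw [← Ideal.span_singleton_pow, ← ha, Ideal.span_singleton_pow]
  choose v hv using fun i => cyclic_basis (a i) (e i) _ (hspan i)
  let b₀ : Module.Basis (Σ i, Fin (e i)) ℂ (DirectSum ι fun i => ℂ[X] ⧸ Submodule.span ℂ[X] {p i ^ e i}) :=
    DFinsupp.basis v
  let ψ : (n → ℂ) ≃ₗ[ℂ] (DirectSum ι fun i => ℂ[X] ⧸ Submodule.span ℂ[X] {p i ^ e i}) :=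
    (Module.AEval'.of f).trans (φ.restrictScalars ℂ)
  have hψ : ∀ x, ψ (f x) = (X : ℂ[X]) • ψ x := by
    intro x
    change φ (Module.AEval'.of f (f x)) = X • φ (Module.AEval'.of f x)
    rw [← map_smul, Module.AEval'.X_smul_of]
  have hb₀ : ∀ s, b₀ s = DirectSum.lof ℂ[X] ι _ s.1 (v s.1 s.2) := by
    intro s
    change DFinsupp.basis v s = DFinsupp.lsingle (R := ℂ[X]) s.1 (v s.1 s.2)
    change DFinsupp.mapRange.linearEquiv (fun i => (v i).repr.symm)
      (sigmaFinsuppEquivDFinsupp (Finsupp.single s (1 : ℂ))) = DFinsupp.single s.1 (v s.1 s.2)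
    rw [sigmaFinsuppEquivDFinsupp_single]
    simp
  obtain ⟨g⟩ : Nonempty ({i // 0 < e i} ≃ Fin (Fintype.card {i // 0 < e i})) := ⟨Fintype.equivFin _⟩
  set k := Fintype.card {i // 0 < e i}
  let h : Fin k → ι := fun i => (g.symm i).1
  have hinj : Function.Injective h := Subtype.val_injective.comp g.symm.injective
  let ε : (Σ i : Fin k, Fin (e (h i))) ≃ Σ i, Fin (e i) := by
    refine Equiv.ofBijective (fun s => ⟨h s.1, s.2⟩) ⟨?_, ?_⟩
    · rintro ⟨i, x⟩ ⟨j, y⟩ hij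
      simp only [Sigma.mk.injEq] at hij
      obtain ⟨h1, h2⟩ := hij
      obtain rfl := hinj h1
      simpa using h2
    · rintro ⟨i, x⟩
      obtain ⟨j, rfl⟩ : ∃ j, h j = i := ⟨g ⟨i, x.pos⟩, by simp [h]⟩
      exact ⟨⟨j, x⟩, rfl⟩
  let b : Module.Basis (Σ i : Fin k, Fin (e (h i))) ℂ (n → ℂ) := (b₀.reindex ε.symm).map ψ.symm
  have hb : ∀ s, f (b s) = ∑ r, Matrix.blockDiagonal' (fun i => jordanCell (a (h i)) (e (h i))) r s • b r := by
    intro s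
    apply ψ.injective
    rw [hψ, map_sum]
    simp only [map_smul]
    have : ∀ s, ψ (b s) = DirectSum.lof ℂ[X] ι _ (h s.1) (v (h s.1) s.2) := by
      intro s
      have : ψ (b s) = b₀ (ε s) := by simp [b]
      rw [this, hb₀]
      rfl
    simp only [this]
    rw [← map_smul, hv, map_sum, Fintype.sum_sigma, Finset.sum_eq_single s.1]
    · refine Finset.sum_congr rfl fun i _ => ?_
      obtain ⟨s₁, s₂⟩ := s
      rw [Matrix.blockDiagonal'_apply_eq]
      exact (DirectSum.lof ℂ[X] ι _ _).map_smul_of_tower _ _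
    · intro i _ hi
      refine Finset.sum_eq_zero fun j _ => ?_
      obtain ⟨s₁, s₂⟩ := s
      rw [Matrix.blockDiagonal'_apply_ne _ _ _ hi, zero_smul]
    · simp
  refine ⟨k, a ∘ h, e ∘ h, fun i => (g.symm i).2, (Pi.basisFun ℂ n).toMatrix b, b.toMatrix (Pi.basisFun ℂ n), ?_, ?_, ?_⟩
  · exact Module.Basis.toMatrix_mul_toMatrix_flip _ _
  · exact Module.Basis.toMatrix_mul_toMatrix_flip _ _
  · have : LinearMap.toMatrix b b f = Matrix.blockDiagonal' (fun i => jordanCell (a (h i)) (e (h i))) := by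
      ext r s
      rw [LinearMap.toMatrix_apply, hb, map_sum]
      simp [Finsupp.single_apply]
    have h2 := basis_toMatrix_mul_linearMap_toMatrix_mul_basis_toMatrix (Pi.basisFun ℂ n) b (Pi.basisFun ℂ n) b f
    rw [this] at h2
    rw [← LinearMap.toMatrix'_toLin' M, ← hf]
    exact h2.symm

/-- Smith normal form over `ℂ[X]`, with divisibility. -/
theorem exists_smithForm : ∀ (m : ℕ) (A : Matrix (Fin m) (Fin m) ℂ[X]),
    ∃ (d : Fin m → ℂ[X]) (P Q : Matrix (Fin m) (Fin m) ℂ[X]), IsUnit P ∧ IsUnit Q ∧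
      (∀ i j, i ≤ j → d j ∣ d i) ∧ P * A * Q = Matrix.diagonal d := by
  intro m
  induction m with
  | zero => intro A; exact ⟨fun _ => 0, 1, 1, isUnit_one, isUnit_one, fun i => i.elim0, by ext i; exact i.elim0⟩
  | succ m ih =>
    intro A
    by_cases hA : A = 0
    · exact ⟨fun _ => 0, 1, 1, isUnit_one, isUnit_one, fun _ _ _ => dvd_rfl, by simp [hA]⟩
    -- minimal degree of a nonzero entry over all equivalent matrices
    let S : Set ℕ := {k | ∃ P Q : Matrix (Fin (m+1)) (Fin (m+1)) ℂ[X], IsUnit P ∧ IsUnit Q ∧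
      ∃ i j, (P * A * Q) i j ≠ 0 ∧ ((P * A * Q) i j).natDegree = k}
    have hS : S.Nonempty := by
      have : ∃ i j, A i j ≠ 0 := by
        by_contra! h
        exact hA (by ext i j; simp [h i j])
      obtain ⟨i, j, h⟩ := this
      exact ⟨_, 1, 1, isUnit_one, isUnit_one, i, j, by simpa using h, rfl⟩
    have hmin : ∀ P Q : Matrix (Fin (m+1)) (Fin (m+1)) ℂ[X], IsUnit P → IsUnit Q → ∀ i j,
        (P * A * Q) i j ≠ 0 → sInf S ≤ ((P * A * Q) i j).natDegree :=
      fun P Q hP hQ i j h => Nat.sInf_le ⟨P, Q, hP, hQ, i, j, h, rfl⟩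
    -- divisibility in the row and column of a minimal entry
    have hcol : ∀ P Q : Matrix (Fin (m+1)) (Fin (m+1)) ℂ[X], IsUnit P → IsUnit Q → ∀ i j,
        (P * A * Q) i j ≠ 0 → ((P * A * Q) i j).natDegree = sInf S → ∀ i', i' ≠ i →
          (P * A * Q) i j ∣ (P * A * Q) i' j := by
      intro P Q hP hQ i j h0 hd i' hi'
      by_contra hnd
      set x := (P * A * Q) i j with hx
      set y := (P * A * Q) i' j with hy
      have hr : y % x ≠ 0 := fun h => hnd (EuclideanDomain.mod_eq_zero.1 h)
      have hu : IsUnit (Matrix.transvection i' i (-(y / x))) := by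
        rw [Matrix.isUnit_iff_isUnit_det, Matrix.det_transvection_of_ne _ _ hi']
        exact isUnit_one
      have he : (Matrix.transvection i' i (-(y / x)) * P * A * Q) i' j = y % x := by
        rw [Matrix.mul_assoc, Matrix.mul_assoc, ← Matrix.mul_assoc P,
          Matrix.transvection_mul_apply_same, ← hx, ← hy, EuclideanDomain.mod_eq_sub_mul_div]
        ring
      have := hmin _ Q (hu.mul hP) hQ i' j (by rw [he]; exact hr)
      rw [he, ← hd] at this
      exact absurd (Polynomial.natDegree_lt_natDegree hr (EuclideanDomain.mod_lt y h0)) (not_lt.2 this)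
    have hrow : ∀ P Q : Matrix (Fin (m+1)) (Fin (m+1)) ℂ[X], IsUnit P → IsUnit Q → ∀ i j,
        (P * A * Q) i j ≠ 0 → ((P * A * Q) i j).natDegree = sInf S → ∀ j', j' ≠ j →
          (P * A * Q) i j ∣ (P * A * Q) i j' := by
      intro P Q hP hQ i j h0 hd i' hi'
      by_contra hnd
      set x := (P * A * Q) i j with hx
      set y := (P * A * Q) i i' with hy
      have hr : y % x ≠ 0 := fun h => hnd (EuclideanDomain.mod_eq_zero.1 h)
      have hu : IsUnit (Matrix.transvection j i' (-(y / x))) := by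
        rw [Matrix.isUnit_iff_isUnit_det, Matrix.det_transvection_of_ne _ _ hi'.symm]
        exact isUnit_one
      have he : (P * A * (Q * Matrix.transvection j i' (-(y / x)))) i i' = y % x := by
        rw [← Matrix.mul_assoc,
          Matrix.mul_transvection_apply_same, ← hx, ← hy, EuclideanDomain.mod_eq_sub_mul_div]
        ring
      have := hmin P _ hP (hQ.mul hu) i i' (by rw [he]; exact hr)
      rw [he, ← hd] at this
      exact absurd (Polynomial.natDegree_lt_natDegree hr (EuclideanDomain.mod_lt y h0)) (not_lt.2 this)
    -- move the minimal entry to the last place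
    obtain ⟨P₀, Q₀, hP₀, hQ₀, i₀, j₀, hne, hdeg⟩ := Nat.sInf_mem hS
    have perm : ∀ σ : Equiv.Perm (Fin (m+1)), IsUnit (σ.toPEquiv.toMatrix : Matrix _ _ ℂ[X]) := by
      intro σ
      rw [Matrix.isUnit_iff_isUnit_det, Matrix.det_permutation]
      exact (Equiv.Perm.sign σ).isUnit.map (Int.castRingHom ℂ[X])
    let l : Fin (m+1) := Fin.last m
    obtain ⟨P₁, Q₁, hP₁, hQ₁, hne₁, hdeg₁⟩ : ∃ P₁ Q₁ : Matrix (Fin (m+1)) (Fin (m+1)) ℂ[X],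
        IsUnit P₁ ∧ IsUnit Q₁ ∧ (P₁ * A * Q₁) l l ≠ 0 ∧
        ((P₁ * A * Q₁) l l).natDegree = sInf S := by
      refine ⟨(Equiv.swap l i₀).toPEquiv.toMatrix * P₀, Q₀ * (Equiv.swap l j₀).toPEquiv.toMatrix,
        (perm _).mul hP₀, hQ₀.mul (perm _), ?_⟩
      have : (((Equiv.swap l i₀).toPEquiv.toMatrix * P₀ * A : Matrix (Fin (m+1)) (Fin (m+1)) ℂ[X]) *
          (Q₀ * (Equiv.swap l j₀).toPEquiv.toMatrix) : Matrix (Fin (m+1)) (Fin (m+1)) ℂ[X]) l l = (P₀ * A * Q₀) i₀ j₀ := by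
        rw [← Matrix.mul_assoc, PEquiv.mul_toMatrix_toPEquiv, Matrix.mul_assoc, Matrix.mul_assoc,
          PEquiv.toMatrix_toPEquiv_mul]
        simp [Matrix.mul_assoc]
      rw [this]
      exact ⟨hne, hdeg⟩
    obtain ⟨P₂, Q₂, hP₂, hQ₂, hne₂, hdeg₂, hc, hr⟩ : ∃ P₂ Q₂ : Matrix (Fin (m+1)) (Fin (m+1)) ℂ[X],
        IsUnit P₂ ∧ IsUnit Q₂ ∧ (P₂ * A * Q₂) l l ≠ 0 ∧
        ((P₂ * A * Q₂) l l).natDegree = sInf S ∧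
        (∀ i, i ≠ l → (P₂ * A * Q₂) i l = 0) ∧ (∀ j, j ≠ l → (P₂ * A * Q₂) l j = 0) := by
      set B := P₁ * A * Q₁ with hB
      let U : Matrix (Fin (m+1)) (Fin (m+1)) ℂ[X] :=
        Matrix.of fun i j => if i = j then 1 else if j = l then -(B i l / B l l) else 0
      let W : Matrix (Fin (m+1)) (Fin (m+1)) ℂ[X] :=
        Matrix.of fun i j => if i = j then 1 else if i = l then -(B l j / B l l) else 0
      have hU : IsUnit U := by
        rw [Matrix.isUnit_iff_isUnit_det, Matrix.det_of_isUpperTriangular]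
        · simp [U]
        · intro i j hij
          have h1 : i ≠ j := fun h => by simp [h] at hij
          have h2 : j ≠ l := fun h => by
            rw [h] at hij; exact absurd (Fin.le_last i) (not_le.2 hij)
          simp [U, h1, h2]
      have hW : IsUnit W := by
        rw [Matrix.isUnit_iff_isUnit_det, Matrix.det_of_isLowerTriangular]
        · simp [W]
        · intro i j hij
          have hij' : i < j := hij
          have h1 : i ≠ j := hij'.ne
          have h2 : i ≠ l := fun h => by
            rw [h] at hij'; exact absurd (Fin.le_last j) (not_le.2 hij')
          simp [W, h1, h2]
      have hUl : ∀ (M : Matrix (Fin (m+1)) (Fin (m+1)) ℂ[X]) j, (U * M) l j = M l j := by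
        intro M j
        rw [Matrix.mul_apply, Finset.sum_eq_single l]
        · simp [U]
        · intro k _ hk; simp [U, hk, hk.symm]
        · simp
      have hUi : ∀ (M : Matrix (Fin (m+1)) (Fin (m+1)) ℂ[X]) i j, i ≠ l →
          (U * M) i j = M i j - B i l / B l l * M l j := by
        intro M i j hi
        rw [Matrix.mul_apply, Finset.sum_eq_add i l hi]
        · simp [U, hi]; ring
        · intro k _ hk; simp [U, hk.1.symm, hk.2]
        · simp
        · simp
      have hWl : ∀ (M : Matrix (Fin (m+1)) (Fin (m+1)) ℂ[X]) i, (M * W) i l = M i l := by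
        intro M i
        rw [Matrix.mul_apply, Finset.sum_eq_single l]
        · simp [W]
        · intro k _ hk; simp [W, hk]
        · simp
      have hWj : ∀ (M : Matrix (Fin (m+1)) (Fin (m+1)) ℂ[X]) i j, j ≠ l →
          (M * W) i j = M i j - M i l * (B l j / B l l) := by
        intro M i j hj
        rw [Matrix.mul_apply, Finset.sum_eq_add j l hj]
        · simp [W, hj.symm]; ring
        · intro k _ hk; simp [W, hk.1, hk.2]
        · simp
        · simp
      have hE : U * P₁ * A * (Q₁ * W) = U * B * W := by rw [hB]; simp only [Matrix.mul_assoc]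
      refine ⟨U * P₁, Q₁ * W, hU.mul hP₁, hQ₁.mul hW, ?_⟩
      rw [hE]
      refine ⟨by rwa [hWl, hUl], by rwa [hWl, hUl], fun i hi => ?_, fun j hj => ?_⟩
      · rw [hWl, hUi _ _ _ hi, mul_comm,
          EuclideanDomain.mul_div_cancel' hne₁ (hcol P₁ Q₁ hP₁ hQ₁ l l hne₁ hdeg₁ i hi), sub_self]
      · rw [hWj _ _ _ hj, hUl, hUl,
          EuclideanDomain.mul_div_cancel' hne₁ (hrow P₁ Q₁ hP₁ hQ₁ l l hne₁ hdeg₁ j hj), sub_self]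
    set x := (P₂ * A * Q₂) l l with hx
    -- the pivot divides every entry
    have hall : ∀ i j : Fin m, x ∣ (P₂ * A * Q₂) i.castSucc j.castSucc := by
      intro i j
      have hi : l ≠ i.castSucc := (Fin.castSucc_lt_last i).ne'
      have hj : j.castSucc ≠ l := (Fin.castSucc_lt_last j).ne
      have hu : IsUnit (Matrix.transvection l i.castSucc (1 : ℂ[X])) := by
        rw [Matrix.isUnit_iff_isUnit_det, Matrix.det_transvection_of_ne _ _ hi]
        exact isUnit_one
      have e : ∀ j, (Matrix.transvection l i.castSucc (1 : ℂ[X]) * P₂ * A * Q₂) l j =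
          (P₂ * A * Q₂) l j + (P₂ * A * Q₂) i.castSucc j := by
        intro j
        rw [Matrix.mul_assoc, Matrix.mul_assoc, ← Matrix.mul_assoc P₂,
          Matrix.transvection_mul_apply_same, one_mul]
      have el := e l
      rw [hc _ hi.symm, add_zero, ← hx] at el
      have := hrow _ Q₂ (hu.mul hP₂) hQ₂ l l (by rwa [el]) (by rwa [el]) _ hj
      rwa [el, e, hr _ hj, zero_add] at this
    choose B'' hB'' using hall
    obtain ⟨d', P', Q', hP', hQ', hd', he'⟩ := ih (Matrix.of B'')
    let e : Fin m ⊕ Fin 1 ≃ Fin (m+1) := finSumFinEquiv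
    have hblk : (P₂ * A * Q₂) = (Matrix.fromBlocks (x • Matrix.of B'') 0 0
        (Matrix.diagonal fun _ => x)).submatrix e.symm e.symm := by
      refine Matrix.ext fun i j => ?_
      obtain ⟨i, rfl⟩ := e.surjective i
      obtain ⟨j, rfl⟩ := e.surjective j
      have hl : ∀ k : Fin 1, e (Sum.inr k) = l := fun k => by
        ext; simp [e, l, Fin.eq_zero k]
      have hcs : ∀ k : Fin m, e (Sum.inl k) = k.castSucc := fun k => by
        ext; simp [e]
      rw [Matrix.submatrix_apply, Equiv.symm_apply_apply, Equiv.symm_apply_apply]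
      rcases i with i | i <;> rcases j with j | j
      · rw [hcs, hcs, hB'', Matrix.fromBlocks_apply₁₁]; rfl
      · rw [hcs, hl, Matrix.fromBlocks_apply₁₂]; exact hc _ (Fin.castSucc_lt_last i).ne
      · rw [hcs, hl, Matrix.fromBlocks_apply₂₁]; exact hr _ (Fin.castSucc_lt_last j).ne
      · rw [hl, hl, Matrix.fromBlocks_apply₂₂, Subsingleton.elim i j, Matrix.diagonal_apply_eq]
    have hunit : ∀ M : Matrix (Fin m) (Fin m) ℂ[X], IsUnit M →
        IsUnit ((Matrix.fromBlocks M 0 0 (1 : Matrix (Fin 1) (Fin 1) ℂ[X])).submatrix e.symm e.symm) := by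
      intro M hM
      rw [Matrix.isUnit_iff_isUnit_det, Matrix.det_submatrix_equiv_self,
        Matrix.det_fromBlocks_zero₂₁, Matrix.det_one, mul_one, ← Matrix.isUnit_iff_isUnit_det]
      exact hM
    refine ⟨fun i => Sum.elim (fun k => x * d' k) (fun _ => x) (e.symm i), _, _,
      (hunit P' hP').mul hP₂, hQ₂.mul (hunit Q' hQ'), ?_, ?_⟩
    · intro i j hij
      obtain ⟨i, rfl⟩ := e.surjective i
      obtain ⟨j, rfl⟩ := e.surjective j
      rcases i with i | i <;> rcases j with j | j <;>
        simp only [Equiv.symm_apply_apply, Sum.elim_inl, Sum.elim_inr]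
      · exact mul_dvd_mul_left _ (hd' i j hij)
      · exact dvd_mul_right _ _
      · exfalso
        have : (e (Sum.inr i) : ℕ) ≤ (e (Sum.inl j) : ℕ) := hij
        simp [e] at this
        omega
      · exact dvd_rfl
    · have hE : ∀ X Y : Matrix (Fin (m+1)) (Fin (m+1)) ℂ[X],
          X * P₂ * A * (Q₂ * Y) = X * (P₂ * A * Q₂) * Y := by
        intro X Y; simp only [Matrix.mul_assoc]
      rw [hE, hblk, Matrix.submatrix_mul_equiv, Matrix.submatrix_mul_equiv,
        Matrix.fromBlocks_multiply, Matrix.fromBlocks_multiply]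
      simp only [Matrix.mul_zero, Matrix.zero_mul, add_zero, zero_add, Matrix.one_mul,
        Matrix.mul_one, Matrix.mul_smul, Matrix.smul_mul, he']
      ext i j
      obtain ⟨i, rfl⟩ := e.surjective i
      obtain ⟨j, rfl⟩ := e.surjective j
      rcases i with i | i <;> rcases j with j | j <;>
        simp [Matrix.diagonal_apply]

/-- Every square polynomial matrix has elementary divisors. -/
theorem exists_isElementaryDivisors {m : ℕ} (A : Matrix (Fin m) (Fin m) ℂ[X]) :
    ∃ d, IsElementaryDivisors A d := by
  obtain ⟨d, P, Q, hP, hQ, hd, h⟩ := exists_smithForm m A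
  exact ⟨d, hd, hP.unit, hQ.unit, h⟩

/-- A Fuchsian equation has a rigidity index. -/
theorem exists_isRigidityIndex {m N : ℕ} {R : Matrix (Fin m) (Fin m) (RatFunc ℂ)}
    {A : Matrix (Fin m) (Fin m) ℂ[X]} (hA : IsCanonicalForm R N A) (hF : IsFuchsianPoly N A) :
    ∃ r, IsRigidityIndex R r := by
  obtain ⟨k₀, α₀, t₀, h₀⟩ := exists_isJordanForm (matCoeff A 0)
  obtain ⟨k₁, α₁, t₁, h₁⟩ := exists_isJordanForm (matCoeff A N)
  obtain ⟨d, hd⟩ := exists_isElementaryDivisors A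
  exact ⟨_, N, A, hA, hF, k₀, α₀, t₀, k₁, α₁, t₁, d, h₀, h₁, hd, rfl⟩

end Rigidity

/-! Write c = q^λ, rₖ = rank Bₖ and Bₖ = colₖ rowₖ with colₖ injective and rowₖ surjective. Each
partition in the index is encoded by a sequence of dimensions whose increments are the parts of the
conjugate partition (`sqSum_min`). For a constant matrix f it is dim ker (f - a)^j. For A(x) it is
the dimension of the space of solutions of A v = 0 killed by (x - a)^j, with components in the
injective hull of ℂ[x]/(x - a). The index thus makes sense for every Fuchsian polynomial system.
Multiplication by a scalar polynomial f adds m² deg f both to the divisor term and to m²N, whence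
the index depends only on the gauge class (`isRigidityIndex_iff`).

Each of the three terms is reduced to data on the spaces im Bₖ. If j : V → U is injective and s : U
→ V surjective, then js and sj agree at nonzero eigenvalues, and at 0 the sequence of js is that of
sj with the increment dim U - dim V prepended (`spectralIndex_comp`). So B₀ = col₀ row₀ contributes
the index of row₀ col₀ plus (m - r₀)², and 1 - B_∞ = ∑ colₖ rowₖ contributes the index of the block
matrix (rowₖ colₗ) minus (∑ rₖ - m)². For A(x), write B(x) = (1 - B₀) + ∑ (x/bₖ)/(1 - x/bₖ) colₖ
rowₖ and eliminate v. What remains is a linear pencil in the variables uₖ with matrix Zₖₗ = rowₖ (1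
- B₀)⁻¹ colₗ. Its solutions have the dimensions of those of A away from the bₖ, and at bₖ the
increment m - rₖ is prepended (`Realization.divisorIndex_eq`).

The middle convolution factors through the same spaces. The induced maps are F̄ₖ = mcColₖ mcRowₖ for
k ≥ 1, the new B₀ is mcCol₀ mcRow₀ + (1 - c), and mcRowₖ mcColₗ = rowₖ colₗ - (1 - c)δₖₗ; (∗) and
(∗∗) make mcColₖ injective and mcRowₖ surjective. Hence the exchanged operators at 0 and ∞ change by
a scalar, and Z becomes c⁻¹(Z - (1 - c)), a change undone by substituting cx for x
(`pencilSol_rescale`). Only the squares remain, and in them the size m cancels: (m - r₀)² - (∑ rₖ -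
m)² + ∑_{k≥1} (m - rₖ)² - m²N = ∑ rₖ² - (∑ rₖ)². -/

/-! ### Conjugate partitions as increments of sequences -/

/-- The sum of the squares of the increments of a sequence of natural numbers. -/
noncomputable def sqSum (κ : ℕ → ℕ) : ℤ :=
  ∑ᶠ j, ((κ (j + 1) : ℤ) - κ j) ^ 2

/-- A `finsum` of infinite support is 0 by convention, so the stabilization of the sequence is what
gives `sqSum` its meaning. -/
theorem sqSum_eq_sum {κ : ℕ → ℕ} {n : ℕ} (hn : ∀ j, n ≤ j → κ j = κ n) :
    sqSum κ = ∑ j ∈ Finset.range n, ((κ (j + 1) : ℤ) - κ j) ^ 2 := by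
  refine finsum_eq_sum_of_support_subset _ fun j hj => ?_
  by_contra h
  have h' : n ≤ j := by simpa using h
  exact hj (by simp [hn j h', hn (j + 1) (by omega)])

theorem sqSum_const (d : ℕ) : sqSum (fun _ => d) = 0 := by
  simp [sqSum]

/-- Prepending an increment `d` to a sequence adds `d ^ 2` to the sum of squares. -/
theorem sqSum_shift {κ κ' : ℕ → ℕ} {d : ℤ} (hκ : ∃ n, ∀ j, n ≤ j → κ j = κ n)
    (h0 : κ 0 = 0) (h0' : κ' 0 = 0) (h : ∀ j, (κ' (j + 1) : ℤ) = d + κ j) :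
    sqSum κ' = sqSum κ + d ^ 2 := by
  obtain ⟨n, hn⟩ := hκ
  have hn' : ∀ j, n + 1 ≤ j → κ' j = κ' (n + 1) := by
    intro j hj
    obtain ⟨i, rfl⟩ : ∃ i, j = i + 1 := ⟨j - 1, by omega⟩
    have h1 := h i
    have h2 := h n
    rw [hn i (by omega)] at h1
    omega
  rw [sqSum_eq_sum hn, sqSum_eq_sum hn', Finset.sum_range_succ']
  simp [h, h0, h0']

/-- A part `a` contributes `min (j + 1) a - min j a`, which is 1 if `j + 1 ≤ a` and 0 otherwise. -/
theorem conjPart_eq_sub (s : Multiset ℕ) (j : ℕ) :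
    (conjPart s (j + 1) : ℤ) = ((s.map (min (j + 1))).sum : ℕ) - ((s.map (min j)).sum : ℕ) := by
  induction s using Multiset.induction_on with
  | empty => simp [conjPart]
  | cons a s ih =>
    unfold conjPart at ih ⊢
    rw [Multiset.filter_cons, Multiset.card_add, Multiset.map_cons, Multiset.sum_cons,
      Multiset.map_cons, Multiset.sum_cons, Nat.cast_add, Nat.cast_add, Nat.cast_add, ih]
    by_cases h : j + 1 ≤ a
    · rw [if_pos h, Multiset.card_singleton, min_eq_left h, min_eq_left (by omega)]
      push_cast
      ring
    · rw [if_neg h, Multiset.card_zero, min_eq_right (by omega), min_eq_right (by omega)]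
      push_cast
      ring

theorem sum_map_min_of_sup_le (s : Multiset ℕ) {j : ℕ} (h : s.sup ≤ j) :
    (s.map (min j)).sum = s.sum := by
  congr 1
  conv_rhs => rw [← Multiset.map_id s]
  exact Multiset.map_congr rfl fun a ha => min_eq_right ((Multiset.le_sup ha).trans h)

/-- This is the bridge from partitions to dimensions: both for Jordan cells and for elementary
divisors the dimension at level `j` is a sum of terms `min j t` over the parts `t`. -/
theorem sqSum_min (s : Multiset ℕ) :
    sqSum (fun j => (s.map (min j)).sum) = sumSqConj s := by
  rw [sqSum_eq_sum (n := s.sup)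
    fun j hj => by rw [sum_map_min_of_sup_le s hj, sum_map_min_of_sup_le s le_rfl]]
  simp only [sumSqConj, ← conjPart_eq_sub]
  push_cast
  rw [Finset.range_eq_Ico, Finset.sum_Ico_add' (fun j => (conjPart s j : ℤ) ^ 2) 0 s.sup 1]
  rfl

theorem sumSqConj_eq_zero {s : Multiset ℕ} (h : ∀ a ∈ s, a = 0) : sumSqConj s = 0 := by
  have : s.sup = 0 := by
    have := Multiset.sup_le (s := s) (a := 0) |>.2 fun b hb => (h b hb).le
    omega
  simp [sumSqConj, this]

/-- The sum of a finitely supported function and of point masses. -/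
theorem finsum_add_point_masses {α ι : Type*} [Fintype ι] (F G : α → ℤ) (b : ι → α) (D : ι → ℤ)
    (hG : (Function.support G).Finite) [DecidableEq α]
    (h : ∀ a, F a = G a + ∑ i, if a = b i then D i else 0) :
    ∑ᶠ a, F a = ∑ᶠ a, G a + ∑ i, D i := by
  have hs : ∀ i, (Function.support fun a => if a = b i then D i else 0).Finite := fun i =>
    (Set.finite_singleton (b i)).subset fun a ha => by
      by_contra hne
      exact ha (if_neg hne)
  rw [finsum_congr h, finsum_add_distrib hG, finsum_sum_comm _ _ fun i _ => hs i]
  · congr 1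
    refine Finset.sum_congr rfl fun i _ => ?_
    rw [finsum_eq_single _ (b i) fun a ha => if_neg ha, if_pos rfl]
  · refine (Set.finite_iUnion hs).subset fun a ha => ?_
    by_contra hne
    simp only [Set.mem_iUnion, not_exists, Function.mem_support, not_not] at hne
    exact ha (Finset.sum_eq_zero fun i _ => hne i)

/-! ### The contribution of a constant matrix through kernel dimensions -/

section SpectralIndex

variable {V U : Type*} [AddCommGroup V] [Module ℂ V] [AddCommGroup U] [Module ℂ U]

/-- The dimension of the kernel of `(f - a) ^ k`. -/
noncomputable def kerDim (f : Module.End ℂ V) (a : ℂ) (k : ℕ) : ℕ :=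
  Module.finrank ℂ (LinearMap.ker ((f - algebraMap ℂ _ a) ^ k))

/-- `∑ᵢ ∑ⱼ m_{i,j}²`, where `m_{i,1}, m_{i,2}, …` is the conjugate of the partition formed by the
sizes of the Jordan cells with the `i`-th eigenvalue. -/
noncomputable def spectralIndex (f : Module.End ℂ V) : ℤ :=
  ∑ᶠ a, sqSum (kerDim f a)

theorem kerDim_zero (f : Module.End ℂ V) (a : ℂ) : kerDim f a 0 = 0 := by
  rw [kerDim, pow_zero, Module.End.one_eq_id, LinearMap.ker_id, finrank_bot]

theorem kerDim_conj (e : V ≃ₗ[ℂ] U) (f : Module.End ℂ V) (g : Module.End ℂ U)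
    (h : ∀ v, e (f v) = g (e v)) : kerDim f = kerDim g := by
  funext a k
  have hk : ∀ v, e (((f - algebraMap ℂ _ a) ^ k) v) = ((g - algebraMap ℂ _ a) ^ k) (e v) := by
    intro v
    induction k with
    | zero => simp
    | succ k ih =>
      rw [pow_succ', Module.End.mul_apply, pow_succ', Module.End.mul_apply, ← ih]
      simp [h]
  have : LinearMap.ker ((g - algebraMap ℂ _ a) ^ k) =
      (LinearMap.ker ((f - algebraMap ℂ _ a) ^ k)).map (e : V →ₗ[ℂ] U) := by
    ext u
    rw [Submodule.mem_map_equiv, LinearMap.mem_ker, LinearMap.mem_ker,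
      ← e.map_eq_zero_iff (x := ((f - algebraMap ℂ _ a) ^ k) (e.symm u)), hk, e.apply_symm_apply]
  rw [kerDim, kerDim, this]
  exact (e.submoduleMap _).finrank_eq

theorem spectralIndex_conj (e : V ≃ₗ[ℂ] U) (f : Module.End ℂ V) (g : Module.End ℂ U)
    (h : ∀ v, e (f v) = g (e v)) : spectralIndex f = spectralIndex g := by
  rw [spectralIndex, spectralIndex, kerDim_conj e f g h]

/-- The eigenvalues are translated and the kernels kept. Together with `spectralIndex_smul` this
makes affine changes such as `1 - B₀` or the shift by `1 - q^λ` harmless. -/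
theorem spectralIndex_add_const (f : Module.End ℂ V) (c : ℂ) :
    spectralIndex (f + algebraMap ℂ _ c) = spectralIndex f := by
  rw [spectralIndex, spectralIndex, ← finsum_comp_equiv (Equiv.addRight c)]
  refine finsum_congr fun a => ?_
  congr 1
  funext k
  have : f + algebraMap ℂ (Module.End ℂ V) c - algebraMap ℂ _ (a + c) = f - algebraMap ℂ _ a := by
    rw [map_add]
    abel
  rw [Equiv.coe_addRight, kerDim, kerDim, this]

theorem spectralIndex_smul (f : Module.End ℂ V) {c : ℂ} (hc : c ≠ 0) :
    spectralIndex (c • f) = spectralIndex f := by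
  rw [spectralIndex, spectralIndex, ← finsum_comp_equiv (Equiv.mulLeft₀ c hc)]
  refine finsum_congr fun a => ?_
  congr 1
  funext k
  change kerDim (c • f) (c * a) k = _
  have : c • f - algebraMap ℂ (Module.End ℂ V) (c * a) = c • (f - algebraMap ℂ _ a) := by
    rw [smul_sub, map_mul, Algebra.smul_def c (algebraMap ℂ (Module.End ℂ V) a)]
  rw [kerDim, kerDim, this, _root_.smul_pow, LinearMap.ker_smul _ _ (pow_ne_zero k hc)]

variable [FiniteDimensional ℂ V] [FiniteDimensional ℂ U]

theorem kerDim_mono (f : Module.End ℂ V) (a : ℂ) : Monotone (kerDim f a) := by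
  refine monotone_nat_of_le_succ fun k => Submodule.finrank_mono fun v hv => ?_
  rw [LinearMap.mem_ker] at hv ⊢
  rw [pow_succ', Module.End.mul_apply, hv, map_zero]

theorem exists_stable_of_monotone {κ : ℕ → ℕ} (hκ : Monotone κ) {B : ℕ} (hB : ∀ k, κ k ≤ B) :
    ∃ n, ∀ j, n ≤ j → κ j = κ n := by
  have hbdd : BddAbove (Set.range κ) := ⟨B, by rintro _ ⟨k, rfl⟩; exact hB k⟩
  obtain ⟨n, hn⟩ := Nat.sSup_mem (Set.range_nonempty κ) hbdd
  refine ⟨n, fun j hj => le_antisymm ?_ (hκ hj)⟩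
  rw [hn]
  exact le_csSup hbdd ⟨j, rfl⟩

theorem kerDim_stable (f : Module.End ℂ V) (a : ℂ) :
    ∃ n, ∀ j, n ≤ j → kerDim f a j = kerDim f a n :=
  exists_stable_of_monotone (kerDim_mono f a) fun _ => Submodule.finrank_le _

theorem support_sqSum_kerDim_finite (f : Module.End ℂ V) :
    (Function.support fun a => sqSum (kerDim f a)).Finite := by
  refine f.finite_hasEigenvalue.subset fun a ha => ?_
  by_contra h
  refine ha ?_
  have h1 : LinearMap.ker (f - algebraMap ℂ _ a) = ⊥ := by
    have h2 : f.eigenspace a = ⊥ := by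
      by_contra h3
      exact h h3
    rwa [Module.End.eigenspace_def] at h2
  have : kerDim f a = fun _ => 0 := by
    funext k
    have h3 : Function.Injective ((f - algebraMap ℂ (Module.End ℂ V) a) ^ k) := by
      rw [Module.End.coe_pow]
      exact (LinearMap.ker_eq_bot.1 h1).iterate k
    rw [kerDim, LinearMap.ker_eq_bot.2 h3, finrank_bot]
  simp only [this, sqSum_const]

-- The map `h` intertwines `g ∘ h` with `h ∘ g`, hence sends one kernel into the other. It is
-- injective there, because on `ker h` the operator `(g ∘ h - a) ^ k` is the scalar `(-a) ^ k ≠ 0`.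
-- Exchanging `g` and `h` gives the opposite inequality.
omit [FiniteDimensional ℂ U] in
theorem kerDim_comp_le (g : V →ₗ[ℂ] U) (h : U →ₗ[ℂ] V) {a : ℂ} (ha : a ≠ 0) (k : ℕ) :
    kerDim (g ∘ₗ h) a k ≤ kerDim (h ∘ₗ g) a k := by
  have hcomm : ∀ u, ((h ∘ₗ g - algebraMap ℂ (Module.End ℂ V) a) ^ k) (h u) =
      h (((g ∘ₗ h - algebraMap ℂ (Module.End ℂ U) a) ^ k) u) := by
    induction k with
    | zero => simp
    | succ k ih =>
      intro u
      rw [pow_succ', Module.End.mul_apply, ih, pow_succ', Module.End.mul_apply]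
      simp
  have hker : ∀ u, h u = 0 → ((g ∘ₗ h - algebraMap ℂ (Module.End ℂ U) a) ^ k) u = (-a) ^ k • u := by
    intro u hu
    clear hcomm
    induction k with
    | zero => simp
    | succ k ih =>
      rw [pow_succ', Module.End.mul_apply, ih]
      simp [hu, pow_succ, mul_smul]
  refine LinearMap.finrank_le_finrank_of_injective
    (f := (h.domRestrict _).codRestrict _ fun u => ?_) ?_
  · rw [LinearMap.mem_ker, LinearMap.domRestrict_apply, hcomm, LinearMap.mem_ker.1 u.2, map_zero]
  · rw [← LinearMap.ker_eq_bot, LinearMap.ker_codRestrict, LinearMap.ker_eq_bot']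
    rintro ⟨u, hu⟩ h0
    rw [LinearMap.mem_ker, hker u h0] at hu
    exact Subtype.ext ((smul_eq_zero.1 hu).resolve_left (pow_ne_zero k (neg_ne_zero.2 ha)))

/-- One has `(j s)^(k+1) = j (s j)^k s`. The injective `j` does not affect the kernel, and the
surjective `s` enlarges it by `dim ker s = dim U - dim V`. -/
theorem finrank_ker_pow_comp_zero (j : V →ₗ[ℂ] U) (s : U →ₗ[ℂ] V) (hj : Function.Injective j)
    (hs : Function.Surjective s) (k : ℕ) :
    (kerDim (j ∘ₗ s) 0 (k + 1) : ℤ) =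
      (Module.finrank ℂ U - Module.finrank ℂ V) + kerDim (s ∘ₗ j) 0 k := by
  have hpow : (j ∘ₗ s : Module.End ℂ U) ^ (k + 1) =
      j ∘ₗ ((s ∘ₗ j : Module.End ℂ V) ^ k : Module.End ℂ V) ∘ₗ s := by
    induction k with
    | zero => simp; rfl
    | succ k ih =>
      rw [pow_succ, ih, pow_succ]
      rfl
  have h1 := LinearMap.finrank_range_add_finrank_ker (((s ∘ₗ j : Module.End ℂ V) ^ k : Module.End ℂ V) ∘ₗ s)
  have h2 := LinearMap.finrank_range_add_finrank_ker ((s ∘ₗ j : Module.End ℂ V) ^ k)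
  rw [LinearMap.range_comp_of_range_eq_top _ (LinearMap.range_eq_top.2 hs)] at h1
  rw [kerDim, kerDim, map_zero, map_zero, sub_zero, sub_zero, hpow, LinearMap.ker_comp_of_ker_eq_bot _ (LinearMap.ker_eq_bot.2 hj)]
  omega

/-- Interchanging the factors of `j ∘ s` with `s` surjective and `j` injective. -/
theorem spectralIndex_comp (j : V →ₗ[ℂ] U) (s : U →ₗ[ℂ] V) (hj : Function.Injective j)
    (hs : Function.Surjective s) :
    spectralIndex (j ∘ₗ s) =
      spectralIndex (s ∘ₗ j) + ((Module.finrank ℂ U : ℤ) - Module.finrank ℂ V) ^ 2 := by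
  classical
  have := finsum_add_point_masses (fun a => sqSum (kerDim (j ∘ₗ s) a))
    (fun a => sqSum (kerDim (s ∘ₗ j) a)) (fun _ : Unit => (0 : ℂ))
    (fun _ => ((Module.finrank ℂ U : ℤ) - Module.finrank ℂ V) ^ 2)
    (support_sqSum_kerDim_finite _) ?_
  · simpa [spectralIndex] using this
  · intro a
    simp only [Finset.univ_unique, Finset.sum_const, Finset.card_singleton, one_smul]
    split_ifs with h
    · rw [h]
      exact sqSum_shift (kerDim_stable _ _) (kerDim_zero _ _) (kerDim_zero _ _)
        (finrank_ker_pow_comp_zero j s hj hs)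
    · rw [add_zero]
      congr 1
      exact funext fun k => le_antisymm (kerDim_comp_le _ _ h k) (kerDim_comp_le _ _ h k)

end SpectralIndex

/-- The dimension of a product of subspaces. -/
theorem finrank_submodule_pi {ι : Type*} [Fintype ι] {V : ι → Type*} [∀ i, AddCommGroup (V i)]
    [∀ i, Module ℂ (V i)] (S : ∀ i, Submodule ℂ (V i)) [∀ i, FiniteDimensional ℂ (S i)] :
    Module.finrank ℂ (Submodule.pi Set.univ S) = ∑ i, Module.finrank ℂ (S i) := by
  let e : (∀ i, S i) ≃ₗ[ℂ] Submodule.pi Set.univ S :=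
    { toFun := fun v => ⟨fun i => v i, fun i _ => (v i).2⟩
      invFun := fun v i => ⟨v.1 i, v.2 i trivial⟩
      map_add' := fun _ _ => rfl
      map_smul' := fun _ _ => rfl
      left_inv := fun _ => rfl
      right_inv := fun _ => rfl }
  rw [← e.finrank_eq, Module.finrank_pi_fintype]

/-! ### Kernel dimensions of Jordan forms -/

section Jordan

/-- The action of a nilpotent Jordan cell shifts the components. -/
theorem jordanCell_sub_pow_apply (a : ℂ) (t k : ℕ) (v : Fin t → ℂ) (i : Fin t) :
    ((Matrix.toLin' (jordanCell a t) - algebraMap ℂ (Module.End ℂ (Fin t → ℂ)) a) ^ k) v i =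
      if h : (i : ℕ) + k < t then v ⟨i + k, h⟩ else 0 := by
  have hcell : ∀ (v : Fin t → ℂ) (i : Fin t),
      (Matrix.toLin' (jordanCell a t) - algebraMap ℂ (Module.End ℂ (Fin t → ℂ)) a) v i =
      if h : (i : ℕ) + 1 < t then v ⟨i + 1, h⟩ else 0 := by
    intro v i
    have hs : ∀ j : Fin t, jordanCell a t i j * v j =
        (if i = j then a * v j else 0) + (if (i : ℕ) + 1 = j then v j else 0) := by
      intro j
      by_cases h1 : i = j
      · subst h1; simp [jordanCell]
      · by_cases h2 : (i : ℕ) + 1 = j <;> simp [jordanCell, h1, h2]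
    rw [LinearMap.sub_apply, Pi.sub_apply, Matrix.toLin'_apply, Matrix.mulVec, dotProduct,
      Finset.sum_congr rfl fun j _ => hs j, Finset.sum_add_distrib, Finset.sum_ite_eq]
    simp only [Finset.mem_univ, if_true, Module.algebraMap_end_apply, Pi.smul_apply, smul_eq_mul,
      add_sub_cancel_left]
    split_ifs with h
    · rw [Finset.sum_eq_single ⟨i + 1, h⟩, if_pos rfl]
      · exact fun j _ hj => if_neg fun h' => hj (Fin.ext h'.symm)
      · simp
    · exact Finset.sum_eq_zero fun j _ => if_neg fun h' => h (by omega)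
  induction k generalizing i with
  | zero => simp
  | succ k ih =>
    rw [pow_succ', Module.End.mul_apply, hcell]
    split_ifs with h1 h2 h2
    · rw [ih, dif_pos (show (i : ℕ) + 1 + k < t by omega)]
      congr 2
      exact (by omega : (i : ℕ) + 1 + k = i + (k + 1))
    · rw [ih, dif_neg (show ¬ (i : ℕ) + 1 + k < t by omega)]
    · omega
    · rfl

theorem kerDim_jordanCell (b : ℂ) (t : ℕ) (a : ℂ) (k : ℕ) :
    kerDim (Matrix.toLin' (jordanCell b t)) a k = if b = a then min k t else 0 := by
  split_ifs with h
  · subst h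
    -- The `k`-th power of the nilpotent part kills exactly the vectors supported on the first `k`
    -- coordinates, of which there are `min k t`.
    have hker : LinearMap.ker
        ((Matrix.toLin' (jordanCell b t) - algebraMap ℂ (Module.End ℂ (Fin t → ℂ)) b) ^ k) =
        ⨅ i ∈ {i : Fin t | ¬ (i : ℕ) < k},
          LinearMap.ker (LinearMap.proj i : (Fin t → ℂ) →ₗ[ℂ] ℂ) := by
      ext v
      simp only [LinearMap.mem_ker, Submodule.mem_iInf, LinearMap.proj_apply, Set.mem_ofPred_eq]
      constructor
      · intro hv i hi
        have := congrFun hv ⟨i - k, by omega⟩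
        rw [jordanCell_sub_pow_apply, dif_pos (by simp; omega)] at this
        rw [← Pi.zero_apply (M := fun _ : Fin t => ℂ) ⟨i - k, by omega⟩, ← this]
        congr 1
        ext
        simp
        omega
      · intro hv
        ext i
        rw [jordanCell_sub_pow_apply]
        split_ifs with h
        · exact hv _ (by simp)
        · rfl
    rw [kerDim, hker, (LinearMap.iInfKerProjEquiv ℂ (fun _ : Fin t => ℂ)
      (I := {i : Fin t | (i : ℕ) < k}) (J := {i : Fin t | ¬ (i : ℕ) < k})
      (Set.disjoint_left.2 fun i h1 h2 => h2 h1) fun i _ => em _).finrank_eq,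
      Module.finrank_fintype_fun_eq_card, Fintype.card_subtype]
    have : (Finset.univ.filter fun i : Fin t => i ∈ {i : Fin t | (i : ℕ) < k}).map
        Fin.valEmbedding = Finset.range (min k t) := by
      ext i
      simp only [Finset.mem_map, Finset.mem_filter, Finset.mem_univ, true_and, Set.mem_ofPred_eq,
        Fin.valEmbedding_apply, Finset.mem_range, lt_min_iff]
      exact ⟨by rintro ⟨j, hj, rfl⟩; exact ⟨hj, j.2⟩, fun hi => ⟨⟨i, hi.2⟩, hi.1, rfl⟩⟩
    rw [← Finset.card_map Fin.valEmbedding, this, Finset.card_range]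
  · set f : Module.End ℂ (Fin t → ℂ) := Matrix.toLin' (jordanCell b t) with hf
    have hinj : Function.Injective (f - algebraMap ℂ (Module.End ℂ (Fin t → ℂ)) a) := by
      rw [← LinearMap.ker_eq_bot, LinearMap.ker_eq_bot']
      intro v hv
      -- A vector killed by `f - a` is an eigenvector of the nilpotent map `f - b` with the nonzero
      -- eigenvalue `a - b`, hence zero.
      have h1 : (f - algebraMap ℂ (Module.End ℂ (Fin t → ℂ)) b) v = (a - b) • v := by
        have : f v = a • v := by simpa [sub_eq_zero] using hv
        simp [this, sub_smul]
      have h2 : ∀ k, ((f - algebraMap ℂ (Module.End ℂ (Fin t → ℂ)) b) ^ k) v = (a - b) ^ k • v := by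
        intro k
        induction k with
        | zero => simp
        | succ k ih => rw [pow_succ', Module.End.mul_apply, ih, map_smul, h1, smul_smul, pow_succ]
      have h3 : (a - b) ^ t • v = 0 := by
        rw [← h2]
        ext i
        rw [hf, jordanCell_sub_pow_apply, dif_neg (by omega)]
        rfl
      exact (smul_eq_zero.1 h3).resolve_left (pow_ne_zero t (sub_ne_zero.2 (Ne.symm h)))
    have h3 : Function.Injective ((f - algebraMap ℂ (Module.End ℂ (Fin t → ℂ)) a) ^ k) := by
      rw [Module.End.coe_pow]
      exact hinj.iterate k
    rw [kerDim, LinearMap.ker_eq_bot.2 h3, finrank_bot]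

theorem kerDim_pi {ι : Type*} [Fintype ι] {V : ι → Type*} [∀ i, AddCommGroup (V i)]
    [∀ i, Module ℂ (V i)] [∀ i, FiniteDimensional ℂ (V i)] (f : ∀ i, Module.End ℂ (V i)) (a : ℂ)
    (k : ℕ) :
    kerDim (LinearMap.pi fun i => f i ∘ₗ LinearMap.proj i) a k = ∑ i, kerDim (f i) a k := by
  have hpow : ∀ v i, (((LinearMap.pi fun i => f i ∘ₗ LinearMap.proj i) -
      algebraMap ℂ (Module.End ℂ (∀ i, V i)) a) ^ k) v i = ((f i - algebraMap ℂ _ a) ^ k) (v i) := by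
    intro v i
    induction k with
    | zero => simp
    | succ k ih => rw [pow_succ', pow_succ', Module.End.mul_apply, Module.End.mul_apply, ← ih]; simp
  have hker : LinearMap.ker (((LinearMap.pi fun i => f i ∘ₗ LinearMap.proj i) -
      algebraMap ℂ (Module.End ℂ (∀ i, V i)) a) ^ k) =
      Submodule.pi Set.univ fun i => LinearMap.ker ((f i - algebraMap ℂ _ a) ^ k) := by
    ext v
    simp only [LinearMap.mem_ker, Submodule.mem_pi, Set.mem_univ, true_imp_iff, ← hpow]
    exact funext_iff
  rw [kerDim, hker, finrank_submodule_pi]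
  rfl

variable {n : Type} [Fintype n] [DecidableEq n]

theorem IsJordanForm.kerDim_eq {M : Matrix n n ℂ} {k : ℕ} {α : Fin k → ℂ} {t : Fin k → ℕ}
    (h : IsJordanForm M α t) (a : ℂ) (j : ℕ) :
    kerDim (Matrix.toLin' M) a j = ∑ i, if α i = a then min j (t i) else 0 := by
  obtain ⟨-, P, P', h1, h2, rfl⟩ := h
  set J := Matrix.blockDiagonal' fun i => jordanCell (α i) (t i) with hJ
  let e : (n → ℂ) ≃ₗ[ℂ] (∀ i, Fin (t i) → ℂ) :=
    (Matrix.toLin'OfInv h1 h2).trans (LinearEquiv.piCurry ℂ fun i (_ : Fin (t i)) => ℂ)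
  have he : ∀ v, e (Matrix.toLin' (P * J * P') v) =
      (LinearMap.pi fun i => Matrix.toLin' (jordanCell (α i) (t i)) ∘ₗ LinearMap.proj i) (e v) := by
    intro v
    ext i x
    change P'.mulVec ((P * J * P').mulVec v) ⟨i, x⟩ =
      (jordanCell (α i) (t i)).mulVec (fun y => P'.mulVec v ⟨i, y⟩) x
    rw [Matrix.mulVec_mulVec, ← Matrix.mul_assoc, ← Matrix.mul_assoc, h2, Matrix.one_mul,
      ← Matrix.mulVec_mulVec]
    simp only [Matrix.mulVec, dotProduct, Fintype.sum_sigma]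
    rw [Finset.sum_eq_single i]
    · simp [hJ, Matrix.blockDiagonal'_apply_eq]
    · intro i' _ hi'
      exact Finset.sum_eq_zero fun y _ => by
        rw [hJ, Matrix.blockDiagonal'_apply_ne _ _ _ hi'.symm, zero_mul]
    · simp
  rw [kerDim_conj e _ _ he, kerDim_pi]
  exact Finset.sum_congr rfl fun i _ => kerDim_jordanCell _ _ _ _

theorem IsJordanForm.spectralIndex_eq {M : Matrix n n ℂ} {k : ℕ} {α : Fin k → ℂ} {t : Fin k → ℕ}
    (h : IsJordanForm M α t) : spectralIndex (Matrix.toLin' M) = jordanSum α t := by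
  have key : ∀ a, sqSum (kerDim (Matrix.toLin' M) a) =
      sumSqConj ((Finset.univ.filter fun i => α i = a).val.map t) := by
    intro a
    rw [← sqSum_min]
    congr 1
    funext j
    rw [h.kerDim_eq, Multiset.map_map, ← Finset.sum_filter]
    rfl
  rw [spectralIndex, finsum_congr key, jordanSum, finsum_eq_sum_of_support_subset]
  · push_cast; rfl
  · intro a ha
    by_contra h'
    refine ha ?_
    have : (Finset.univ.filter fun i => α i = a) = ∅ := by
      refine Finset.filter_eq_empty_iff.2 fun i _ hi => h' ?_
      simp [← hi]
    simp only [this]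
    exact_mod_cast sumSqConj_eq_zero (by simp)

end Jordan

/-! ### Action of polynomial matrices on vectors with entries in a module -/

section PolyAct

variable {R M : Type*} [CommRing R] [AddCommGroup M] [Module R M]
  {n p r : Type*} [Fintype n] [Fintype p] [Fintype r]

/-- The action of a matrix on vectors with entries in a module. -/
def polyAct (M : Type*) [AddCommGroup M] [Module R M] (A : Matrix n p R) :
    (p → M) →ₗ[R] (n → M) :=
  LinearMap.pi fun i => ∑ j, A i j • LinearMap.proj j

omit [Fintype n] in
theorem polyAct_apply (A : Matrix n p R) (v : p → M) (i : n) :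
    polyAct M A v i = ∑ j, A i j • v j := by
  simp [polyAct]

omit [Fintype n] in
theorem polyAct_mul (A : Matrix n p R) (B : Matrix p r R) (v : r → M) :
    polyAct M (A * B) v = polyAct M A (polyAct M B v) := by
  ext i
  simp only [polyAct_apply, Matrix.mul_apply, Finset.sum_smul, Finset.smul_sum, mul_smul]
  exact Finset.sum_comm

theorem polyAct_one [DecidableEq n] (v : n → M) : polyAct M (1 : Matrix n n R) v = v := by
  ext i
  simp [polyAct_apply, Matrix.one_apply]

omit [Fintype n] in
theorem polyAct_add (A B : Matrix n p R) (v : p → M) :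
    polyAct M (A + B) v = polyAct M A v + polyAct M B v := by
  ext i
  simp [polyAct_apply, add_smul, Finset.sum_add_distrib]

omit [Fintype n] in
theorem polyAct_sub (A B : Matrix n p R) (v : p → M) :
    polyAct M (A - B) v = polyAct M A v - polyAct M B v := by
  ext i
  simp [polyAct_apply, sub_smul, Finset.sum_sub_distrib]

omit [Fintype n] in
theorem polyAct_smul (c : R) (A : Matrix n p R) (v : p → M) :
    polyAct M (c • A) v = c • polyAct M A v := by
  ext i
  simp [polyAct_apply, mul_smul, Finset.smul_sum]

omit [Fintype n] in
theorem polyAct_sum {ι : Type*} (s : Finset ι) (A : ι → Matrix n p R) (v : p → M) :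
    polyAct M (∑ k ∈ s, A k) v = ∑ k ∈ s, polyAct M (A k) v := by
  ext i
  simp only [polyAct_apply, Matrix.sum_apply, Finset.sum_smul, Finset.sum_apply]
  exact Finset.sum_comm

theorem polyAct_diagonal [DecidableEq n] (d : n → R) (v : n → M) (i : n) :
    polyAct M (Matrix.diagonal d) v i = d i • v i := by
  rw [polyAct_apply, Finset.sum_eq_single i]
  · simp
  · intro j _ hj
    rw [Matrix.diagonal_apply_ne _ hj.symm, zero_smul]
  · simp

end PolyAct

/-! ### The injective hull of ℂ[X]/(X - a) -/

/-- The backward shift. -/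
noncomputable def backwardShift : Module.End ℂ ℂ[X] where
  toFun := divX
  map_add' _ _ := divX_add
  map_smul' c p := by rw [smul_eq_C_mul, divX_C_mul, smul_eq_C_mul]; rfl

theorem coeff_backwardShift_pow (k : ℕ) (p : ℂ[X]) (i : ℕ) :
    ((backwardShift ^ k) p).coeff i = p.coeff (i + k) := by
  induction k generalizing i with
  | zero => simp
  | succ k ih =>
    rw [pow_succ', Module.End.mul_apply]
    change (divX _).coeff i = _
    rw [coeff_divX, ih]
    congr 1
    omega

/-- The injective hull of `ℂ[X] / (X - a)`: the space `ℂ[X]` on which `X` acts as the sum of `a`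
and of the backward shift. -/
def LocalDual (_ : ℂ) : Type := ℂ[X]

namespace LocalDual

variable (a : ℂ)

noncomputable instance : AddCommGroup (LocalDual a) := inferInstanceAs (AddCommGroup ℂ[X])

noncomputable instance : Module ℂ (LocalDual a) := inferInstanceAs (Module ℂ ℂ[X])

/-- The identity map. -/
noncomputable def of : ℂ[X] ≃ₗ[ℂ] LocalDual a := LinearEquiv.refl ℂ ℂ[X]

/-- The backward shift of `LocalDual a`. -/
noncomputable def shift : Module.End ℂ (LocalDual a) :=
  (of a : ℂ[X] →ₗ[ℂ] LocalDual a) ∘ₗ backwardShift ∘ₗ ((of a).symm : LocalDual a →ₗ[ℂ] ℂ[X])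

/-- The action of polynomials. -/
noncomputable def action : ℂ[X] →ₐ[ℂ] Module.End ℂ (LocalDual a) :=
  aeval (algebraMap ℂ _ a + shift a)

noncomputable instance : Module ℂ[X] (LocalDual a) :=
  Module.compHom _ (action a).toRingHom

theorem smul_eq (p : ℂ[X]) (m : LocalDual a) : p • m = action a p m :=
  rfl

theorem shift_pow_of (k : ℕ) (m : ℂ[X]) : (shift a ^ k) (of a m) = of a ((backwardShift ^ k) m) := by
  induction k with
  | zero => rfl
  | succ k ih => rw [pow_succ', Module.End.mul_apply, ih, pow_succ']; rfl

instance : IsScalarTower ℂ ℂ[X] (LocalDual a) where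
  smul_assoc c p m := by
    rw [smul_eq, smul_eq, map_smul, LinearMap.smul_apply]

theorem X_sub_C_pow_smul (k : ℕ) (m : ℂ[X]) :
    ((X - C a) ^ k : ℂ[X]) • of a m = of a ((backwardShift ^ k) m) := by
  rw [smul_eq, ← shift_pow_of]
  congr 1
  simp [action]

/-- Multiplication by `X` is a right inverse of the backward shift. This divisibility, which fails
in `ℂ[X] / (X - a)^k`, is what allows division by `X - b_l` at a pole. -/
theorem X_sub_C_smul_surjective (m : LocalDual a) : ∃ m', ((X - C a) : ℂ[X]) • m' = m := by
  obtain ⟨m, rfl⟩ := (of a).surjective m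
  refine ⟨of a (X * m), ?_⟩
  have := X_sub_C_pow_smul a 1 (X * m)
  rw [pow_one, pow_one] at this
  rw [this]
  congr 1
  ext i
  change (divX _).coeff i = _
  rw [coeff_divX, coeff_X_mul]

theorem exists_pow_smul_eq_zero (m : LocalDual a) : ∃ k, ((X - C a) ^ k : ℂ[X]) • m = 0 := by
  obtain ⟨m, rfl⟩ := (of a).surjective m
  refine ⟨m.natDegree + 1, ?_⟩
  rw [X_sub_C_pow_smul, LinearEquiv.map_eq_zero_iff]
  ext i
  rw [coeff_backwardShift_pow, coeff_zero]
  exact coeff_eq_zero_of_natDegree_lt (by omega)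

/-- The elements of `LocalDual a` killed by `(X - a) ^ k`. -/
noncomputable abbrev tor (k : ℕ) : Submodule ℂ (LocalDual a) :=
  (Submodule.torsionBy ℂ[X] (LocalDual a) ((X - C a) ^ k)).restrictScalars ℂ

/-- The `k`-th backward shift discards the first `k` coefficients, so it kills precisely the
polynomials of degree less than `k`. -/
theorem tor_eq (k : ℕ) : tor a k = (degreeLT ℂ k).map
    (of a : ℂ[X] →ₗ[ℂ] _) := by
  ext m
  obtain ⟨m, rfl⟩ := (of a).surjective m
  rw [Submodule.mem_map_equiv, LinearEquiv.symm_apply_apply, Submodule.restrictScalars_mem,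
    Submodule.mem_torsionBy_iff, X_sub_C_pow_smul, LinearEquiv.map_eq_zero_iff, mem_degreeLT,
    degree_lt_iff_coeff_zero]
  constructor
  · intro h i hi
    rw [← coeff_zero (i - k), ← h, coeff_backwardShift_pow]
    congr 1
    omega
  · intro h
    ext i
    rw [coeff_backwardShift_pow, coeff_zero]
    exact h _ (by omega)

noncomputable def torEquiv (k : ℕ) : (Fin k → ℂ) ≃ₗ[ℂ] tor a k :=
  (degreeLTEquiv ℂ k).symm.trans ((LinearEquiv.submoduleMap
    (of a) _).trans
      (LinearEquiv.ofEq _ _ (tor_eq a k).symm))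

instance (k : ℕ) : FiniteDimensional ℂ (tor a k) :=
  (torEquiv a k).finiteDimensional

theorem finrank_tor (k : ℕ) : Module.finrank ℂ (tor a k) = k := by
  rw [← (torEquiv a k).finrank_eq]
  simp

variable {a}

/-- Each element is killed by some power of `X - a`, which is coprime to `w`; a Bézout relation then
inverts `w`. The same argument gives surjectivity in `exists_smul_eq`. -/
theorem eq_zero_of_smul_eq_zero {w : ℂ[X]} (hw : ¬ w.IsRoot a) {m : LocalDual a}
    (h : w • m = 0) : m = 0 := by
  obtain ⟨k, hk⟩ := exists_pow_smul_eq_zero a m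
  have hc : IsCoprime ((X - C a) ^ k) w :=
    IsCoprime.pow_left ((irreducible_X_sub_C a).coprime_iff_not_dvd.2 fun h => hw (dvd_iff_isRoot.1 h))
  obtain ⟨u, v, huv⟩ := hc
  rw [← one_smul ℂ[X] m, ← huv, add_smul, mul_smul, mul_smul, hk, h, smul_zero, smul_zero, add_zero]

theorem exists_smul_eq {w : ℂ[X]} (hw : ¬ w.IsRoot a) (m : LocalDual a) :
    ∃ m', w • m' = m := by
  obtain ⟨k, hk⟩ := exists_pow_smul_eq_zero a m
  have hc : IsCoprime ((X - C a) ^ k) w :=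
    IsCoprime.pow_left ((irreducible_X_sub_C a).coprime_iff_not_dvd.2 fun h => hw (dvd_iff_isRoot.1 h))
  obtain ⟨u, v, huv⟩ := hc
  refine ⟨v • m, ?_⟩
  conv_rhs => rw [← one_smul ℂ[X] m, ← huv, add_smul, mul_smul, hk, smul_zero, zero_add]
  rw [smul_smul, mul_comm]

/-- Up to a factor acting injectively, `d` is `(X - a)^e` with `e` the order of `a`, so the stronger
of the two conditions is the one with the smaller exponent. -/
theorem smul_eq_zero_and_iff {d : ℂ[X]} (hd : d ≠ 0) (k : ℕ) (m : LocalDual a) :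
    d • m = 0 ∧ ((X - C a) ^ k : ℂ[X]) • m = 0 ↔
      ((X - C a) ^ min k (d.rootMultiplicity a) : ℂ[X]) • m = 0 := by
  obtain ⟨w, hw, hnd⟩ := exists_eq_pow_rootMultiplicity_mul_and_not_dvd d hd a
  set e := d.rootMultiplicity a
  have hroot : ¬ w.IsRoot a := fun h => hnd (dvd_iff_isRoot.2 h)
  constructor
  · rintro ⟨h1, h2⟩
    rcases le_total k e with h | h
    · rwa [min_eq_left h]
    · rw [min_eq_right h]
      refine eq_zero_of_smul_eq_zero hroot ?_
      rw [smul_smul, mul_comm, ← hw, h1]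
  · intro h
    constructor
    · obtain ⟨c, hc⟩ : ((X - C a) ^ min k e : ℂ[X]) ∣ d :=
        (pow_dvd_pow _ (min_le_right k e)).trans ⟨w, hw⟩
      rw [hc, mul_comm, mul_smul, h, smul_zero]
    · obtain ⟨c, hc⟩ : ((X - C a) ^ min k e : ℂ[X]) ∣ (X - C a) ^ k :=
        pow_dvd_pow _ (min_le_left k e)
      rw [hc, mul_comm, mul_smul, h, smul_zero]

end LocalDual

/-! ### Elementary divisors through local solutions -/

section LocalProfile

variable {n p : Type*} [Fintype n] [Fintype p]

/-- The solutions `v` of `A v = 0`, `(X - a) ^ k v = 0` with components in `LocalDual a`. -/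
noncomputable def localSol (A : Matrix n p ℂ[X]) (a : ℂ) (k : ℕ) : Submodule ℂ (p → LocalDual a) :=
  (LinearMap.ker (polyAct (LocalDual a) A) ⊓
    Submodule.torsionBy ℂ[X] _ ((X - C a) ^ k)).restrictScalars ℂ

omit [Fintype n] in
theorem mem_localSol {A : Matrix n p ℂ[X]} {a : ℂ} {k : ℕ} {v : p → LocalDual a} :
    v ∈ localSol A a k ↔ polyAct _ A v = 0 ∧ ((X - C a) ^ k : ℂ[X]) • v = 0 := by
  rw [localSol, Submodule.restrictScalars_mem, Submodule.mem_inf, LinearMap.mem_ker,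
    Submodule.mem_torsionBy_iff]

/-- The dimension of `localSol A a k`. -/
noncomputable def localDim (A : Matrix n p ℂ[X]) (a : ℂ) (k : ℕ) : ℕ :=
  Module.finrank ℂ (localSol A a k)

omit [Fintype n] in
theorem localSol_le_pi (A : Matrix n p ℂ[X]) (a : ℂ) (k : ℕ) :
    localSol A a k ≤ Submodule.pi Set.univ fun _ => LocalDual.tor a k := by
  intro v hv i _
  exact congrFun (mem_localSol.1 hv).2 i

instance (a : ℂ) (k : ℕ) :
    FiniteDimensional ℂ (Submodule.pi Set.univ fun _ : p => LocalDual.tor a k) := by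
  let e : (p → LocalDual.tor a k) →ₗ[ℂ] (Submodule.pi Set.univ fun _ : p => LocalDual.tor a k) :=
    { toFun := fun v => ⟨fun i => v i, fun i _ => (v i).2⟩
      map_add' := fun _ _ => rfl
      map_smul' := fun _ _ => rfl }
  exact Module.Finite.of_surjective e fun v => ⟨fun i => ⟨v.1 i, v.2 i trivial⟩, rfl⟩

instance (A : Matrix n p ℂ[X]) (a : ℂ) (k : ℕ) : FiniteDimensional ℂ (localSol A a k) :=
  Submodule.finiteDimensional_of_le (localSol_le_pi A a k)

theorem localDim_diagonal [DecidableEq n] (d : n → ℂ[X]) (hd : ∀ i, d i ≠ 0) (a : ℂ) (k : ℕ) :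
    localDim (Matrix.diagonal d) a k = ∑ i, min k ((d i).rootMultiplicity a) := by
  have : localSol (Matrix.diagonal d) a k =
      Submodule.pi Set.univ fun i => LocalDual.tor a (min k ((d i).rootMultiplicity a)) := by
    ext v
    rw [mem_localSol, Submodule.mem_pi, funext_iff, funext_iff, ← forall_and]
    refine forall_congr' fun i => ?_
    rw [polyAct_diagonal, Pi.zero_apply, Pi.smul_apply, LocalDual.smul_eq_zero_and_iff (hd i)]
    exact ⟨fun h _ => h, fun h => h trivial⟩
  rw [localDim, this, finrank_submodule_pi]
  exact Finset.sum_congr rfl fun i _ => LocalDual.finrank_tor _ _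

/-- The action of `Q` carries one solution space to the other and commutes with scalars, while `P`,
acting invertibly, leaves the equation unchanged. -/
theorem localDim_equiv [DecidableEq n] (A : Matrix n n ℂ[X]) (P Q : (Matrix n n ℂ[X])ˣ) (a : ℂ)
    (k : ℕ) : localDim ((P : Matrix n n ℂ[X]) * A * (Q : Matrix n n ℂ[X])) a k = localDim A a k := by
  let e : (n → LocalDual a) ≃ₗ[ℂ] (n → LocalDual a) :=
    { (polyAct (LocalDual a) (Q : Matrix n n ℂ[X])).restrictScalars ℂ with
      invFun := polyAct (LocalDual a) ((Q⁻¹ : (Matrix n n ℂ[X])ˣ) : Matrix n n ℂ[X])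
      left_inv := fun v => by
        change polyAct _ _ (polyAct _ _ v) = v
        rw [← polyAct_mul, Units.inv_mul, polyAct_one]
      right_inv := fun v => by
        change polyAct _ _ (polyAct _ _ v) = v
        rw [← polyAct_mul, Units.mul_inv, polyAct_one] }
  have he : ∀ v, e v = polyAct _ (Q : Matrix n n ℂ[X]) v := fun v => rfl
  have hes : ∀ v, e.symm v = polyAct _ ((Q⁻¹ : (Matrix n n ℂ[X])ˣ) : Matrix n n ℂ[X]) v := fun v => rfl
  have : localSol A a k =
      (localSol ((P : Matrix n n ℂ[X]) * A * (Q : Matrix n n ℂ[X])) a k).map (e : _ →ₗ[ℂ] _) := by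
    ext v
    rw [Submodule.mem_map_equiv, mem_localSol, mem_localSol, polyAct_mul, ← he, e.apply_symm_apply,
      hes, ← map_smul, polyAct_mul]
    refine and_congr ⟨fun h => by rw [h, map_zero], fun h => ?_⟩ ⟨fun h => by rw [h, map_zero], fun h => ?_⟩
    · have := congrArg (polyAct (LocalDual a) ((P⁻¹ : (Matrix n n ℂ[X])ˣ) : Matrix n n ℂ[X])) h
      rwa [← polyAct_mul, Units.inv_mul, polyAct_one, map_zero] at this
    · rw [← hes, LinearEquiv.map_eq_zero_iff] at h
      exact h
  rw [localDim, localDim, this]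
  exact (e.submoduleMap _).finrank_eq

theorem IsElementaryDivisors.prod_ne_zero {m : ℕ} {A : Matrix (Fin m) (Fin m) ℂ[X]}
    {d : Fin m → ℂ[X]} (h : IsElementaryDivisors A d) :
    Associated (∏ i, d i) A.det := by
  obtain ⟨-, P, Q, hPQ⟩ := h
  have := congrArg Matrix.det hPQ
  rw [Matrix.det_mul, Matrix.det_mul, Matrix.det_diagonal] at this
  rw [← this, mul_right_comm]
  exact associated_unit_mul_left _ _ (((Matrix.isUnit_iff_isUnit_det _).1 P.isUnit).mul
    ((Matrix.isUnit_iff_isUnit_det _).1 Q.isUnit))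

theorem IsElementaryDivisors.ne_zero {m : ℕ} {A : Matrix (Fin m) (Fin m) ℂ[X]}
    {d : Fin m → ℂ[X]} (h : IsElementaryDivisors A d) (hA : A.det ≠ 0) (i : Fin m) : d i ≠ 0 := by
  intro hi
  exact hA ((h.prod_ne_zero.eq_zero_iff).1 (Finset.prod_eq_zero (Finset.mem_univ i) hi))

/-- The Smith form decouples the system into the scalar equations `d i • v i = 0`. In particular the
orders of the zeros enter only through a quantity attached to `A` itself. -/
theorem IsElementaryDivisors.localDim_eq {m : ℕ} {A : Matrix (Fin m) (Fin m) ℂ[X]}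
    {d : Fin m → ℂ[X]} (h : IsElementaryDivisors A d) (hA : A.det ≠ 0) (a : ℂ) (k : ℕ) :
    localDim A a k = ∑ i, min k ((d i).rootMultiplicity a) := by
  obtain ⟨P, Q, hPQ⟩ := h.2
  rw [← localDim_diagonal d (h.ne_zero hA), ← hPQ, localDim_equiv]

/-- `∑ᵢ ∑ⱼ (n_j^i)²` for the zeros of `det A`. -/
noncomputable def divisorIndex (A : Matrix n p ℂ[X]) : ℤ :=
  ∑ᶠ a, sqSum (localDim A a)

variable {m : ℕ} {A : Matrix (Fin m) (Fin m) ℂ[X]}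

theorem IsElementaryDivisors.sqSum_localDim {d : Fin m → ℂ[X]} (h : IsElementaryDivisors A d)
    (hA : A.det ≠ 0) (a : ℂ) :
    sqSum (localDim A a) = sumSqConj (Finset.univ.val.map fun i => (d i).rootMultiplicity a) := by
  rw [← sqSum_min]
  congr 1
  funext k
  rw [h.localDim_eq hA, Multiset.map_map]
  rfl

theorem IsElementaryDivisors.support_subset {d : Fin m → ℂ[X]} (h : IsElementaryDivisors A d)
    (hA : A.det ≠ 0) :
    Function.support (fun a => sqSum (localDim A a)) ⊆ (A.det.roots.toFinset : Set ℂ) := by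
  intro a ha
  by_contra h'
  refine ha ?_
  simp only [h.sqSum_localDim hA]
  norm_cast
  refine sumSqConj_eq_zero fun b hb => ?_
  obtain ⟨i, -, rfl⟩ := Multiset.mem_map.1 hb
  refine rootMultiplicity_eq_zero fun hr => h' ?_
  have : (X - C a) ∣ A.det := (dvd_iff_isRoot.2 hr).trans
    ((Finset.dvd_prod_of_mem d (Finset.mem_univ i)).trans h.prod_ne_zero.dvd)
  simpa [hA] using dvd_iff_isRoot.1 this

theorem IsElementaryDivisors.divisorIndex_eq {d : Fin m → ℂ[X]} (h : IsElementaryDivisors A d)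
    (hA : A.det ≠ 0) : divisorIndex A = divisorSum A d := by
  rw [divisorIndex, finsum_eq_sum_of_support_subset _ (h.support_subset hA), divisorSum]
  push_cast
  exact Finset.sum_congr rfl fun a _ => h.sqSum_localDim hA a

theorem support_sqSum_localDim_finite (hA : A.det ≠ 0) :
    (Function.support fun a => sqSum (localDim A a)).Finite := by
  obtain ⟨d, hd⟩ := exists_isElementaryDivisors A
  exact (Finset.finite_toSet _).subset (hd.support_subset hA)

omit [Fintype n] in
theorem localDim_zero (A : Matrix n p ℂ[X]) (a : ℂ) : localDim A a 0 = 0 := by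
  have : localSol A a 0 = ⊥ := by
    refine (Submodule.eq_bot_iff _).2 fun v hv => ?_
    simpa using (mem_localSol.1 hv).2
  rw [localDim, this, finrank_bot]

theorem localDim_stable (hA : A.det ≠ 0) (a : ℂ) :
    ∃ N, ∀ j, N ≤ j → localDim A a j = localDim A a N := by
  obtain ⟨d, hd⟩ := exists_isElementaryDivisors A
  refine exists_stable_of_monotone (B := ∑ i, (d i).rootMultiplicity a) (fun i j hij => ?_) fun k => ?_
  · rw [hd.localDim_eq hA, hd.localDim_eq hA]
    gcongr
  · rw [hd.localDim_eq hA]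
    exact Finset.sum_le_sum fun i _ => min_le_right _ _

/-- Substitution of `c x` for `x`. -/
theorem divisorIndex_comp (hA : A.det ≠ 0) {c : ℂ} (hc : c ≠ 0) :
    divisorIndex (A.map fun f => f.comp (C c * X)) = divisorIndex A := by
  obtain ⟨d, hd⟩ := exists_isElementaryDivisors A
  let φ : ℂ[X] →+* ℂ[X] := compRingHom (C c * X)
  have hφ : ∀ f, φ f = f.comp (C c * X) := fun f => rfl
  have hroot : ∀ f a, (φ f).rootMultiplicity a = f.rootMultiplicity (c * a) := by
    intro f a
    have := rootMultiplicity_comp_C_mul_X_add_C f c 0 a (isUnit_iff_ne_zero.2 hc)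
    simpa [hφ] using this
  have hinj : ∀ f, φ f = 0 → f = 0 := by
    intro f hf
    have : (φ f).comp (C c⁻¹ * X) = f := by
      rw [hφ, comp_assoc]
      have : (C c * X : ℂ[X]).comp (C c⁻¹ * X) = X := by
        rw [mul_comp, C_comp, X_comp, ← mul_assoc, ← C_mul, mul_inv_cancel₀ hc, C_1, one_mul]
      rw [this, comp_X]
    rw [← this, hf, zero_comp]
  have hd' : IsElementaryDivisors (φ.mapMatrix A) fun i => φ (d i) := by
    obtain ⟨h1, P, Q, hPQ⟩ := hd
    refine ⟨fun i j hij => map_dvd φ (h1 i j hij), Units.map φ.mapMatrix.toMonoidHom P,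
      Units.map φ.mapMatrix.toMonoidHom Q, ?_⟩
    have := congrArg φ.mapMatrix hPQ
    rw [map_mul, map_mul] at this
    refine this.trans ?_
    rw [RingHom.mapMatrix_apply, Matrix.diagonal_map (map_zero φ)]
  have hdet : (φ.mapMatrix A).det ≠ 0 := by
    rw [← RingHom.map_det]
    exact fun h => hA (hinj _ h)
  change divisorIndex (φ.mapMatrix A) = _
  rw [divisorIndex, divisorIndex, 
    ← finsum_comp_equiv (f := fun a => sqSum (localDim A a)) (Equiv.mulLeft₀ c hc)]
  refine finsum_congr fun a => ?_
  change _ = sqSum (localDim A (c * a))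
  rw [hd'.sqSum_localDim hdet, hd.sqSum_localDim hA]
  simp only [hroot]

end LocalProfile

/-! ### Multiplication of a system by a scalar polynomial -/

section DivisorIndexSmul

variable {m : ℕ} {A : Matrix (Fin m) (Fin m) ℂ[X]}

theorem IsElementaryDivisors.smul {d : Fin m → ℂ[X]} (h : IsElementaryDivisors A d) (f : ℂ[X]) :
    IsElementaryDivisors (f • A) fun i => f * d i := by
  obtain ⟨h1, P, Q, hPQ⟩ := h
  refine ⟨fun i j hij => mul_dvd_mul_left _ (h1 i j hij), P, Q, ?_⟩
  rw [Matrix.mul_smul, Matrix.smul_mul, hPQ, ← Matrix.diagonal_smul]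
  rfl

theorem det_smul_ne_zero {f : ℂ[X]} (hf : f ≠ 0) (hA : A.det ≠ 0) : (f • A).det ≠ 0 := by
  rw [Matrix.det_smul]
  exact mul_ne_zero (pow_ne_zero _ hf) hA

/-- All `m` orders at `β` grow by one, which prepends a part `m` to the conjugate partition there
and changes nothing elsewhere. -/
theorem divisorIndex_X_sub_C_smul (hA : A.det ≠ 0) (β : ℂ) :
    divisorIndex ((X - C β : ℂ[X]) • A) = divisorIndex A + (m : ℤ) ^ 2 := by
  classical
  obtain ⟨d, hd⟩ := exists_isElementaryDivisors A
  have hd' := hd.smul (X - C β)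
  have hA' := det_smul_ne_zero (X_sub_C_ne_zero β) hA
  have hmult : ∀ i a, ((X - C β) * d i).rootMultiplicity a =
      (if a = β then 1 else 0) + (d i).rootMultiplicity a := by
    intro i a
    rw [rootMultiplicity_mul (mul_ne_zero (X_sub_C_ne_zero β) (hd.ne_zero hA i)),
      rootMultiplicity_X_sub_C]
  have := finsum_add_point_masses (fun a => sqSum (localDim ((X - C β : ℂ[X]) • A) a))
    (fun a => sqSum (localDim A a)) (fun _ : Unit => β) (fun _ => (m : ℤ) ^ 2)
    (support_sqSum_localDim_finite hA) ?_
  · simpa [divisorIndex] using this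
  · intro a
    simp only [Finset.univ_unique, Finset.sum_const, Finset.card_singleton, one_smul]
    split_ifs with h
    · refine sqSum_shift (localDim_stable hA a) (localDim_zero _ _) (localDim_zero _ _) fun j => ?_
      rw [hd'.localDim_eq hA', hd.localDim_eq hA]
      simp only [hmult, if_pos h, add_comm 1, min_add_add_right, Finset.sum_add_distrib]
      simp [add_comm]
    · rw [add_zero]
      congr 1
      funext j
      rw [hd'.localDim_eq hA', hd.localDim_eq hA]
      simp only [hmult, if_neg h, zero_add]

theorem divisorIndex_C_smul {c : ℂ} (hc : c ≠ 0) :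
    divisorIndex ((C c : ℂ[X]) • A) = divisorIndex A := by
  refine finsum_congr fun a => ?_
  congr 1
  funext k
  have : localSol ((C c : ℂ[X]) • A) a k = localSol A a k := by
    ext v
    rw [mem_localSol, mem_localSol, polyAct_smul]
    refine and_congr_left fun _ => ⟨fun h => ?_, fun h => by rw [h, smul_zero]⟩
    have := congrArg (fun w => (C c⁻¹ : ℂ[X]) • w) h
    simpa only [smul_smul, ← C_mul, inv_mul_cancel₀ hc, C_1, one_smul, smul_zero] using this
  rw [localDim, localDim, this]

/-- Roots are split off one at a time. The resulting term is exactly compensated in the index by `-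
m² N`, as the degree of the system grows by `f.natDegree`. -/
theorem divisorIndex_smul {f : ℂ[X]} (hf : f ≠ 0) (hA : A.det ≠ 0) :
    divisorIndex (f • A) = divisorIndex A + (m : ℤ) ^ 2 * f.natDegree := by
  induction h : f.natDegree generalizing f with
  | zero =>
    obtain ⟨c, rfl⟩ := natDegree_eq_zero.1 h
    rw [divisorIndex_C_smul fun hc => hf (by rw [hc, C_0])]
    simp
  | succ k ih =>
    obtain ⟨β, hβ⟩ := IsAlgClosed.exists_root f fun h0 => by
      rw [natDegree_eq_zero_iff_degree_le_zero.2 h0.le] at h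
      omega
    obtain ⟨g, rfl⟩ := dvd_iff_isRoot.2 hβ
    have hg : g ≠ 0 := right_ne_zero_of_mul hf
    rw [natDegree_mul (X_sub_C_ne_zero β) hg, natDegree_X_sub_C] at h
    rw [mul_smul, divisorIndex_X_sub_C_smul (det_smul_ne_zero hg hA), ih hg (by omega)]
    push_cast
    ring

end DivisorIndexSmul

/-! ### Gauge equivalence and independence of the canonical form -/

section Gauge

variable {n : Type} [Fintype n] [DecidableEq n]

theorem GaugeEquiv.symm {R R' : Matrix n n (RatFunc ℂ)} (h : GaugeEquiv R R') :
    GaugeEquiv R' R := by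
  obtain ⟨P, Q, hQ, rfl⟩ := h
  refine ⟨P⁻¹, Q⁻¹, inv_ne_zero hQ, ?_⟩
  have h1 : ((P⁻¹ : (Matrix n n ℂ)ˣ) : Matrix n n ℂ).map (RatFunc.C : ℂ →+* RatFunc ℂ) *
      (P : Matrix n n ℂ).map (RatFunc.C : ℂ →+* RatFunc ℂ) = 1 := by
    rw [← Matrix.map_mul, Units.inv_mul]
    simp
  rw [inv_inv, Matrix.mul_smul, Matrix.smul_mul, smul_smul, inv_mul_cancel₀ hQ, one_smul,
    ← Matrix.mul_assoc, ← Matrix.mul_assoc, h1, Matrix.one_mul, Matrix.mul_assoc, h1, Matrix.mul_one]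

theorem GaugeEquiv.trans {R R' R'' : Matrix n n (RatFunc ℂ)} (h : GaugeEquiv R R')
    (h' : GaugeEquiv R' R'') : GaugeEquiv R R'' := by
  obtain ⟨P, Q, hQ, rfl⟩ := h
  obtain ⟨P', Q', hQ', rfl⟩ := h'
  refine ⟨P' * P, Q' * Q, mul_ne_zero hQ' hQ, ?_⟩
  rw [mul_inv_rev, Units.val_mul, Units.val_mul, Matrix.map_mul, Matrix.map_mul, Matrix.mul_smul,
    Matrix.smul_mul, smul_smul]
  simp only [Matrix.mul_assoc]

theorem gaugeEquiv_smul (R : Matrix n n (RatFunc ℂ)) {Q : RatFunc ℂ} (hQ : Q ≠ 0) :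
    GaugeEquiv R (Q • R) :=
  ⟨1, Q, hQ, by simp⟩

end Gauge

section FuchsianIndex

variable {m : ℕ}

/-- The rigidity index computed from a polynomial system of Fuchsian type. -/
noncomputable def fuchsianIndex (N : ℕ) (A : Matrix (Fin m) (Fin m) ℂ[X]) : ℤ :=
  spectralIndex (Matrix.toLin' (matCoeff A 0)) + spectralIndex (Matrix.toLin' (matCoeff A N)) +
    divisorIndex A - (m : ℤ) ^ 2 * N

theorem IsFuchsianPoly.det_ne_zero {N : ℕ} {A : Matrix (Fin m) (Fin m) ℂ[X]}
    (h : IsFuchsianPoly N A) : A.det ≠ 0 := by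
  intro h0
  have h1 := (Matrix.isUnit_iff_isUnit_det _).1 h.2.1
  have h2 : (evalRingHom (0 : ℂ)).mapMatrix A = matCoeff A 0 := by
    ext i j
    simp [matCoeff, coeff_zero_eq_eval_zero]
  rw [← h2, ← RingHom.map_det, h0, map_zero] at h1
  exact not_isUnit_zero h1

theorem matCoeff_smul_zero (f : ℂ[X]) (A : Matrix (Fin m) (Fin m) ℂ[X]) :
    matCoeff (f • A) 0 = f.coeff 0 • matCoeff A 0 := by
  ext i j
  simp [matCoeff, mul_coeff_zero]

theorem matCoeff_smul_add (f : ℂ[X]) {A : Matrix (Fin m) (Fin m) ℂ[X]} {N : ℕ}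
    (hA : ∀ i j, (A i j).natDegree ≤ N) :
    matCoeff (f • A) (f.natDegree + N) = f.leadingCoeff • matCoeff A N := by
  ext i j
  simp [matCoeff, coeff_mul_add_eq_of_natDegree_le le_rfl (hA i j)]

theorem matCoeff_eq_zero {A : Matrix (Fin m) (Fin m) ℂ[X]} {N k : ℕ}
    (hA : ∀ i j, (A i j).natDegree ≤ N) (hk : N < k) : matCoeff A k = 0 := by
  ext i j
  exact coeff_eq_zero_of_natDegree_lt ((hA i j).trans_lt hk)

theorem natDegree_smul_le (f : ℂ[X]) {A : Matrix (Fin m) (Fin m) ℂ[X]} {N : ℕ}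
    (hA : ∀ i j, (A i j).natDegree ≤ N) (i j : Fin m) :
    ((f • A) i j).natDegree ≤ f.natDegree + N :=
  natDegree_mul_le_of_le le_rfl (hA i j)

/-- Two proportional Fuchsian polynomial systems have the same index. -/
theorem fuchsianIndex_eq_of_smul_eq [NeZero m] {N N' : ℕ} {A A' : Matrix (Fin m) (Fin m) ℂ[X]}
    (hA : IsFuchsianPoly N A) (hA' : IsFuchsianPoly N' A') {f g : ℂ[X]} (hfg : IsCoprime f g)
    (hf : f ≠ 0) (hg : g ≠ 0) (h : g • A' = f • A) : fuchsianIndex N A = fuchsianIndex N' A' := by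
  have h0 : g.coeff 0 • matCoeff A' 0 = f.coeff 0 • matCoeff A 0 := by
    rw [← matCoeff_smul_zero, h, matCoeff_smul_zero]
  -- The coefficients at the origin are invertible, and nonzero because `m ≠ 0`. If `X` divided one
  -- of `f`, `g` it would therefore divide the other, against coprimality.
  have hne : ∀ {p : ℂ[X]} {B : Matrix (Fin m) (Fin m) ℂ}, B ≠ 0 → p.coeff 0 • B = 0 → X ∣ p :=
    fun hB hp => X_dvd_iff.2 ((smul_eq_zero.1 hp).resolve_right hB)
  have hX : ¬ (X ∣ f ∧ X ∣ g) := fun hX => not_isUnit_X (hfg.isUnit_of_dvd' hX.1 hX.2)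
  have hg0 : g.coeff 0 ≠ 0 := by
    intro hg0
    refine hX ⟨hne hA.2.1.ne_zero ?_, X_dvd_iff.2 hg0⟩
    rw [← h0, hg0, zero_smul]
  have hf0 : f.coeff 0 ≠ 0 := by
    intro hf0
    refine hX ⟨X_dvd_iff.2 hf0, hne hA'.2.1.ne_zero ?_⟩
    rw [h0, hf0, zero_smul]
  -- Both sides of `g • A' = f • A` have a nonzero leading coefficient in the degree shown, so the
  -- degrees agree.
  have hdeg : g.natDegree + N' = f.natDegree + N := by
    rcases lt_trichotomy (g.natDegree + N') (f.natDegree + N) with hlt | heq | hlt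
    · have h1 := matCoeff_eq_zero (natDegree_smul_le g hA'.1) hlt
      rw [h, matCoeff_smul_add f hA.1] at h1
      exact absurd ((smul_eq_zero.1 h1).resolve_left (leadingCoeff_ne_zero.2 hf)) hA.2.2.ne_zero
    · exact heq
    · have h1 := matCoeff_eq_zero (natDegree_smul_le f hA.1) hlt
      rw [← h, matCoeff_smul_add g hA'.1] at h1
      exact absurd ((smul_eq_zero.1 h1).resolve_left (leadingCoeff_ne_zero.2 hg)) hA'.2.2.ne_zero
  have hN : g.leadingCoeff • matCoeff A' N' = f.leadingCoeff • matCoeff A N := by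
    rw [← matCoeff_smul_add g hA'.1, ← matCoeff_smul_add f hA.1, h, hdeg]
  have hs : ∀ {a b : ℂ} {M M' : Matrix (Fin m) (Fin m) ℂ}, a ≠ 0 → b ≠ 0 → a • M' = b • M →
      spectralIndex (Matrix.toLin' M) = spectralIndex (Matrix.toLin' M') := by
    intro a b M M' ha hb hab
    rw [← spectralIndex_smul (Matrix.toLin' M) hb, ← spectralIndex_smul (Matrix.toLin' M') ha,
      ← map_smul, ← map_smul, hab]
  have hd := divisorIndex_smul hf hA.det_ne_zero
  rw [← h, divisorIndex_smul hg hA'.det_ne_zero] at hd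
  rw [fuchsianIndex, fuchsianIndex, hs hg0 hf0 h0,
    hs (leadingCoeff_ne_zero.2 hg) (leadingCoeff_ne_zero.2 hf) hN]
  have hdeg' : (g.natDegree : ℤ) + N' = f.natDegree + N := by exact_mod_cast hdeg
  linear_combination (m : ℤ) ^ 2 * hdeg' - hd

theorem spectralIndex_conj_matrix (P : (Matrix (Fin m) (Fin m) ℂ)ˣ) (M : Matrix (Fin m) (Fin m) ℂ) :
    spectralIndex (Matrix.toLin' ((P : Matrix (Fin m) (Fin m) ℂ) * M *
      ((P⁻¹ : (Matrix (Fin m) (Fin m) ℂ)ˣ) : Matrix (Fin m) (Fin m) ℂ))) =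
      spectralIndex (Matrix.toLin' M) := by
  refine (spectralIndex_conj (Matrix.toLin'OfInv P.inv_mul P.mul_inv) _ _ fun v => ?_).symm
  change P.1.mulVec (M.mulVec v) = Matrix.mulVec _ (P.1.mulVec v)
  rw [Matrix.mulVec_mulVec, Matrix.mulVec_mulVec, Matrix.mul_assoc _ _ P.1, Units.inv_mul,
    Matrix.mul_one]

theorem matCoeff_map_C_mul (P Q : Matrix (Fin m) (Fin m) ℂ) (A : Matrix (Fin m) (Fin m) ℂ[X])
    (k : ℕ) : matCoeff (P.map C * A * Q.map C) k = P * matCoeff A k * Q := by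
  ext i j
  simp [matCoeff, Matrix.mul_apply]

theorem natDegree_map_C_mul_le (P Q : Matrix (Fin m) (Fin m) ℂ) {A : Matrix (Fin m) (Fin m) ℂ[X]}
    {N : ℕ} (hA : ∀ i j, (A i j).natDegree ≤ N) (i j : Fin m) :
    ((P.map C * A * Q.map C) i j).natDegree ≤ N := by
  simp only [Matrix.mul_apply, Matrix.map_apply]
  refine natDegree_sum_le_of_forall_le _ _ fun k _ => (natDegree_mul_C_le _ _).trans ?_
  exact natDegree_sum_le_of_forall_le _ _ fun l _ => (natDegree_C_mul_le _ _).trans (hA _ _)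

/-- The constant conjugation is a similarity on the end coefficients and a unimodular equivalence on
`A`. The scalar factor, written as a reduced fraction and cleared of its denominator, leads to two
proportional systems. -/
theorem fuchsianIndex_eq_of_gaugeEquiv [NeZero m] {N N' : ℕ} {A A' : Matrix (Fin m) (Fin m) ℂ[X]}
    (hA : IsFuchsianPoly N A) (hA' : IsFuchsianPoly N' A')
    (h : GaugeEquiv (A.map (algebraMap ℂ[X] (RatFunc ℂ))) (A'.map (algebraMap ℂ[X] (RatFunc ℂ)))) :
    fuchsianIndex N A = fuchsianIndex N' A' := by
  obtain ⟨P, Q, hQ, h⟩ := h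
  set D : Matrix (Fin m) (Fin m) ℂ[X] := (P : Matrix (Fin m) (Fin m) ℂ).map C * A *
    ((P⁻¹ : (Matrix (Fin m) (Fin m) ℂ)ˣ) : Matrix (Fin m) (Fin m) ℂ).map C with hD
  have hDF : IsFuchsianPoly N D := by
    refine ⟨natDegree_map_C_mul_le _ _ hA.1, ?_, ?_⟩
    · rw [hD, matCoeff_map_C_mul]
      exact (P.isUnit.mul hA.2.1).mul (P⁻¹).isUnit
    · rw [hD, matCoeff_map_C_mul]
      exact (P.isUnit.mul hA.2.2).mul (P⁻¹).isUnit
  let u : (Matrix (Fin m) (Fin m) ℂ[X])ˣ := Units.map (C : ℂ →+* ℂ[X]).mapMatrix.toMonoidHom P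
  have hAD : fuchsianIndex N A = fuchsianIndex N D := by
    have h1 : divisorIndex D = divisorIndex A := by
      refine finsum_congr fun a => ?_
      congr 1
      funext k
      exact localDim_equiv A u u⁻¹ a k
    rw [fuchsianIndex, fuchsianIndex, h1, hD, matCoeff_map_C_mul, matCoeff_map_C_mul,
      spectralIndex_conj_matrix, spectralIndex_conj_matrix]
  rw [hAD]
  refine fuchsianIndex_eq_of_smul_eq hDF hA' (f := Q.num) (g := Q.denom)
    (RatFunc.isCoprime_num_denom Q) (RatFunc.num_ne_zero hQ) (RatFunc.denom_ne_zero Q) ?_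
  have hDm : D.map (algebraMap ℂ[X] (RatFunc ℂ)) = (P : Matrix (Fin m) (Fin m) ℂ).map RatFunc.C *
      A.map (algebraMap ℂ[X] (RatFunc ℂ)) *
      ((P⁻¹ : (Matrix (Fin m) (Fin m) ℂ)ˣ) : Matrix (Fin m) (Fin m) ℂ).map RatFunc.C := by
    rw [hD, Matrix.map_mul, Matrix.map_mul, Matrix.map_map, Matrix.map_map]
    rfl
  rw [← hDm] at h
  ext1 i j
  have hij := congrFun (congrFun h i) j
  refine RatFunc.algebraMap_injective ℂ ?_
  simp only [Matrix.map_apply, Matrix.smul_apply, smul_eq_mul, map_mul] at hij ⊢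
  have hQn : algebraMap ℂ[X] (RatFunc ℂ) Q.denom * Q = algebraMap ℂ[X] (RatFunc ℂ) Q.num := by
    rw [mul_comm, ← eq_div_iff (RatFunc.algebraMap_ne_zero (RatFunc.denom_ne_zero Q)),
      RatFunc.num_div_denom]
  rw [hij, ← mul_assoc, hQn]

/-- Removal of the scalar factors of a Fuchsian polynomial system. -/
theorem IsFuchsianPoly.exists_primitive [NeZero m] {N : ℕ} {A : Matrix (Fin m) (Fin m) ℂ[X]}
    (hA : IsFuchsianPoly N A) : ∃ (N' : ℕ) (A' : Matrix (Fin m) (Fin m) ℂ[X]) (g : ℂ[X]),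
      g ≠ 0 ∧ A = g • A' ∧ IsFuchsianPoly N' A' ∧ ∀ a : ℂ, A'.map (eval a) ≠ 0 := by
  induction N generalizing A with
  | zero =>
    refine ⟨0, A, 1, one_ne_zero, (one_smul _ _).symm, hA, fun a ha => hA.2.1.ne_zero ?_⟩
    rw [← ha]
    ext i j
    have := eq_C_of_natDegree_le_zero (hA.1 i j)
    simp only [matCoeff, Matrix.map_apply]
    conv_rhs => rw [this]
    simp
  | succ N ih =>
    by_cases h : ∀ a : ℂ, A.map (eval a) ≠ 0
    · exact ⟨N + 1, A, 1, one_ne_zero, (one_smul _ _).symm, hA, h⟩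
    -- A point where the whole matrix vanishes gives a scalar factor `X - a`. Removing it keeps the
    -- two end coefficients invertible and lowers the degree bound by one.
    · push Not at h
      obtain ⟨a, ha⟩ := h
      have hdvd : ∀ i j, ∃ g, A i j = (X - C a) * g := fun i j =>
        dvd_iff_isRoot.2 (congrFun (congrFun ha i) j)
      choose B hB using hdvd
      have hAB : A = (X - C a : ℂ[X]) • Matrix.of B := by
        ext1 i j
        exact hB i j
      have hdeg : ∀ i j, (Matrix.of B i j).natDegree ≤ N := by
        intro i j
        have h1 := hA.1 i j
        rw [hB] at h1
        by_cases h0 : B i j = 0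
        · simp [h0]
        · rw [natDegree_mul (X_sub_C_ne_zero a) h0, natDegree_X_sub_C] at h1
          simp only [Matrix.of_apply]
          omega
      have hBF : IsFuchsianPoly N (Matrix.of B) := by
        refine ⟨hdeg, ?_, ?_⟩
        · have h1 := hA.2.1
          rw [hAB, matCoeff_smul_zero] at h1
          rw [Matrix.isUnit_iff_isUnit_det, Matrix.det_smul] at h1
          exact (Matrix.isUnit_iff_isUnit_det _).2 (isUnit_of_mul_isUnit_right h1)
        · have h1 := hA.2.2
          have h2 := matCoeff_smul_add (X - C a) hdeg
          rw [natDegree_X_sub_C, leadingCoeff_X_sub_C, one_smul, ← hAB, add_comm] at h2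
          rwa [← h2]
      obtain ⟨N', A', g, hg, h1, h2, h3⟩ := ih hBF
      exact ⟨N', A', (X - C a) * g, mul_ne_zero (X_sub_C_ne_zero a) hg, by rw [mul_smul, ← h1, hAB],
        h2, h3⟩

/-- The index may be computed from any Fuchsian polynomial system of the gauge class, canonical or
not. Existence comes from removing scalar factors and taking Jordan and Smith forms, uniqueness from
gauge invariance. -/
theorem isRigidityIndex_iff [NeZero m] {N : ℕ} {A : Matrix (Fin m) (Fin m) ℂ[X]}
    (hA : IsFuchsianPoly N A) {R : Matrix (Fin m) (Fin m) (RatFunc ℂ)}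
    (hR : GaugeEquiv R (A.map (algebraMap ℂ[X] (RatFunc ℂ)))) (s : ℤ) :
    IsRigidityIndex R s ↔ s = fuchsianIndex N A := by
  have key : ∀ s, IsRigidityIndex R s → s = fuchsianIndex N A := by
    rintro s ⟨N', A', hcan, hF, k₀, α₀, t₀, k₁, α₁, t₁, d, h0, h1, hd, rfl⟩
    rw [fuchsianIndex_eq_of_gaugeEquiv hA hF (hR.symm.trans hcan.1), fuchsianIndex,
      h0.spectralIndex_eq, h1.spectralIndex_eq, hd.divisorIndex_eq hF.det_ne_zero]
  refine ⟨key s, ?_⟩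
  rintro rfl
  obtain ⟨N', A', g, hg, h1, h2, h3⟩ := hA.exists_primitive
  have hcan : IsCanonicalForm R N' A' := by
    refine ⟨hR.trans (GaugeEquiv.symm ?_), h2.1, h2.2.1.ne_zero, h2.2.2.ne_zero, h3⟩
    have h4 : A.map (algebraMap ℂ[X] (RatFunc ℂ)) =
        algebraMap ℂ[X] (RatFunc ℂ) g • A'.map (algebraMap ℂ[X] (RatFunc ℂ)) := by
      rw [h1]
      ext i j
      simp
    rw [h4]
    exact gaugeEquiv_smul _ (RatFunc.algebraMap_ne_zero hg)
  obtain ⟨s, hs⟩ := exists_isRigidityIndex hcan h2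
  rwa [← key s hs]

end FuchsianIndex

/-! ### Realizations: from a Fuchsian system to a linear pencil -/

theorem finrank_map_add_finrank_inf_ker {V W : Type*} [AddCommGroup V] [Module ℂ V]
    [AddCommGroup W] [Module ℂ W] (g : V →ₗ[ℂ] W) (S : Submodule ℂ V) [FiniteDimensional ℂ S] :
    Module.finrank ℂ (S.map g) + Module.finrank ℂ (S ⊓ LinearMap.ker g : Submodule ℂ V) =
      Module.finrank ℂ S := by
  rw [← LinearMap.finrank_range_add_finrank_ker (g.domRestrict S), LinearMap.range_domRestrict]
  congr 1
  rw [LinearMap.ker_domRestrict, ← Submodule.map_comap_subtype]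
  exact (Submodule.equivMapOfInjective _ S.injective_subtype _).symm.finrank_eq

namespace QEquation

variable {N : ℕ} {n : Type} [Fintype n] [DecidableEq n]

/-- Rank factorizations `Bₖ = Xₖ Yₖ` of the residues, with one-sided inverses of the factors,
and the inverse `H` of `1 - B₀`. -/
structure Realization (E : QEquation N n) where
  H : Matrix n n ℂ
  H_mul : H * (1 - E.Bzero) = 1
  mul_H : (1 - E.Bzero) * H = 1
  rk : Fin N → ℕ
  col : ∀ k, Matrix n (Fin (rk k)) ℂ
  row : ∀ k, Matrix (Fin (rk k)) n ℂ
  colInv : ∀ k, Matrix (Fin (rk k)) n ℂ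
  rowInv : ∀ k, Matrix n (Fin (rk k)) ℂ
  col_mul_row : ∀ k, col k * row k = E.B k
  colInv_mul : ∀ k, colInv k * col k = 1
  mul_rowInv : ∀ k, row k * rowInv k = 1

end QEquation

/-- The action of a constant matrix. -/
noncomputable abbrev constAct {n p : Type*} [Fintype p] (a : ℂ) (K : Matrix n p ℂ) :
    (p → LocalDual a) →ₗ[ℂ[X]] (n → LocalDual a) :=
  polyAct (LocalDual a) (K.map C)

theorem constAct_mul {n p r : Type*} [Fintype p] [Fintype r] {a : ℂ} (K : Matrix n p ℂ)
    (K' : Matrix p r ℂ) (v : r → LocalDual a) :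
    constAct a (K * K') v = constAct a K (constAct a K' v) := by
  rw [constAct, Matrix.map_mul, polyAct_mul]

theorem constAct_one {n : Type*} [Fintype n] [DecidableEq n] {a : ℂ} (v : n → LocalDual a) :
    constAct a (1 : Matrix n n ℂ) v = v := by
  rw [constAct, Matrix.map_one _ C_0 C_1, polyAct_one]

theorem constAct_cancel {n p : Type*} [Fintype n] [Fintype p] [DecidableEq p] {a : ℂ}
    {K : Matrix p n ℂ} {K' : Matrix n p ℂ} (h : K * K' = 1) (v : p → LocalDual a) :
    constAct a K (constAct a K' v) = v := by
  rw [← constAct_mul, h, constAct_one]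

theorem constAct_smul {n p : Type*} [Fintype p] {a : ℂ} (c : ℂ) (K : Matrix n p ℂ)
    (v : p → LocalDual a) : constAct a (c • K) v = (C c : ℂ[X]) • constAct a K v := by
  rw [constAct, ← polyAct_smul]
  congr 2
  ext1 i j
  simp

/-- The solutions of the linear pencil
`(1 - x / bₖ) uₖ + (x / bₖ) ∑ₗ Zₖₗ uₗ = 0`, `(x - a) ^ j u = 0`. -/
noncomputable def pencilSol {N : ℕ} {rk : Fin N → ℕ} (b : Fin N → ℂ)
    (Z : ∀ k l, Matrix (Fin (rk k)) (Fin (rk l)) ℂ) (a : ℂ) (j : ℕ) :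
    Submodule ℂ (∀ k, Fin (rk k) → LocalDual a) :=
  (LinearMap.ker (LinearMap.pi fun k => (1 - C (b k)⁻¹ * X : ℂ[X]) • LinearMap.proj k +
      (C (b k)⁻¹ * X : ℂ[X]) • ∑ l, constAct a (Z k l) ∘ₗ LinearMap.proj l) ⊓
    Submodule.torsionBy ℂ[X] _ ((X - C a) ^ j)).restrictScalars ℂ

theorem mem_pencilSol {N : ℕ} {rk : Fin N → ℕ} {b : Fin N → ℂ}
    {Z : ∀ k l, Matrix (Fin (rk k)) (Fin (rk l)) ℂ} {a : ℂ} {j : ℕ}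
    {u : ∀ k, Fin (rk k) → LocalDual a} :
    u ∈ pencilSol b Z a j ↔ (∀ k, (1 - C (b k)⁻¹ * X : ℂ[X]) • u k +
      (C (b k)⁻¹ * X : ℂ[X]) • ∑ l, constAct a (Z k l) (u l) = 0) ∧
      ((X - C a) ^ j : ℂ[X]) • u = 0 := by
  rw [pencilSol, Submodule.restrictScalars_mem, Submodule.mem_inf, LinearMap.mem_ker,
    Submodule.mem_torsionBy_iff, funext_iff]
  simp

instance {N : ℕ} {rk : Fin N → ℕ} (b : Fin N → ℂ)
    (Z : ∀ k l, Matrix (Fin (rk k)) (Fin (rk l)) ℂ) (a : ℂ) (j : ℕ) :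
    FiniteDimensional ℂ (pencilSol b Z a j) := by
  let f : pencilSol b Z a j →ₗ[ℂ] (∀ k, Fin (rk k) → LocalDual.tor a j) :=
    { toFun := fun u k i => ⟨u.1 k i, congrFun (congrFun (mem_pencilSol.1 u.2).2 k) i⟩
      map_add' := fun _ _ => rfl
      map_smul' := fun _ _ => rfl }
  have h1 : ∀ k, Module.Finite ℂ (Fin (rk k) → LocalDual.tor a j) := fun k => Module.Finite.pi
  have h2 : Module.Finite ℂ (∀ k, Fin (rk k) → LocalDual.tor a j) := Module.Finite.pi
  have h3 := isNoetherian_of_isNoetherianRing_of_finite ℂ (∀ k, Fin (rk k) → LocalDual.tor a j)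
  refine Module.Finite.of_injective f fun u w h => Subtype.ext ?_
  funext k i
  exact congrArg Subtype.val (congrFun (congrFun h k) i)

namespace LocalDual

variable {a : ℂ} {n : Type*}

theorem pi_eq_zero_of_smul_eq_zero {w : ℂ[X]} (hw : ¬ w.IsRoot a) {v : n → LocalDual a}
    (h : w • v = 0) : v = 0 :=
  funext fun i => eq_zero_of_smul_eq_zero hw (congrFun h i)

theorem pi_exists_smul_eq {w : ℂ[X]} (hw : ¬ w.IsRoot a) (v : n → LocalDual a) :
    ∃ v', w • v' = v := by
  choose v' hv' using fun i => exists_smul_eq hw (v i)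
  exact ⟨v', funext hv'⟩

end LocalDual

namespace QEquation

variable {N : ℕ} {n : Type} [Fintype n] [DecidableEq n] {E : QEquation N n}

-- The identity `1/(1 - x/b) = 1 + (x/b)/(1 - x/b)` moves the constant parts of all the fractions
-- into `1 - B₀`, the value at the origin. Its invertibility is what permits the elimination of `v`.
omit [Fintype n] in
theorem polyCoeff_eq (E : QEquation N n) :
    E.polyCoeff = (∏ i, (1 - C (E.b i)⁻¹ * X)) • (1 - E.Bzero).map C +
      ∑ k, ((∏ j ∈ Finset.univ.erase k, (1 - C (E.b j)⁻¹ * X)) * (C (E.b k)⁻¹ * X)) •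
        (E.B k).map C := by
  have hB : (1 - E.Bzero) = E.Binf + ∑ i, E.B i := by
    rw [Bzero]
    abel
  have hmap : (1 - E.Bzero).map (C : ℂ →+* ℂ[X]) = E.Binf.map C + ∑ i, (E.B i).map C := by
    rw [hB]
    ext1 i j
    simp [Matrix.sum_apply]
  rw [hmap, smul_add, add_assoc, polyCoeff, Finset.smul_sum, ← Finset.sum_add_distrib]
  congr 1
  refine Finset.sum_congr rfl fun k _ => ?_
  rw [← add_smul, ← Finset.mul_prod_erase _ _ (Finset.mem_univ k)]
  congr 1
  ring

omit [Fintype n] [DecidableEq n] in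
theorem not_isRoot_factor (E : QEquation N n) {k : Fin N} {a : ℂ} (h : E.b k ≠ a) :
    ¬ (1 - C (E.b k)⁻¹ * X : ℂ[X]).IsRoot a := by
  intro hr
  have : (E.b k)⁻¹ * a = 1 := by
    have : 1 - (E.b k)⁻¹ * a = 0 := by simpa [IsRoot] using hr
    linear_combination -this
  exact h (by rw [← mul_one (E.b k), ← this, mul_inv_cancel_left₀ (E.b_ne_zero k)])

omit [Fintype n] [DecidableEq n] in
theorem not_isRoot_prod (E : QEquation N n) {s : Finset (Fin N)} {a : ℂ} (h : ∀ k ∈ s, E.b k ≠ a) :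
    ¬ (∏ k ∈ s, (1 - C (E.b k)⁻¹ * X) : ℂ[X]).IsRoot a := by
  rw [IsRoot, eval_prod, Finset.prod_eq_zero_iff]
  rintro ⟨k, hk, h0⟩
  exact E.not_isRoot_factor (h k hk) h0

omit [Fintype n] [DecidableEq n] in
theorem factor_eq (E : QEquation N n) (l : Fin N) :
    (1 - C (E.b l)⁻¹ * X : ℂ[X]) = -C (E.b l)⁻¹ * (X - C (E.b l)) := by
  have : (C (E.b l)⁻¹ * C (E.b l) : ℂ[X]) = 1 := by
    rw [← C_mul, inv_mul_cancel₀ (E.b_ne_zero l), C_1]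
  linear_combination -this

omit [Fintype n] [DecidableEq n] in
theorem prod_erase_smul (E : QEquation N n) {M : Type*} [AddCommGroup M] [Module ℂ[X] M]
    (k : Fin N) (w : M) :
    (∏ j ∈ Finset.univ.erase k, (1 - C (E.b j)⁻¹ * X : ℂ[X])) • (1 - C (E.b k)⁻¹ * X : ℂ[X]) • w =
      (∏ j, (1 - C (E.b j)⁻¹ * X : ℂ[X])) • w := by
  rw [smul_smul, Finset.prod_erase_mul _ (fun j => (1 - C (E.b j)⁻¹ * X : ℂ[X])) (Finset.mem_univ k)]

namespace Realization

variable (r : E.Realization)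

/-- The matrix `Y (1 - B₀)⁻¹ X`. -/
def core (k l : Fin N) : Matrix (Fin (r.rk k)) (Fin (r.rk l)) ℂ :=
  r.row k * (r.H * r.col l)

/-- The map `u ↦ - (1 - B₀)⁻¹ ∑ Xₖ uₖ`. -/
noncomputable def state (a : ℂ) : (∀ k, Fin (r.rk k) → LocalDual a) →ₗ[ℂ[X]] (n → LocalDual a) :=
  -∑ k, constAct a (r.H * r.col k) ∘ₗ LinearMap.proj k

theorem state_apply {a : ℂ} (u : ∀ k, Fin (r.rk k) → LocalDual a) :
    r.state a u = -constAct a r.H (∑ k, constAct a (r.col k) (u k)) := by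
  simp [state, constAct_mul]

theorem constAct_state {a : ℂ} (u : ∀ k, Fin (r.rk k) → LocalDual a) :
    constAct a (1 - E.Bzero) (r.state a u) = -∑ k, constAct a (r.col k) (u k) := by
  rw [state_apply, map_neg, constAct_cancel r.mul_H]

theorem state_eq_of_eq {a : ℂ} {u : ∀ k, Fin (r.rk k) → LocalDual a} {v : n → LocalDual a}
    (h : constAct a (1 - E.Bzero) v + ∑ k, constAct a (r.col k) (u k) = 0) : r.state a u = v := by
  rw [state_apply, ← eq_neg_of_add_eq_zero_left h |> neg_eq_iff_eq_neg.2, map_neg, neg_neg,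
    constAct_cancel r.H_mul]

/-- In terms of the state `v` of `u`, the pencil says that `u k` is formally `(x/bₖ)/(1 - x/bₖ)`
times `rowₖ v`, while `(1 - B₀) v + ∑ colₖ uₖ = 0` holds by construction of the state. -/
theorem mem_pencilSol_iff {a : ℂ} {j : ℕ} {u : ∀ k, Fin (r.rk k) → LocalDual a} :
    u ∈ pencilSol E.b r.core a j ↔ (∀ k, (1 - C (E.b k)⁻¹ * X : ℂ[X]) • u k =
      (C (E.b k)⁻¹ * X : ℂ[X]) • constAct a (r.row k) (r.state a u)) ∧
      ((X - C a) ^ j : ℂ[X]) • u = 0 := by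
  rw [mem_pencilSol]
  refine and_congr_left fun _ => forall_congr' fun k => ?_
  have : ∑ l, constAct a (r.core k l) (u l) = -constAct a (r.row k) (r.state a u) := by
    rw [state]
    simp [core, constAct_mul]
  rw [this, smul_neg, add_neg_eq_zero]

theorem polyAct_polyCoeff {a : ℂ} (v : n → LocalDual a) :
    polyAct _ E.polyCoeff v =
      (∏ i, (1 - C (E.b i)⁻¹ * X : ℂ[X])) • constAct a (1 - E.Bzero) v +
      ∑ k, (∏ j ∈ Finset.univ.erase k, (1 - C (E.b j)⁻¹ * X : ℂ[X])) •
        constAct a (r.col k) ((C (E.b k)⁻¹ * X : ℂ[X]) • constAct a (r.row k) v) := by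
  rw [polyCoeff_eq, polyAct_add, polyAct_smul, polyAct_sum]
  congr 1
  refine Finset.sum_congr rfl fun k _ => ?_
  rw [polyAct_smul, mul_smul, map_smul, ← constAct_mul, r.col_mul_row]

/-- If the state vanishes, so does each component with `b k ≠ a`, as `1 - x/bₖ` acts injectively. At
most one component is left, and it vanishes because `colₗ` has a left inverse. Hence passing to
states preserves dimensions. -/
theorem eq_zero_of_state_eq_zero {a : ℂ} {j : ℕ} {u : ∀ k, Fin (r.rk k) → LocalDual a}
    (hu : u ∈ pencilSol E.b r.core a j) (h : r.state a u = 0) : u = 0 := by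
  have h1 := (r.mem_pencilSol_iff.1 hu).1
  simp only [h, map_zero, smul_zero] at h1
  have h2 : ∀ k, E.b k ≠ a → u k = 0 := fun k hk =>
    LocalDual.pi_eq_zero_of_smul_eq_zero (E.not_isRoot_factor hk) (h1 k)
  funext l
  by_cases hl : E.b l = a
  · have h3 := r.constAct_state u
    rw [h, map_zero, Finset.sum_eq_single l] at h3
    · have h4 := congrArg (constAct a (r.colInv l)) h3
      rw [map_neg, constAct_cancel (r.colInv_mul l), map_zero] at h4
      exact neg_eq_zero.1 h4.symm
    · intro k _ hk
      rw [h2 k fun h' => hk (E.b_injective (h'.trans hl.symm)), map_zero]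
    · simp
  · exact h2 l hl

theorem finrank_map_state (a : ℂ) (j : ℕ) :
    Module.finrank ℂ ((pencilSol E.b r.core a j).map ((r.state a).restrictScalars ℂ)) =
      Module.finrank ℂ (pencilSol E.b r.core a j) := by
  rw [← finrank_map_add_finrank_inf_ker ((r.state a).restrictScalars ℂ) (pencilSol E.b r.core a j)]
  have : pencilSol E.b r.core a j ⊓ LinearMap.ker ((r.state a).restrictScalars ℂ) = ⊥ :=
    (Submodule.eq_bot_iff _).2 fun u hu => r.eq_zero_of_state_eq_zero hu.1 hu.2
  rw [this, finrank_bot, add_zero]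

/-- Away from the poles, the local solutions are those of the pencil. -/
theorem localDim_of_ne {a : ℂ} (ha : ∀ k, E.b k ≠ a) (j : ℕ) :
    localDim E.polyCoeff a j = Module.finrank ℂ (pencilSol E.b r.core a j) := by
  have : localSol E.polyCoeff a j =
      (pencilSol E.b r.core a j).map ((r.state a).restrictScalars ℂ) := ?_
  · rw [← r.finrank_map_state, localDim, this]
  ext v
  rw [Submodule.mem_map]
  constructor
  · intro hv
    obtain ⟨h1, h2⟩ := mem_localSol.1 hv
    -- Away from the poles `1 - x/bₖ` is invertible on the module, so `uₖ = (x/bₖ)/(1 - x/bₖ) rowₖ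
    -- v` has a meaning.
    choose u hu using fun k => LocalDual.pi_exists_smul_eq (E.not_isRoot_factor (ha k))
      ((C (E.b k)⁻¹ * X : ℂ[X]) • constAct a (r.row k) v)
    have h3 : r.state a u = v := by
      refine r.state_eq_of_eq (LocalDual.pi_eq_zero_of_smul_eq_zero
        (E.not_isRoot_prod (s := Finset.univ) fun k _ => ha k) ?_)
      rw [← h1, r.polyAct_polyCoeff, smul_add, Finset.smul_sum]
      congr 1
      refine Finset.sum_congr rfl fun k _ => ?_
      rw [← hu, map_smul, E.prod_erase_smul]
    refine ⟨u, r.mem_pencilSol_iff.2 ⟨fun k => by rw [hu, h3], ?_⟩, h3⟩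
    funext k
    refine LocalDual.pi_eq_zero_of_smul_eq_zero (E.not_isRoot_factor (ha k)) ?_
    rw [Pi.smul_apply, smul_comm, hu, smul_comm, ← map_smul, h2, map_zero, smul_zero]
  · rintro ⟨u, hu, rfl⟩
    obtain ⟨h1, h2⟩ := r.mem_pencilSol_iff.1 hu
    refine mem_localSol.2 ⟨?_, ?_⟩
    · change polyAct _ _ (r.state a u) = 0
      have : ∀ k, (∏ j ∈ Finset.univ.erase k, (1 - C (E.b j)⁻¹ * X : ℂ[X])) • constAct a (r.col k)
          ((C (E.b k)⁻¹ * X : ℂ[X]) • constAct a (r.row k) (r.state a u)) =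
          (∏ i, (1 - C (E.b i)⁻¹ * X : ℂ[X])) • constAct a (r.col k) (u k) := by
        intro k
        rw [← h1, map_smul, E.prod_erase_smul]
      rw [r.polyAct_polyCoeff, Finset.sum_congr rfl fun k _ => this k, ← Finset.smul_sum, ← smul_add,
        r.constAct_state, neg_add_cancel, smul_zero]
    · change _ • r.state a u = 0
      rw [← map_smul, h2, map_zero]

/-- At the pole `b l` the factor `1 - x/bₗ` is missing only from the term of index `l`. The last
bracket is the state equation for the state `(X - bₗ) v`, with `uₖ = (X - bₗ) yₖ` for `k ≠ l` and
`uₗ = -X rowₗ v`. -/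
theorem polyAct_polyCoeff_at {l : Fin N} {v : n → LocalDual (E.b l)}
    {y : ∀ k, Fin (r.rk k) → LocalDual (E.b l)}
    (hy : ∀ k, k ≠ l → (1 - C (E.b k)⁻¹ * X : ℂ[X]) • y k =
      (C (E.b k)⁻¹ * X : ℂ[X]) • constAct _ (r.row k) v) :
    polyAct _ E.polyCoeff v =
      (∏ j ∈ Finset.univ.erase l, (1 - C (E.b j)⁻¹ * X : ℂ[X])) •
        (-C (E.b l)⁻¹ : ℂ[X]) • (constAct _ (1 - E.Bzero) ((X - C (E.b l) : ℂ[X]) • v) +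
          ∑ k ∈ Finset.univ.erase l, constAct _ (r.col k) ((X - C (E.b l) : ℂ[X]) • y k) -
          constAct _ (r.col l) ((X : ℂ[X]) • constAct _ (r.row l) v)) := by
  have h1 : ∀ k ∈ Finset.univ.erase l,
      (∏ j ∈ Finset.univ.erase k, (1 - C (E.b j)⁻¹ * X : ℂ[X])) •
        constAct _ (r.col k) ((C (E.b k)⁻¹ * X : ℂ[X]) • constAct _ (r.row k) v) =
      (∏ i, (1 - C (E.b i)⁻¹ * X : ℂ[X])) • constAct _ (r.col k) (y k) := by
    intro k hk
    rw [← hy k (Finset.ne_of_mem_erase hk), map_smul, E.prod_erase_smul]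
  rw [r.polyAct_polyCoeff, ← Finset.add_sum_erase _ _ (Finset.mem_univ l), Finset.sum_congr rfl h1,
    ← Finset.smul_sum, ← Finset.mul_prod_erase _ _ (Finset.mem_univ l), E.factor_eq l]
  simp only [map_smul, ← Finset.smul_sum, smul_add, smul_sub, smul_smul]
  rw [mul_comm (-C (E.b l)⁻¹ * (X - C (E.b l))), ← mul_assoc]
  have : ∀ (p : ℂ[X]) (w : n → LocalDual (E.b l)), (p * (C (E.b l)⁻¹ * X)) • w =
      -((p * (-C (E.b l)⁻¹ * X)) • w) := by
    intro p w
    rw [show p * (C (E.b l)⁻¹ * X) = -(p * (-C (E.b l)⁻¹ * X)) by ring]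
    exact neg_smul _ _
  rw [this]
  abel

theorem exists_pencilSol_of_localSol {l : Fin N} {j : ℕ} {v : n → LocalDual (E.b l)}
    (hv : v ∈ localSol E.polyCoeff (E.b l) (j + 1)) :
    ∃ u ∈ pencilSol E.b r.core (E.b l) j, r.state _ u = (X - C (E.b l) : ℂ[X]) • v := by
  obtain ⟨hv1, hv2⟩ := mem_localSol.1 hv
  have hne : ∀ k, k ≠ l → E.b k ≠ E.b l := fun k hk h => hk (E.b_injective h)
  have hex : ∀ k, ∃ y, k ≠ l → (1 - C (E.b k)⁻¹ * X : ℂ[X]) • y =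
      (C (E.b k)⁻¹ * X : ℂ[X]) • constAct _ (r.row k) v := by
    intro k
    by_cases hk : k = l
    · exact ⟨0, fun h => absurd hk h⟩
    · obtain ⟨y, hy⟩ := LocalDual.pi_exists_smul_eq (E.not_isRoot_factor (hne k hk))
        ((C (E.b k)⁻¹ * X : ℂ[X]) • constAct _ (r.row k) v)
      exact ⟨y, fun _ => hy⟩
  choose y hy using hex
  have h1 := r.polyAct_polyCoeff_at hy
  rw [hv1] at h1
  have hb : ¬ (-C (E.b l)⁻¹ : ℂ[X]).IsRoot (E.b l) := by
    simp [IsRoot, E.b_ne_zero l]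
  have h2 := LocalDual.pi_eq_zero_of_smul_eq_zero hb (LocalDual.pi_eq_zero_of_smul_eq_zero
    (E.not_isRoot_prod fun k hk => hne k (Finset.ne_of_mem_erase hk)) h1.symm)
  -- The quotient `(x/bₗ)/(1 - x/bₗ) rowₗ v` need not exist uniquely at the pole, but its formal
  -- product with `X - bₗ` is `-X rowₗ v`. This explains the shift from `j + 1` to `j`.
  let u : ∀ k, Fin (r.rk k) → LocalDual (E.b l) :=
    Function.update (fun k => (X - C (E.b l) : ℂ[X]) • y k) l (-((X : ℂ[X]) • constAct _ (r.row l) v))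
  have hul : u l = -((X : ℂ[X]) • constAct _ (r.row l) v) := Function.update_self _ _ _
  have huk : ∀ k, k ≠ l → u k = (X - C (E.b l) : ℂ[X]) • y k := fun k hk =>
    Function.update_of_ne hk _ _
  have h3 : constAct _ (1 - E.Bzero) ((X - C (E.b l) : ℂ[X]) • v) +
      ∑ k, constAct _ (r.col k) (u k) = 0 := by
    rw [← h2, ← Finset.add_sum_erase _ _ (Finset.mem_univ l), hul, map_neg,
      Finset.sum_congr rfl fun k hk => by rw [huk k (Finset.ne_of_mem_erase hk)]]
    abel
  have h4 := r.state_eq_of_eq h3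
  have hk0 : ∀ k, k ≠ l → ((X - C (E.b l)) ^ j : ℂ[X]) • u k = 0 := by
    intro k hk
    refine LocalDual.pi_eq_zero_of_smul_eq_zero (E.not_isRoot_factor (hne k hk)) ?_
    rw [huk k hk, smul_smul ((X - C (E.b l)) ^ j), ← pow_succ, smul_comm, hy k hk, smul_comm, ← map_smul, hv2, map_zero,
      smul_zero]
  refine ⟨u, r.mem_pencilSol_iff.2 ⟨fun k => ?_, funext fun k => ?_⟩, h4⟩
  · rw [h4, map_smul]
    by_cases hk : k = l
    · subst hk
      rw [hul, E.factor_eq k, smul_neg, smul_smul, smul_smul]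
      exact (neg_smul _ _).symm.trans (congrArg (· • constAct _ (r.row k) v) (by ring))
    · rw [huk k hk, smul_comm, hy k hk, smul_comm]
  · by_cases hk : k = l
    · subst hk
      -- The torsion order of the component at the pole is read off from the state equation: the
      -- other terms are already killed, and `colₗ` has a left inverse.
      have h5 := congrArg (fun w => ((X - C (E.b k)) ^ j : ℂ[X]) • w) h3
      simp only [smul_add, smul_zero] at h5
      rw [← map_smul, smul_smul, ← pow_succ, hv2, map_zero, zero_add,
        ← Finset.add_sum_erase _ _ (Finset.mem_univ k), smul_add, Finset.smul_sum,
        Finset.sum_eq_zero fun i hi => by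
          rw [← map_smul, hk0 i (Finset.ne_of_mem_erase hi), map_zero], add_zero, ← map_smul] at h5
      have h6 := congrArg (constAct _ (r.colInv k)) h5
      rwa [constAct_cancel (r.colInv_mul k), map_zero] at h6
    · exact hk0 k hk

theorem exists_localSol_of_pencilSol {l : Fin N} {j : ℕ}
    {u : ∀ k, Fin (r.rk k) → LocalDual (E.b l)} (hu : u ∈ pencilSol E.b r.core (E.b l) j) :
    ∃ v ∈ localSol E.polyCoeff (E.b l) (j + 1), (X - C (E.b l) : ℂ[X]) • v = r.state _ u := by
  obtain ⟨hu1, hu2⟩ := r.mem_pencilSol_iff.1 hu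
  have hne : ∀ k, k ≠ l → E.b k ≠ E.b l := fun k hk h => hk (E.b_injective h)
  choose v' hv' using fun i => LocalDual.X_sub_C_smul_surjective (E.b l) (r.state _ u i)
  replace hv' : (X - C (E.b l) : ℂ[X]) • v' = r.state _ u := funext hv'
  -- Dividing the state by `X - bₗ` leaves an ambiguity killed by `X - bₗ`. Up to the unit `bₗ⁻¹`,
  -- `δ` is the defect in `uₗ = -X rowₗ v'`. It is killed by `X - bₗ`, so `x/bₗ` fixes it, and
  -- subtracting `rowInvₗ δ` from `v'` removes it.
  set δ := (C (E.b l)⁻¹ : ℂ[X]) • u l + (C (E.b l)⁻¹ * X : ℂ[X]) • constAct _ (r.row l) v' with hδ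
  have hbC : (C (E.b l)⁻¹ * C (E.b l) : ℂ[X]) = 1 := by
    rw [← C_mul, inv_mul_cancel₀ (E.b_ne_zero l), C_1]
  have h1 : (X - C (E.b l) : ℂ[X]) • δ = 0 := by
    have := hu1 l
    rw [E.factor_eq l] at this
    rw [hδ, smul_add, smul_comm _ (C (E.b l)⁻¹ * X), ← map_smul, hv', ← this, smul_smul, ← add_smul]
    rw [mul_comm, neg_mul, add_neg_cancel, zero_smul]
  have h2 : (C (E.b l)⁻¹ * X : ℂ[X]) • δ = δ := by
    have : (C (E.b l)⁻¹ * X : ℂ[X]) = 1 + C (E.b l)⁻¹ * (X - C (E.b l)) := by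
      linear_combination hbC
    rw [this, add_smul, one_smul, mul_smul, h1, smul_zero, add_zero]
  let v := v' - constAct _ (r.rowInv l) δ
  have hv : (X - C (E.b l) : ℂ[X]) • v = r.state _ u := by
    rw [smul_sub, hv', ← map_smul, h1, map_zero, sub_zero]
  have h3 : u l = -((X : ℂ[X]) • constAct _ (r.row l) v) := by
    have h4 : (C (E.b l)⁻¹ : ℂ[X]) • (u l + (X : ℂ[X]) • constAct _ (r.row l) v) = 0 := by
      rw [smul_add, smul_smul, map_sub, constAct_cancel (r.mul_rowInv l), smul_sub, h2, ← add_sub_assoc,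
        ← hδ, sub_self]
    have hb : ¬ (C (E.b l)⁻¹ : ℂ[X]).IsRoot (E.b l) := by
      simp [IsRoot, E.b_ne_zero l]
    exact eq_neg_of_add_eq_zero_left (LocalDual.pi_eq_zero_of_smul_eq_zero hb h4)
  have hex : ∀ k, ∃ y, k ≠ l → (1 - C (E.b k)⁻¹ * X : ℂ[X]) • y =
      (C (E.b k)⁻¹ * X : ℂ[X]) • constAct _ (r.row k) v := by
    intro k
    by_cases hk : k = l
    · exact ⟨0, fun h => absurd hk h⟩
    · obtain ⟨y, hy⟩ := LocalDual.pi_exists_smul_eq (E.not_isRoot_factor (hne k hk))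
        ((C (E.b k)⁻¹ * X : ℂ[X]) • constAct _ (r.row k) v)
      exact ⟨y, fun _ => hy⟩
  choose y hy using hex
  have hyk : ∀ k, k ≠ l → (X - C (E.b l) : ℂ[X]) • y k = u k := by
    intro k hk
    refine sub_eq_zero.1 (LocalDual.pi_eq_zero_of_smul_eq_zero (E.not_isRoot_factor (hne k hk)) ?_)
    rw [smul_sub, hu1 k, smul_comm, hy k hk, smul_comm, ← map_smul, hv, sub_self]
  refine ⟨v, mem_localSol.2 ⟨?_, ?_⟩, hv⟩
  · have hs : ∑ k ∈ Finset.univ.erase l, constAct _ (r.col k) ((X - C (E.b l) : ℂ[X]) • y k) =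
        ∑ k ∈ Finset.univ.erase l, constAct _ (r.col k) (u k) :=
      Finset.sum_congr rfl fun k hk => by rw [hyk k (Finset.ne_of_mem_erase hk)]
    rw [r.polyAct_polyCoeff_at hy, hv, r.constAct_state, hs,
      ← Finset.add_sum_erase _ (fun k => constAct _ (r.col k) (u k)) (Finset.mem_univ l), h3, map_neg]
    have : ∀ x y : n → LocalDual (E.b l), -(-x + y) + y - x = 0 := fun x y => by abel
    rw [this, smul_zero, smul_zero]
  · rw [pow_succ, mul_smul, hv, ← map_smul, hu2, map_zero]

/-- On vectors killed by `X - bₗ` only the term of index `l` of `A` survives, with a nonzero scalar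
factor. The solutions thus form the kernel of `rowₗ`, and `rowₗ` is onto. -/
theorem localDim_one (l : Fin N) :
    r.rk l + localDim E.polyCoeff (E.b l) 1 = Fintype.card n := by
  have hfin : ∀ (p : Type) [Fintype p], Module.finrank ℂ
      (Submodule.pi Set.univ fun _ : p => LocalDual.tor (E.b l) 1) = Fintype.card p := by
    intro p _
    rw [finrank_submodule_pi]
    simp only [LocalDual.finrank_tor]
    simp
  have hmem : ∀ {p : Type} {v : p → LocalDual (E.b l)},
      v ∈ (Submodule.pi Set.univ fun _ : p => LocalDual.tor (E.b l) 1) ↔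
        (X - C (E.b l) : ℂ[X]) • v = 0 := by
    intro p v
    rw [Submodule.mem_pi, funext_iff]
    simp [Submodule.mem_torsionBy_iff]
  have key := finrank_map_add_finrank_inf_ker ((constAct (E.b l) (r.row l)).restrictScalars ℂ)
    (Submodule.pi Set.univ fun _ : n => LocalDual.tor (E.b l) 1)
  rw [hfin] at key
  have h1 : (Submodule.pi Set.univ fun _ : n => LocalDual.tor (E.b l) 1).map
      ((constAct (E.b l) (r.row l)).restrictScalars ℂ) =
      Submodule.pi Set.univ fun _ : Fin (r.rk l) => LocalDual.tor (E.b l) 1 := by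
    ext w
    rw [Submodule.mem_map, hmem]
    constructor
    · rintro ⟨v, hv, rfl⟩
      change _ • constAct _ _ v = 0
      rw [← map_smul, hmem.1 hv, map_zero]
    · intro hw
      refine ⟨constAct _ (r.rowInv l) w, hmem.2 ?_, constAct_cancel (r.mul_rowInv l) w⟩
      rw [← map_smul, hw, map_zero]
  have h2 : (Submodule.pi Set.univ fun _ : n => LocalDual.tor (E.b l) 1) ⊓
      LinearMap.ker ((constAct (E.b l) (r.row l)).restrictScalars ℂ) =
      localSol E.polyCoeff (E.b l) 1 := by
    ext v
    rw [Submodule.mem_inf, hmem, mem_localSol, pow_one, and_comm]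
    refine and_congr_left fun hv => ?_
    change constAct _ (r.row l) v = 0 ↔ _
    have hne : ∀ k, k ≠ l → E.b k ≠ E.b l := fun k hk h => hk (E.b_injective h)
    have hA : polyAct _ E.polyCoeff v = (∏ j ∈ Finset.univ.erase l, (1 - C (E.b j)⁻¹ * X : ℂ[X])) •
        constAct _ (r.col l) ((C (E.b l)⁻¹ * X : ℂ[X]) • constAct _ (r.row l) v) := by
      have hq : (1 - C (E.b l)⁻¹ * X : ℂ[X]) • v = 0 := by
        rw [E.factor_eq, mul_smul, hv, smul_zero]
      rw [r.polyAct_polyCoeff, ← Finset.prod_erase_mul _ _ (Finset.mem_univ l), mul_smul, ← map_smul,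
        hq, map_zero, smul_zero, zero_add, Finset.sum_eq_single l]
      · intro k _ hk
        have h0 : (1 - C (E.b l)⁻¹ * X : ℂ[X]) • constAct _ (r.col k)
            ((C (E.b k)⁻¹ * X : ℂ[X]) • constAct _ (r.row k) v) = 0 := by
          rw [← map_smul, smul_comm, ← map_smul (constAct _ (r.row k)), hq, map_zero, smul_zero,
            map_zero]
        rw [← Finset.prod_erase_mul _ _ (Finset.mem_erase.2 ⟨hk.symm, Finset.mem_univ l⟩), mul_smul,
          h0, smul_zero]
      · simp
    rw [hA]
    constructor
    · intro h
      rw [h, smul_zero, map_zero, smul_zero]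
    · intro h
      have h3 := LocalDual.pi_eq_zero_of_smul_eq_zero
        (E.not_isRoot_prod fun k hk => hne k (Finset.ne_of_mem_erase hk)) h
      have h4 := congrArg (constAct _ (r.colInv l)) h3
      rw [constAct_cancel (r.colInv_mul l), map_zero] at h4
      refine LocalDual.pi_eq_zero_of_smul_eq_zero ?_ h4
      simp [IsRoot, E.b_ne_zero l]
  rw [h1, h2, hfin, Fintype.card_fin] at key
  exact key

/-- At a pole, the local solutions are those of the pencil, up to a shift. -/
theorem localDim_succ (l : Fin N) (j : ℕ) :
    (localDim E.polyCoeff (E.b l) (j + 1) : ℤ) = ((Fintype.card n : ℤ) - r.rk l) +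
      Module.finrank ℂ (pencilSol E.b r.core (E.b l) j) := by
  let g : (n → LocalDual (E.b l)) →ₗ[ℂ] (n → LocalDual (E.b l)) :=
    (LinearMap.lsmul ℂ[X] _ (X - C (E.b l))).restrictScalars ℂ
  have hg : ∀ v, g v = (X - C (E.b l) : ℂ[X]) • v := fun v => rfl
  -- Multiplication by `X - bₗ` maps the solutions of level `j + 1` onto the states of the pencil of
  -- level `j`, with kernel the solutions of level 1.
  have key := finrank_map_add_finrank_inf_ker g (localSol E.polyCoeff (E.b l) (j + 1))
  have h1 : (localSol E.polyCoeff (E.b l) (j + 1)).map g =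
      (pencilSol E.b r.core (E.b l) j).map ((r.state _).restrictScalars ℂ) := by
    ext w
    rw [Submodule.mem_map, Submodule.mem_map]
    constructor
    · rintro ⟨v, hv, rfl⟩
      exact r.exists_pencilSol_of_localSol hv
    · rintro ⟨u, hu, rfl⟩
      exact r.exists_localSol_of_pencilSol hu
  have h2 : localSol E.polyCoeff (E.b l) (j + 1) ⊓ LinearMap.ker g =
      localSol E.polyCoeff (E.b l) 1 := by
    ext v
    rw [Submodule.mem_inf, LinearMap.mem_ker, hg, mem_localSol, mem_localSol, pow_one]
    refine ⟨fun h => ⟨h.1.1, h.2⟩, fun h => ⟨⟨h.1, ?_⟩, h.2⟩⟩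
    rw [pow_succ, mul_smul, h.2, smul_zero]
  rw [h1, h2, r.finrank_map_state] at key
  have := r.localDim_one l
  rw [localDim] at this ⊢
  omega

end Realization

end QEquation

/-! ### End coefficients, rescaling of the variable, the divisor term -/

namespace QEquation

variable {N : ℕ} {n : Type} [Fintype n] [DecidableEq n]

section Coefficients

variable (E : QEquation N n)

omit [Fintype n] in
theorem coeff_zero_polyCoeff : matCoeff E.polyCoeff 0 = 1 - E.Bzero := by
  rw [polyCoeff_eq]
  ext i j
  have h1 : (∏ i, (1 - C (E.b i)⁻¹ * X : ℂ[X])).coeff 0 = 1 := by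
    rw [coeff_zero_eq_eval_zero, eval_prod]
    simp
  have h2 : ∀ k (p : ℂ[X]) (z : ℂ), (p * (C (E.b k)⁻¹ * X) * C z).coeff 0 = 0 := by
    intro k p z
    rw [coeff_zero_eq_eval_zero]
    simp
  simp only [matCoeff, Matrix.map_apply, Matrix.add_apply, Matrix.smul_apply, smul_eq_mul,
    Matrix.sum_apply, coeff_add, finsetSum_coeff, h2, Finset.sum_const_zero, add_zero]
  rw [coeff_mul_C, h1, one_mul]

omit [Fintype n] [DecidableEq n] in
theorem natDegree_prod_factor_le (s : Finset (Fin N)) :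
    (∏ i ∈ s, (1 - C (E.b i)⁻¹ * X : ℂ[X])).natDegree ≤ s.card := by
  refine (Polynomial.natDegree_prod_le s _).trans ?_
  rw [Finset.card_eq_sum_ones]
  refine Finset.sum_le_sum fun i _ => ?_
  compute_degree

omit [Fintype n] [DecidableEq n] in
theorem natDegree_polyCoeff_le (i j : n) : (E.polyCoeff i j).natDegree ≤ N := by
  rw [polyCoeff, Matrix.add_apply]
  refine natDegree_add_le_of_degree_le ?_ ?_
  · refine (natDegree_mul_C_le _ _).trans ((E.natDegree_prod_factor_le _).trans ?_)
    simp
  · rw [Matrix.sum_apply]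
    refine natDegree_sum_le_of_forall_le _ _ fun k _ => ?_
    refine (natDegree_mul_C_le _ _).trans ((E.natDegree_prod_factor_le _).trans ?_)
    rw [Finset.card_erase_of_mem (Finset.mem_univ k), Finset.card_univ, Fintype.card_fin]
    omega

omit [Fintype n] [DecidableEq n] in
theorem coeff_top_polyCoeff : matCoeff E.polyCoeff N = (∏ i, -(E.b i)⁻¹) • E.Binf := by
  ext i j
  have h1 : (∏ i, (1 - C (E.b i)⁻¹ * X : ℂ[X])).coeff N = ∏ i, -(E.b i)⁻¹ := by
    have := coeff_prod_of_natDegree_le Finset.univ (fun i => (1 - C (E.b i)⁻¹ * X : ℂ[X])) 1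
      fun i _ => by compute_degree
    rw [Finset.card_univ, Fintype.card_fin, mul_one] at this
    rw [this]
    refine Finset.prod_congr rfl fun i _ => ?_
    simp [coeff_one]
  have h2 : ∀ (k : Fin N) (z : ℂ),
      ((∏ j ∈ Finset.univ.erase k, (1 - C (E.b j)⁻¹ * X : ℂ[X])) * C z).coeff N = 0 := by
    intro k z
    refine coeff_eq_zero_of_natDegree_lt (((natDegree_mul_C_le _ _).trans
      (E.natDegree_prod_factor_le _)).trans_lt ?_)
    rw [Finset.card_erase_of_mem (Finset.mem_univ k), Finset.card_univ, Fintype.card_fin]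
    have := k.2
    omega
  simp only [matCoeff, polyCoeff, Matrix.map_apply, Matrix.add_apply, Matrix.smul_apply, smul_eq_mul,
    Matrix.sum_apply, coeff_add, finsetSum_coeff, h2, Finset.sum_const_zero, add_zero]
  rw [coeff_mul_C, h1]

omit [Fintype n] [DecidableEq n] in
theorem prod_neg_inv_ne_zero : ∏ i, -(E.b i)⁻¹ ≠ 0 :=
  Finset.prod_ne_zero_iff.2 fun i _ => neg_ne_zero.2 (inv_ne_zero (E.b_ne_zero i))

theorem isFuchsianPoly_iff :
    IsFuchsianPoly N E.polyCoeff ↔ IsUnit (1 - E.Bzero) ∧ IsUnit E.Binf := by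
  rw [IsFuchsianPoly, coeff_zero_polyCoeff, coeff_top_polyCoeff, Matrix.isUnit_iff_isUnit_det (_ • _),
    Matrix.det_smul, IsUnit.mul_iff, ← Matrix.isUnit_iff_isUnit_det]
  exact ⟨fun h => ⟨h.2.1, h.2.2.2⟩, fun h => ⟨E.natDegree_polyCoeff_le, h.1,
    (isUnit_iff_ne_zero.2 E.prod_neg_inv_ne_zero).pow _, h.2⟩⟩

theorem gaugeEquiv_polyCoeff :
    GaugeEquiv E.coeff (E.polyCoeff.map (algebraMap ℂ[X] (RatFunc ℂ))) := by
  have hfac : ∀ k, algebraMap ℂ[X] (RatFunc ℂ) (1 - C (E.b k)⁻¹ * X) =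
      1 - RatFunc.X / RatFunc.C (E.b k) := by
    intro k
    rw [map_sub, map_mul, map_one, RatFunc.algebraMap_C, RatFunc.algebraMap_X, map_inv₀, div_eq_inv_mul]
  have hne : ∀ k, (1 - C (E.b k)⁻¹ * X : ℂ[X]) ≠ 0 := by
    intro k h0
    have := congrArg (eval 0) h0
    simp at this
  have hT : algebraMap ℂ[X] (RatFunc ℂ) (∏ k, (1 - C (E.b k)⁻¹ * X)) ≠ 0 :=
    RatFunc.algebraMap_ne_zero (Finset.prod_ne_zero_iff.2 fun k _ => hne k)
  have : E.polyCoeff.map (algebraMap ℂ[X] (RatFunc ℂ)) =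
      algebraMap ℂ[X] (RatFunc ℂ) (∏ k, (1 - C (E.b k)⁻¹ * X)) • E.coeff := by
    ext i j
    simp only [polyCoeff, coeff, Matrix.map_apply, Matrix.add_apply, Matrix.smul_apply, smul_eq_mul,
      Matrix.sum_apply, map_add, map_mul, map_sum, RatFunc.algebraMap_C, mul_add, Finset.mul_sum]
    congr 1
    refine Finset.sum_congr rfl fun k _ => ?_
    rw [← mul_assoc]
    congr 1
    rw [← hfac, ← Finset.prod_erase_mul _ _ (Finset.mem_univ k), map_mul,
      mul_inv_cancel_right₀ (RatFunc.algebraMap_ne_zero (hne k))]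
  rw [this]
  exact gaugeEquiv_smul _ hT

end Coefficients

/-- The substitution of `c x` for `x`. -/
noncomputable def rescale (E : QEquation N n) {c : ℂ} (hc : c ≠ 0) : QEquation N n where
  B := E.B
  Binf := E.Binf
  b k := c⁻¹ * E.b k
  b_ne_zero k := mul_ne_zero (inv_ne_zero hc) (E.b_ne_zero k)
  b_injective := (mul_right_injective₀ (inv_ne_zero hc)).comp E.b_injective

omit [Fintype n] [DecidableEq n] in
theorem polyCoeff_rescale (E : QEquation N n) {c : ℂ} (hc : c ≠ 0) :
    (E.rescale hc).polyCoeff = E.polyCoeff.map fun f => f.comp (C c * X) := by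
  have h : ∀ s : Finset (Fin N), (∏ k ∈ s, (1 - C (E.b k)⁻¹ * X : ℂ[X])).comp (C c * X) =
      ∏ k ∈ s, (1 - C ((E.rescale hc).b k)⁻¹ * X : ℂ[X]) := by
    intro s
    rw [prod_comp]
    refine Finset.prod_congr rfl fun k _ => ?_
    simp [rescale]
    ring
  ext1 i j
  simp only [polyCoeff, Matrix.map_apply, Matrix.add_apply, Matrix.smul_apply, smul_eq_mul,
    Matrix.sum_apply, add_comp, mul_comp, C_comp, h, Polynomial.sum_comp]
  rfl

/-- The pencils of an equation and of its `q`-middle convolution have the same solutions. -/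
theorem _root_.pencilSol_rescale {rk : Fin N → ℕ} (b : Fin N → ℂ)
    {Z Z' : ∀ k l, Matrix (Fin (rk k)) (Fin (rk l)) ℂ} {c : ℂ} (hc : c ≠ 0)
    (hne : ∀ k l, k ≠ l → Z' k l = c⁻¹ • Z k l)
    (hself : ∀ k, Z' k k = c⁻¹ • (Z k k - (1 - c) • (1 : Matrix (Fin (rk k)) (Fin (rk k)) ℂ)))
    (a : ℂ) (j : ℕ) : pencilSol (fun k => c⁻¹ * b k) Z' a j = pencilSol b Z a j := by
  ext u
  rw [mem_pencilSol, mem_pencilSol]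
  refine and_congr_left fun _ => forall_congr' fun k => ?_
  have hsub : ∀ {p r : Type} [Fintype p] [Fintype r] (K K' : Matrix p r ℂ) (w : r → LocalDual a),
      constAct a (K - K') w = constAct a K w - constAct a K' w := by
    intro p r _ _ K K' w
    rw [constAct, Matrix.map_sub _ (map_sub C), polyAct_sub]
  have hsum : ∑ l, constAct a (Z' k l) (u l) =
      (C c⁻¹ : ℂ[X]) • (∑ l, constAct a (Z k l) (u l) - (C (1 - c) : ℂ[X]) • u k) := by
    rw [← Finset.add_sum_erase _ _ (Finset.mem_univ k),
      ← Finset.add_sum_erase _ (fun l => constAct a (Z k l) (u l)) (Finset.mem_univ k), hself,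
      constAct_smul, hsub, constAct_smul, constAct_one,
      Finset.sum_congr rfl fun l hl => by rw [hne k l (Finset.ne_of_mem_erase hl).symm, constAct_smul],
      ← Finset.smul_sum, ← smul_add]
    congr 1
    abel
  have hcC : (C c * C c⁻¹ : ℂ[X]) = 1 := by
    rw [← C_mul, mul_inv_cancel₀ hc, C_1]
  have hcoef : (C (c⁻¹ * b k)⁻¹ * X : ℂ[X]) = C c * (C (b k)⁻¹ * X) := by
    rw [mul_inv, inv_inv, C_mul, mul_assoc]
  rw [hsum, hcoef, smul_smul, show C c * (C (b k)⁻¹ * X) * C c⁻¹ = C (b k)⁻¹ * X * (C c * C c⁻¹) by ring,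
    hcC, mul_one, smul_sub, smul_smul, ← add_sub_assoc, add_sub_right_comm, ← sub_smul]
  -- The pole `c⁻¹ b` turns `x/b` into `c x/b`; the factor `c` cancels the `c⁻¹` of `Z'`, and the
  -- diagonal shift by `1 - c` restores `1 - x/b`.
  have : (1 - C c * (C (b k)⁻¹ * X) - C (b k)⁻¹ * X * C (1 - c) : ℂ[X]) = 1 - C (b k)⁻¹ * X := by
    rw [C_sub, C_1]
    ring
  rw [this]

theorem _root_.finrank_pencilSol_zero {rk : Fin N → ℕ} (b : Fin N → ℂ)
    (Z : ∀ k l, Matrix (Fin (rk k)) (Fin (rk l)) ℂ) (a : ℂ) :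
    Module.finrank ℂ (pencilSol b Z a 0) = 0 := by
  have : pencilSol b Z a 0 = ⊥ :=
    (Submodule.eq_bot_iff _).2 fun u hu => by simpa using (mem_pencilSol.1 hu).2
  rw [this, finrank_bot]

/-- The contribution of the elementary divisors in terms of the pencil of a realization. -/
theorem Realization.divisorIndex_eq {m : ℕ} {E : QEquation N (Fin m)} (r : E.Realization)
    (hE : E.polyCoeff.det ≠ 0) :
    divisorIndex E.polyCoeff = ∑ᶠ a, sqSum (fun j => Module.finrank ℂ (pencilSol E.b r.core a j)) +
      ∑ k, ((m : ℤ) - r.rk k) ^ 2 := by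
  classical
  have hne : ∀ {a}, (∀ k, E.b k ≠ a) →
      localDim E.polyCoeff a = fun j => Module.finrank ℂ (pencilSol E.b r.core a j) :=
    fun ha => funext fun j => r.localDim_of_ne ha j
  have hsucc : ∀ l j, (localDim E.polyCoeff (E.b l) (j + 1) : ℤ) = ((m : ℤ) - r.rk l) +
      Module.finrank ℂ (pencilSol E.b r.core (E.b l) j) := by
    intro l j
    simpa using r.localDim_succ l j
  refine finsum_add_point_masses _ _ E.b _ ?_ fun a => ?_
  · refine ((support_sqSum_localDim_finite hE).union (Set.finite_range E.b)).subset fun a ha => ?_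
    by_contra h
    simp only [Set.mem_union, not_or, Set.mem_range, not_exists] at h
    refine h.1 ?_
    rw [Function.mem_support] at ha ⊢
    rwa [hne h.2]
  · by_cases h : ∃ l, a = E.b l
    · obtain ⟨l, rfl⟩ := h
      rw [Finset.sum_eq_single l, if_pos rfl]
      -- The two sequences differ only at the finitely many poles, and there by the prepended
      -- increment `m - rₗ`.
      · refine sqSum_shift ?_ (finrank_pencilSol_zero _ _ _) (localDim_zero _ _) (hsucc l)
        obtain ⟨s, hs⟩ := localDim_stable hE (E.b l)
        refine ⟨s, fun j hj => ?_⟩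
        have h1 := hsucc l j
        have h2 := hsucc l s
        rw [hs (j + 1) (by omega), ← hs (s + 1) (by omega)] at h1
        omega
      · exact fun k _ hk => if_neg fun h' => hk (E.b_injective h').symm
      · simp
    · push Not at h
      rw [Finset.sum_eq_zero fun k _ => if_neg (h k), add_zero, hne fun k => (h k).symm]

end QEquation

/-! ### Factorization of the middle convolution through the images of the residues -/

theorem exists_rank_factorization {V : Type*} [AddCommGroup V] [Module ℂ V] [FiniteDimensional ℂ V]
    (f : Module.End ℂ V) : ∃ (r : ℕ) (col : (Fin r → ℂ) →ₗ[ℂ] V) (row : V →ₗ[ℂ] (Fin r → ℂ)),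
      col ∘ₗ row = f ∧ Function.Injective col ∧ Function.Surjective row := by
  let e := (Module.finBasis ℂ (LinearMap.range f)).equivFun
  refine ⟨Module.finrank ℂ (LinearMap.range f), (LinearMap.range f).subtype ∘ₗ (e.symm : _ →ₗ[ℂ] _), (e : _ →ₗ[ℂ] _) ∘ₗ f.rangeRestrict,
    ?_, ?_, ?_⟩
  · ext v
    simp
  · exact (Submodule.injective_subtype _).comp e.symm.injective
  · exact e.surjective.comp f.surjective_rangeRestrict

namespace QEquation

variable {N : ℕ} {ι : Type} [Fintype ι] [DecidableEq ι] (E : QEquation N ι)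

section Components

/-- The component of index `k` of a vector of `𝒱^{N+1}`. -/
def comp (k : Fin (N + 1)) : (Fin (N + 1) × ι → ℂ) →ₗ[ℂ] (ι → ℂ) :=
  LinearMap.funLeft ℂ ℂ (Prod.mk k)

/-- The vector of `𝒱^{N+1}` whose only nonzero component is that of index `k`. -/
def emb (k : Fin (N + 1)) : (ι → ℂ) →ₗ[ℂ] (Fin (N + 1) × ι → ℂ) :=
  LinearMap.pi fun p => if p.1 = k then LinearMap.proj p.2 else 0

/-- The map `v ↦ ∑ Bₖ vₖ`. -/
noncomputable def total : (Fin (N + 1) × ι → ℂ) →ₗ[ℂ] (ι → ℂ) :=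
  ∑ k, Matrix.toLin' (E.Bfull k) ∘ₗ comp k

omit [Fintype ι] [DecidableEq ι] in
theorem ext_comp {v w : Fin (N + 1) × ι → ℂ} (h : ∀ k, comp k v = comp k w) : v = w :=
  funext fun p => congrFun (h p.1) p.2

omit [Fintype ι] [DecidableEq ι] in
theorem comp_emb_self (k : Fin (N + 1)) (w : ι → ℂ) : comp k (emb k w) = w := by
  ext i
  simp [comp, emb, LinearMap.funLeft_apply]

omit [Fintype ι] [DecidableEq ι] in
theorem comp_emb_ne {k l : Fin (N + 1)} (h : k ≠ l) (w : ι → ℂ) : comp k (emb l w) = 0 := by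
  ext i
  simp [comp, emb, LinearMap.funLeft_apply, h]

omit [Fintype ι] [DecidableEq ι] in
theorem comp_sum_emb (w : Fin (N + 1) → ι → ℂ) (k : Fin (N + 1)) :
    comp k (∑ l, emb l (w l)) = w k := by
  rw [map_sum, Finset.sum_eq_single k, comp_emb_self]
  · exact fun l _ hl => comp_emb_ne hl.symm _
  · simp

theorem total_apply (v : Fin (N + 1) × ι → ℂ) : E.total v = ∑ k, (E.Bfull k).mulVec (comp k v) := by
  simp [total]

theorem total_emb (k : Fin (N + 1)) (w : ι → ℂ) : E.total (emb k w) = (E.Bfull k).mulVec w := by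
  rw [total_apply, Finset.sum_eq_single k, comp_emb_self]
  · intro l _ hl
    rw [comp_emb_ne hl, Matrix.mulVec_zero]
  · simp

theorem comp_Fhat (k : Fin (N + 1)) (v : Fin (N + 1) × ι → ℂ) :
    comp k (E.Fhat.mulVec v) = E.total v := by
  ext i
  rw [total_apply, Finset.sum_apply]
  exact E.Fhat_mulVec v (k, i)

theorem mem_L_iff_comp (q lam : ℂ) (v : Fin (N + 1) × ι → ℂ) :
    v ∈ E.L q lam ↔ ∀ k, E.total v = (1 - q ^ lam) • comp k v := by
  rw [mem_L_iff]
  constructor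
  · intro h k
    rw [← E.comp_Fhat k v, h, map_smul]
  · exact fun h => ext_comp fun k => by rw [comp_Fhat, h k, map_smul]

omit [Fintype ι] in
theorem sum_Bfull : ∑ k, E.Bfull k = 1 - E.Binf := by
  rw [Fin.sum_univ_succ]
  simp only [Bfull, Fin.cons_zero, Fin.cons_succ, Bzero]
  abel

theorem conv_B_mulVec_eq (q lam : ℂ) (k : Fin N) (v : Fin (N + 1) × ι → ℂ) :
    ((E.conv q lam).B k).mulVec v = emb k.succ (E.total v - (1 - q ^ lam) • comp k.succ v) := by
  refine ext_comp fun l => ?_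
  ext i
  change ((E.conv q lam).B k).mulVec v (l, i) = _
  rw [conv_B_mulVec]
  split_ifs with h
  · have h' : l = k.succ := h
    subst h'
    rw [comp_emb_self, ← E.comp_Fhat k.succ v]
    rfl
  · rw [comp_emb_ne h]
    rfl

theorem StarKer.eq_zero {E : QEquation N ι} (h : E.StarKer) (k : Fin (N + 1)) (τ : ℂ) {w : ι → ℂ}
    (h1 : ∀ l, l ≠ k → (E.Bfull l).mulVec w = 0) (h2 : (E.Bfull k).mulVec w + τ • w = 0) : w = 0 := by
  rw [← Submodule.mem_bot ℂ, ← h k τ, Submodule.mem_inf]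
  refine ⟨?_, ?_⟩
  · simp only [Submodule.mem_iInf]
    exact fun l hl => h1 l (Finset.ne_of_mem_erase hl)
  · rw [LinearMap.mem_ker, Matrix.toLin'_apply, Matrix.add_mulVec, Matrix.smul_mulVec,
      Matrix.one_mulVec, h2]

theorem StarKer.eq_zero_of_forall {E : QEquation N ι} (h : E.StarKer) {w : ι → ℂ}
    (h1 : ∀ l, (E.Bfull l).mulVec w = 0) : w = 0 :=
  h.eq_zero 0 0 (fun l _ => h1 l) (by rw [h1, zero_smul, add_zero])

theorem StarIm.eq_top {E : QEquation N ι} (h : E.StarIm) (k : Fin (N + 1)) (τ : ℂ)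
    {S : Submodule ℂ (ι → ℂ)} (h1 : ∀ l, l ≠ k → ∀ w, (E.Bfull l).mulVec w ∈ S)
    (h2 : ∀ w, (E.Bfull k).mulVec w + τ • w ∈ S) : S = ⊤ := by
  rw [eq_top_iff, ← h k τ]
  refine sup_le (iSup₂_le fun l hl => ?_) ?_
  · rintro _ ⟨w, rfl⟩
    exact h1 l (Finset.ne_of_mem_erase hl) w
  · rintro _ ⟨w, rfl⟩
    rw [Matrix.toLin'_apply, Matrix.add_mulVec, Matrix.smul_mulVec, Matrix.one_mulVec]
    exact h2 w

end Components

/-- Rank factorizations of `B₀, B₁, …, B_N`. -/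
structure ResidueFactorization where
  rk : Fin (N + 1) → ℕ
  col : ∀ k, (Fin (rk k) → ℂ) →ₗ[ℂ] (ι → ℂ)
  row : ∀ k, (ι → ℂ) →ₗ[ℂ] (Fin (rk k) → ℂ)
  rowInv : ∀ k, (Fin (rk k) → ℂ) →ₗ[ℂ] (ι → ℂ)
  col_row : ∀ k w, col k (row k w) = (E.Bfull k).mulVec w
  col_injective : ∀ k, Function.Injective (col k)
  row_rowInv : ∀ k y, row k (rowInv k y) = y

theorem exists_residueFactorization : Nonempty E.ResidueFactorization := by
  choose rk col row h1 h2 h3 using fun k => exists_rank_factorization (Matrix.toLin' (E.Bfull k))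
  choose inv hinv using fun k => (row k).exists_rightInverse_of_surjective
    (LinearMap.range_eq_top.2 (h3 k))
  exact ⟨⟨rk, col, row, inv, fun k w => LinearMap.congr_fun (h1 k) w, h2,
    fun k y => LinearMap.congr_fun (hinv k) y⟩⟩

namespace ResidueFactorization

variable {E} (r : E.ResidueFactorization) (q lam : ℂ)

theorem row_surjective (k : Fin (N + 1)) : Function.Surjective (r.row k) :=
  fun y => ⟨_, r.row_rowInv k y⟩

/-- The inclusion of `im Bₖ` in `mc_λ(𝒱)`. -/
noncomputable def mcCol (k : Fin (N + 1)) : (Fin (r.rk k) → ℂ) →ₗ[ℂ] E.McSpace q lam :=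
  (E.K ⊔ E.L q lam).mkQ ∘ₗ emb k ∘ₗ r.rowInv k

/-- The projection of `mc_λ(𝒱)` on `im Bₖ`, given by `v ↦ Bₖ (∑ Bₗ vₗ - (1 - q^λ) vₖ)`. -/
noncomputable def mcRow (k : Fin (N + 1)) : E.McSpace q lam →ₗ[ℂ] (Fin (r.rk k) → ℂ) :=
  (E.K ⊔ E.L q lam).liftQ (r.row k ∘ₗ (E.total - (1 - q ^ lam) • comp k)) <| by
    refine sup_le (fun v hv => ?_) fun v hv => ?_
    · rw [LinearMap.mem_ker]
      refine r.col_injective k ?_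
      have h : E.total v = 0 := by
        rw [total_apply]
        exact Finset.sum_eq_zero fun l _ => hv l
      rw [map_zero, LinearMap.comp_apply, r.col_row, LinearMap.sub_apply, h, LinearMap.smul_apply,
        zero_sub, Matrix.mulVec_neg, Matrix.mulVec_smul]
      have : (E.Bfull k).mulVec (comp k v) = 0 := hv k
      rw [this, smul_zero, neg_zero]
    · rw [LinearMap.mem_ker, LinearMap.comp_apply, LinearMap.sub_apply,
        (E.mem_L_iff_comp q lam v).1 hv k, LinearMap.smul_apply, sub_self, map_zero]

theorem mcRow_mk (k : Fin (N + 1)) (v : Fin (N + 1) × ι → ℂ) :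
    r.mcRow q lam k ((E.K ⊔ E.L q lam).mkQ v) = r.row k (E.total v - (1 - q ^ lam) • comp k v) :=
  rfl

/-- The vectors `rowInv (row w)` and `w` differ by an element of `ker Bₖ`, which dies in the
quotient by `𝒦`; the choice of `rowInv` is immaterial. -/
theorem mcCol_row (k : Fin (N + 1)) (w : ι → ℂ) :
    r.mcCol q lam k (r.row k w) = (E.K ⊔ E.L q lam).mkQ (emb k w) := by
  rw [mcCol, LinearMap.comp_apply, LinearMap.comp_apply, ← sub_eq_zero, ← map_sub, ← map_sub,
    Submodule.mkQ_apply, Submodule.Quotient.mk_eq_zero]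
  refine Submodule.mem_sup_left fun l => ?_
  change (E.Bfull l).mulVec (comp l (emb k _)) = 0
  by_cases h : l = k
  · subst h
    rw [comp_emb_self, ← r.col_row, map_sub, r.row_rowInv, sub_self, map_zero]
  · rw [comp_emb_ne h, Matrix.mulVec_zero]

/-- Together with `mcRow_mcCol_ne`, this says that the products of rows by columns are the original
ones minus `1 - q^λ` on the diagonal. All the comparisons below rest on it. -/
theorem mcRow_mcCol_self (k : Fin (N + 1)) (y : Fin (r.rk k) → ℂ) :
    r.mcRow q lam k (r.mcCol q lam k y) = r.row k (r.col k y) - (1 - q ^ lam) • y := by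
  obtain ⟨w, rfl⟩ := r.row_surjective k y
  rw [mcCol_row, mcRow_mk, total_emb, comp_emb_self, r.col_row, map_sub, map_smul]

theorem mcRow_mcCol_ne {k l : Fin (N + 1)} (h : k ≠ l) (y : Fin (r.rk l) → ℂ) :
    r.mcRow q lam k (r.mcCol q lam l y) = r.row k (r.col l y) := by
  obtain ⟨w, rfl⟩ := r.row_surjective l y
  rw [mcCol_row, mcRow_mk, total_emb, comp_emb_ne h, r.col_row, smul_zero, sub_zero]

theorem mcCol_mcRow_mk (k : Fin (N + 1)) (v : Fin (N + 1) × ι → ℂ) :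
    r.mcCol q lam k (r.mcRow q lam k ((E.K ⊔ E.L q lam).mkQ v)) =
      (E.K ⊔ E.L q lam).mkQ (emb k (E.total v - (1 - q ^ lam) • comp k v)) := by
  rw [mcRow_mk, mcCol_row]

theorem mapQ_B (k : Fin N) (w : E.McSpace q lam) :
    Submodule.mapQ _ _ (Matrix.toLin' ((E.conv q lam).B k)) (E.invariant_B q lam k) w =
      r.mcCol q lam k.succ (r.mcRow q lam k.succ w) := by
  obtain ⟨v, rfl⟩ := Submodule.mkQ_surjective _ w
  rw [mcCol_mcRow_mk, ← conv_B_mulVec_eq]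
  rfl

/-- Write `1 - F̂ = q^λ - (F̂ - (1 - q^λ))`; the bracket is the sum over all `k`, including 0, of
its block rows, each of which is `mcColₖ mcRowₖ` in the quotient. -/
theorem mapQ_Binf (w : E.McSpace q lam) :
    Submodule.mapQ _ _ (Matrix.toLin' (E.conv q lam).Binf) (E.invariant_Binf q lam) w =
      q ^ lam • w - ∑ k, r.mcCol q lam k (r.mcRow q lam k w) := by
  obtain ⟨v, rfl⟩ := Submodule.mkQ_surjective _ w
  have h1 : (E.conv q lam).Binf.mulVec v = v - E.Fhat.mulVec v := by
    change (1 - E.Fhat).mulVec v = _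
    rw [Matrix.sub_mulVec, Matrix.one_mulVec]
  have h2 : ∑ k, emb k (E.total v - (1 - q ^ lam) • comp k v) = E.Fhat.mulVec v - (1 - q ^ lam) • v :=
    ext_comp fun k => by rw [comp_sum_emb, map_sub, comp_Fhat, map_smul]
  simp only [mcCol_mcRow_mk]
  rw [← map_sum, h2, ← map_smul, ← map_sub]
  change (E.K ⊔ E.L q lam).mkQ ((E.conv q lam).Binf.mulVec v) = _
  rw [h1]
  congr 1
  rw [sub_smul, one_smul]
  abel

variable (h₁ : E.StarKer) (h₂ : E.StarIm)
-- If `y` is sent to 0, the products of rows by columns show that `colₖ y` is killed by `Bₗ` for `l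
-- ≠ k` and by `Bₖ - (1 - q^λ)`. Condition (∗) with `τ = -(1 - q^λ)` applies.
include h₁ in
theorem mcCol_injective (k : Fin (N + 1)) : Function.Injective (r.mcCol q lam k) := by
  rw [← LinearMap.ker_eq_bot, LinearMap.ker_eq_bot']
  intro y hy
  have hk := r.mcRow_mcCol_self q lam k y
  rw [hy, map_zero] at hk
  have : r.col k y = 0 := by
    refine h₁.eq_zero k (-(1 - q ^ lam)) (fun l hl => ?_) ?_
    · have := r.mcRow_mcCol_ne q lam hl y
      rw [hy, map_zero] at this
      rw [← r.col_row, ← this, map_zero]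
    · rw [← r.col_row, ← sub_eq_zero.1 hk.symm |>.symm, map_smul, neg_smul, add_neg_cancel]
  exact r.col_injective k (by rw [this, map_zero])

-- Dually, the preimage of the range under `rowₖ` contains the images of `Bₗ`, `l ≠ k`, and of `Bₖ -
-- (1 - q^λ)`, hence everything by (∗∗).
include h₂ in
theorem mcRow_surjective (k : Fin (N + 1)) : Function.Surjective (r.mcRow q lam k) := by
  have : (LinearMap.range (r.mcRow q lam k)).comap (r.row k) = ⊤ := by
    refine h₂.eq_top k (-(1 - q ^ lam)) (fun l hl w => ?_) fun w => ?_
    · exact ⟨r.mcCol q lam l (r.row l w), by rw [r.mcRow_mcCol_ne q lam hl.symm, r.col_row]⟩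
    · refine ⟨r.mcCol q lam k (r.row k w), ?_⟩
      rw [r.mcRow_mcCol_self, r.col_row, map_add, map_smul, neg_smul, sub_eq_add_neg]
  intro y
  obtain ⟨w, rfl⟩ := r.row_surjective k y
  exact (eq_top_iff.1 this (Submodule.mem_top (x := w)))

/-- The space `⨁ im Bₖ`. -/
abbrev Sum : Type := ∀ k, Fin (r.rk k) → ℂ

/-- The map `⨁ im Bₖ → 𝒱`. -/
noncomputable def sumCol : r.Sum →ₗ[ℂ] (ι → ℂ) := ∑ k, r.col k ∘ₗ LinearMap.proj k

/-- The map `𝒱 → ⨁ im Bₖ`. -/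
noncomputable def sumRow : (ι → ℂ) →ₗ[ℂ] r.Sum := LinearMap.pi r.row

/-- The projection `⨁ im Bₖ → mc_λ(𝒱)`. -/
noncomputable def sumMcCol : r.Sum →ₗ[ℂ] E.McSpace q lam := ∑ k, r.mcCol q lam k ∘ₗ LinearMap.proj k

/-- The map `mc_λ(𝒱) → ⨁ im Bₖ`. -/
noncomputable def sumMcRow : E.McSpace q lam →ₗ[ℂ] r.Sum := LinearMap.pi (r.mcRow q lam)

theorem sumCol_apply (u : r.Sum) : r.sumCol u = ∑ k, r.col k (u k) := by
  simp [sumCol]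

theorem sumMcCol_apply (u : r.Sum) : r.sumMcCol q lam u = ∑ k, r.mcCol q lam k (u k) := by
  simp [sumMcCol]

include h₁ in
theorem sumRow_injective : Function.Injective r.sumRow := by
  rw [← LinearMap.ker_eq_bot, LinearMap.ker_eq_bot']
  intro w hw
  refine h₁.eq_zero_of_forall fun k => ?_
  have : r.row k w = 0 := congrFun hw k
  rw [← r.col_row, this, map_zero]

include h₂ in
theorem sumCol_surjective : Function.Surjective r.sumCol := by
  have hmem : ∀ k w, (E.Bfull k).mulVec w ∈ LinearMap.range r.sumCol := by
    intro k w
    refine ⟨Pi.single k (r.row k w), ?_⟩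
    rw [sumCol_apply, Finset.sum_eq_single k, Pi.single_eq_same, r.col_row]
    · intro l _ hl
      rw [Pi.single_eq_of_ne hl, map_zero]
    · simp
  refine LinearMap.range_eq_top.1 (h₂.eq_top 0 0 (fun l _ => hmem l) fun w => ?_)
  rw [zero_smul, add_zero]
  exact hmem 0 w

theorem sumMcCol_surjective : Function.Surjective (r.sumMcCol q lam) := by
  intro w
  obtain ⟨v, rfl⟩ := Submodule.mkQ_surjective _ w
  refine ⟨fun k => r.row k (comp k v), ?_⟩
  rw [sumMcCol_apply]
  simp only [mcCol_row]
  rw [← map_sum]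
  congr 1
  exact ext_comp fun k => comp_sum_emb _ _

-- Put `μ = 1 - q^λ`. A representative `v` killed by all rows satisfies `Bₖ (∑ Bₗ vₗ - μ vₖ) = 0`.
-- If `μ ≠ 0`, the vector with all components `μ⁻¹ ∑ Bₗ vₗ` lies in `ℒ` and differs from `v` by an
-- element of `𝒦`. If `μ = 0`, (∗) forces `∑ Bₗ vₗ = 0`, so `v` is in `ℒ`.
include h₁ in
theorem sumMcRow_injective : Function.Injective (r.sumMcRow q lam) := by
  rw [← LinearMap.ker_eq_bot, LinearMap.ker_eq_bot']
  intro w hw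
  obtain ⟨v, rfl⟩ := Submodule.mkQ_surjective _ w
  have hB : ∀ k, (E.Bfull k).mulVec (E.total v - (1 - q ^ lam) • comp k v) = 0 := by
    intro k
    have : r.mcRow q lam k ((E.K ⊔ E.L q lam).mkQ v) = 0 := congrFun hw k
    rw [mcRow_mk] at this
    rw [← r.col_row, this, map_zero]
  rw [Submodule.mkQ_apply, Submodule.Quotient.mk_eq_zero]
  by_cases hμ : 1 - q ^ lam = 0
  · simp only [hμ, zero_smul, sub_zero] at hB
    refine Submodule.mem_sup_right ((E.mem_L_iff_comp q lam v).2 fun k => ?_)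
    rw [h₁.eq_zero_of_forall hB, hμ, zero_smul]
  · let d : Fin (N + 1) × ι → ℂ := ∑ k, emb k ((1 - q ^ lam)⁻¹ • E.total v)
    have hd : ∀ k, comp k d = (1 - q ^ lam)⁻¹ • E.total v := fun k => comp_sum_emb _ _
    have h3 : v - d ∈ E.K := by
      intro k
      change (E.Bfull k).mulVec (comp k (v - d)) = 0
      have : comp k (v - d) = -((1 - q ^ lam)⁻¹ • (E.total v - (1 - q ^ lam) • comp k v)) := by
        rw [map_sub, hd, smul_sub, smul_smul, inv_mul_cancel₀ hμ, one_smul, neg_sub]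
      rw [this, Matrix.mulVec_neg, Matrix.mulVec_smul, hB, smul_zero, neg_zero]
    have h4 : E.total d = E.total v := by
      have : E.total (v - d) = 0 := by
        rw [total_apply]
        exact Finset.sum_eq_zero fun l _ => h3 l
      rw [map_sub, sub_eq_zero] at this
      exact this.symm
    have h5 : d ∈ E.L q lam := (E.mem_L_iff_comp q lam d).2 fun k => by
      rw [hd, h4, smul_smul, mul_inv_cancel₀ hμ, one_smul]
    rw [← sub_add_cancel v d]
    exact Submodule.add_mem_sup h3 h5

include h₁ h₂ in
/-- The change of the contribution of the point at infinity. -/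
theorem spectralIndex_mapQ_Binf :
    spectralIndex (Submodule.mapQ _ _ (Matrix.toLin' (E.conv q lam).Binf) (E.invariant_Binf q lam)) +
      (∑ k, (r.rk k : ℤ) - Module.finrank ℂ (E.McSpace q lam)) ^ 2 =
    spectralIndex (Matrix.toLin' E.Binf) + (∑ k, (r.rk k : ℤ) - Fintype.card ι) ^ 2 := by
  have hdim : (Module.finrank ℂ r.Sum : ℤ) = ∑ k, (r.rk k : ℤ) := by
    rw [Module.finrank_pi_fintype]
    simp
  have e1 : r.sumCol ∘ₗ r.sumRow =
      (-1 : ℂ) • Matrix.toLin' E.Binf + algebraMap ℂ (Module.End ℂ (ι → ℂ)) 1 := by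
    refine LinearMap.ext fun w => ?_
    have : (r.sumCol ∘ₗ r.sumRow) w = ∑ k, (E.Bfull k).mulVec w := by
      rw [LinearMap.comp_apply, sumCol_apply]
      exact Finset.sum_congr rfl fun k _ => r.col_row k w
    rw [this, ← Matrix.sum_mulVec, sum_Bfull, Matrix.sub_mulVec, Matrix.one_mulVec]
    simp [sub_eq_neg_add]
  have e2 : r.sumMcRow q lam ∘ₗ r.sumMcCol q lam =
      r.sumRow ∘ₗ r.sumCol + algebraMap ℂ (Module.End ℂ r.Sum) (-(1 - q ^ lam)) := by
    refine LinearMap.ext fun u => funext fun k => ?_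
    have h3 : (r.sumMcRow q lam ∘ₗ r.sumMcCol q lam) u k =
        ∑ l, r.mcRow q lam k (r.mcCol q lam l (u l)) := by
      rw [LinearMap.comp_apply, sumMcCol_apply, ← map_sum]
      rfl
    have h4 : (r.sumRow ∘ₗ r.sumCol) u k = ∑ l, r.row k (r.col l (u l)) := by
      rw [LinearMap.comp_apply, sumCol_apply, ← map_sum]
      rfl
    rw [LinearMap.add_apply, Pi.add_apply, h3, h4, ← Finset.add_sum_erase _ _ (Finset.mem_univ k),
      ← Finset.add_sum_erase _ (fun l => r.row k (r.col l (u l))) (Finset.mem_univ k),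
      mcRow_mcCol_self, Finset.sum_congr rfl fun l hl =>
        r.mcRow_mcCol_ne q lam (Finset.ne_of_mem_erase hl).symm (u l),
      Module.algebraMap_end_apply, Pi.smul_apply, neg_smul]
    abel
  have e3 : r.sumMcCol q lam ∘ₗ r.sumMcRow q lam =
      (-1 : ℂ) • (Submodule.mapQ _ _ (Matrix.toLin' (E.conv q lam).Binf) (E.invariant_Binf q lam)) +
        algebraMap ℂ (Module.End ℂ (E.McSpace q lam)) (q ^ lam) := by
    refine LinearMap.ext fun w => ?_
    rw [LinearMap.add_apply, LinearMap.smul_apply, r.mapQ_Binf, Module.algebraMap_end_apply,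
      LinearMap.comp_apply, sumMcCol_apply, neg_one_smul, neg_sub, sub_add_cancel]
    rfl
  -- Exchanging the factors brings both operators to `⨁ im Bₖ`, where by `e2` they differ by a
  -- scalar; only the squares of the dimension defects distinguish them.
  have k1 := spectralIndex_comp r.sumRow r.sumCol (r.sumRow_injective h₁) (r.sumCol_surjective h₂)
  have k2 := spectralIndex_comp (r.sumMcRow q lam) (r.sumMcCol q lam)
    (r.sumMcRow_injective q lam h₁) (r.sumMcCol_surjective q lam)
  rw [e2, e3, spectralIndex_add_const, spectralIndex_add_const,
    spectralIndex_smul _ (neg_ne_zero.2 one_ne_zero), k1, e1, spectralIndex_add_const,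
    spectralIndex_smul _ (neg_ne_zero.2 one_ne_zero), hdim, Module.finrank_fintype_fun_eq_card] at k2
  exact k2.symm

include h₁ h₂ in
/-- The change of the contribution of the origin. -/
theorem spectralIndex_mcCol_mcRow :
    spectralIndex (r.mcCol q lam 0 ∘ₗ r.mcRow q lam 0) + ((Fintype.card ι : ℤ) - r.rk 0) ^ 2 =
    spectralIndex (Matrix.toLin' E.Bzero) +
      ((Module.finrank ℂ (E.McSpace q lam) : ℤ) - r.rk 0) ^ 2 := by
  have e1 : r.col 0 ∘ₗ r.row 0 = Matrix.toLin' E.Bzero :=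
    LinearMap.ext fun w => r.col_row 0 w
  have e2 : r.mcRow q lam 0 ∘ₗ r.mcCol q lam 0 =
      r.row 0 ∘ₗ r.col 0 + algebraMap ℂ (Module.End ℂ (Fin (r.rk 0) → ℂ)) (-(1 - q ^ lam)) := by
    refine LinearMap.ext fun y => ?_
    rw [LinearMap.add_apply, LinearMap.comp_apply, mcRow_mcCol_self, Module.algebraMap_end_apply,
      neg_smul, sub_eq_add_neg]
    rfl
  -- The same exchange, on `im B₀` alone. Here the injective factor is the column, so the square
  -- enters with the opposite sign.
  have k1 := spectralIndex_comp (r.col 0) (r.row 0) (r.col_injective 0) (r.row_surjective 0)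
  have k2 := spectralIndex_comp (r.mcCol q lam 0) (r.mcRow q lam 0)
    (r.mcCol_injective q lam h₁ 0) (r.mcRow_surjective q lam h₂ 0)
  rw [e1] at k1
  rw [e2, spectralIndex_add_const] at k2
  simp only [Module.finrank_fintype_fun_eq_card, Fintype.card_fin] at k1 k2
  rw [k1, k2]
  ring

end ResidueFactorization

end QEquation

/-! ### The origin of the middle convolution and its inverse -/

namespace QEquation

variable {N : ℕ} {ι : Type} [Fintype ι] [DecidableEq ι] {E : QEquation N ι}

namespace ResidueFactorization

variable (r : E.ResidueFactorization)

/-- The realization of an equation attached to rank factorizations of its residues. -/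
noncomputable def realization (hE : IsUnit (1 - E.Bzero)) : E.Realization where
  H := (1 - E.Bzero)⁻¹
  H_mul := Matrix.nonsing_inv_mul _ ((Matrix.isUnit_iff_isUnit_det _).1 hE)
  mul_H := Matrix.mul_nonsing_inv _ ((Matrix.isUnit_iff_isUnit_det _).1 hE)
  rk k := r.rk k.succ
  col k := LinearMap.toMatrix' (r.col k.succ)
  row k := LinearMap.toMatrix' (r.row k.succ)
  colInv k := LinearMap.toMatrix' ((r.col k.succ).exists_leftInverse_of_injective
    (LinearMap.ker_eq_bot.2 (r.col_injective k.succ))).choose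
  rowInv k := LinearMap.toMatrix' (r.rowInv k.succ)
  col_mul_row k := by
    rw [← LinearMap.toMatrix'_comp]
    have : r.col k.succ ∘ₗ r.row k.succ = Matrix.toLin' (E.B k) :=
      LinearMap.ext fun w => r.col_row k.succ w
    rw [this, LinearMap.toMatrix'_toLin']
  colInv_mul k := by
    rw [← LinearMap.toMatrix'_comp, ((r.col k.succ).exists_leftInverse_of_injective
      (LinearMap.ker_eq_bot.2 (r.col_injective k.succ))).choose_spec, LinearMap.toMatrix'_id]
  mul_rowInv k := by
    rw [← LinearMap.toMatrix'_comp]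
    have : r.row k.succ ∘ₗ r.rowInv k.succ = LinearMap.id :=
      LinearMap.ext fun y => r.row_rowInv k.succ y
    rw [this, LinearMap.toMatrix'_id]

/-- The pencil attached to rank factorizations of the residues. -/
noncomputable def core (hE : IsUnit (1 - E.Bzero)) (k l : Fin N) :
    Matrix (Fin (r.rk k.succ)) (Fin (r.rk l.succ)) ℂ :=
  (r.realization hE).core k l

theorem core_mulVec (hE : IsUnit (1 - E.Bzero)) (k l : Fin N) (y : Fin (r.rk l.succ) → ℂ) :
    (r.core hE k l).mulVec y = r.row k.succ ((1 - E.Bzero)⁻¹.mulVec (r.col l.succ y)) := by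
  change (LinearMap.toMatrix' (r.row k.succ) * ((1 - E.Bzero)⁻¹ *
    LinearMap.toMatrix' (r.col l.succ))).mulVec y = _
  rw [← Matrix.mulVec_mulVec, ← Matrix.mulVec_mulVec, LinearMap.toMatrix'_mulVec,
    LinearMap.toMatrix'_mulVec]

theorem divisorIndex_eq {m : ℕ} {E : QEquation N (Fin m)} (r : E.ResidueFactorization)
    (hE : IsUnit (1 - E.Bzero)) (hdet : E.polyCoeff.det ≠ 0) :
    divisorIndex E.polyCoeff =
      ∑ᶠ a, sqSum (fun j => Module.finrank ℂ (pencilSol E.b (r.core hE) a j)) +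
        ∑ k : Fin N, ((m : ℤ) - r.rk k.succ) ^ 2 :=
  (r.realization hE).divisorIndex_eq hdet

end ResidueFactorization

section OriginLift

variable (E) (q lam : ℂ)

/-- A lift to `𝒱^{N+1}` of the inverse of the value at the origin of the coefficient of the
`q`-middle convolution. -/
noncomputable def originLift (v : Fin (N + 1) × ι → ℂ) : Fin (N + 1) × ι → ℂ :=
  (q ^ lam)⁻¹ • v +
    emb 0 ((1 - E.Bzero)⁻¹.mulVec ((q ^ lam)⁻¹ • (E.total v - (1 - q ^ lam) • comp 0 v)))

theorem comp_succ_originLift (k : Fin N) (v : Fin (N + 1) × ι → ℂ) :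
    comp k.succ (E.originLift q lam v) = (q ^ lam)⁻¹ • comp k.succ v := by
  rw [originLift, map_add, map_smul, comp_emb_ne k.succ_ne_zero, add_zero]

variable {E} {q lam} (hE : IsUnit (1 - E.Bzero)) (hc : q ^ lam ≠ 0)
include hE

theorem sub_Bzero_mulVec_inv (w : ι → ℂ) :
    (1 - E.Bzero)⁻¹.mulVec w - E.Bzero.mulVec ((1 - E.Bzero)⁻¹.mulVec w) = w := by
  have := congrArg (fun M => M.mulVec w)
    (Matrix.mul_nonsing_inv (1 - E.Bzero) ((Matrix.isUnit_iff_isUnit_det _).1 hE))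
  simpa only [← Matrix.mulVec_mulVec, Matrix.sub_mulVec, Matrix.one_mulVec] using this

include hc

/-- Seek a preimage of the form `c⁻¹ v + emb 0 z`, with `c = q^λ`. The equation reduces to `(1 - B₀)
z = c⁻¹ (∑ Bₗ vₗ - (1 - c) v₀)`, solvable since `1 - B₀` is invertible. -/
theorem originLift_eq (v : Fin (N + 1) × ι → ℂ) :
    q ^ lam • E.originLift q lam v - emb 0 (E.total (E.originLift q lam v) -
      (1 - q ^ lam) • comp 0 (E.originLift q lam v)) = v := by
  have h0 := sub_Bzero_mulVec_inv hE ((q ^ lam)⁻¹ • (E.total v - (1 - q ^ lam) • comp 0 v))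
  rw [originLift]
  generalize hz : (1 - E.Bzero)⁻¹.mulVec ((q ^ lam)⁻¹ • (E.total v - (1 - q ^ lam) • comp 0 v)) = z
  rw [hz] at h0
  have hB : E.Bzero.mulVec z = z - (q ^ lam)⁻¹ • (E.total v - (1 - q ^ lam) • comp 0 v) := by
    rw [← h0]
    abel
  have h1 : E.total (emb 0 z) = E.Bzero.mulVec z := E.total_emb 0 z
  have h2 : E.total ((q ^ lam)⁻¹ • v + emb 0 z) -
      (1 - q ^ lam) • comp 0 ((q ^ lam)⁻¹ • v + emb 0 z) = q ^ lam • z := by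
    rw [map_add, map_add, map_smul, map_smul, h1, hB, comp_emb_self]
    module
  rw [h2, smul_add, smul_inv_smul₀ hc, ← map_smul]
  abel

end OriginLift

namespace ResidueFactorization

variable (r : E.ResidueFactorization) {q lam : ℂ}

theorem mcCol_mcRow_originLift (hE : IsUnit (1 - E.Bzero)) (hc : q ^ lam ≠ 0)
    (v : Fin (N + 1) × ι → ℂ) :
    q ^ lam • (E.K ⊔ E.L q lam).mkQ (E.originLift q lam v) -
      r.mcCol q lam 0 (r.mcRow q lam 0 ((E.K ⊔ E.L q lam).mkQ (E.originLift q lam v))) =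
      (E.K ⊔ E.L q lam).mkQ v := by
  rw [mcCol_mcRow_mk, ← map_smul, ← map_sub, originLift_eq hE hc]

/-- Since the lift inverts the value at the origin, this computes the new pencil matrix as `c⁻¹ (Z -
(1 - c))`, where `c = q^λ`: the last term is `(1 - c) y` if `k = l` and 0 otherwise. -/
theorem mcRow_originLift (hE : IsUnit (1 - E.Bzero)) (k l : Fin N)
    (y : Fin (r.rk l.succ) → ℂ) :
    r.mcRow q lam k.succ ((E.K ⊔ E.L q lam).mkQ
      (E.originLift q lam (emb l.succ (r.rowInv l.succ y)))) =
    (q ^ lam)⁻¹ • (r.row k.succ ((1 - E.Bzero)⁻¹.mulVec (r.col l.succ y)) -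
      (1 - q ^ lam) • r.row k.succ (comp k.succ (emb l.succ (r.rowInv l.succ y)))) := by
  have hcol : E.total (emb l.succ (r.rowInv l.succ y)) = r.col l.succ y := by
    rw [total_emb, ← r.col_row, r.row_rowInv]
  have h0 := sub_Bzero_mulVec_inv hE (r.col l.succ y)
  -- The vector has no component of index 0, and with `H = (1 - B₀)⁻¹` the identity `1 + B₀ H = H`
  -- collapses the two contributions.
  have htot : E.total (E.originLift q lam (emb l.succ (r.rowInv l.succ y))) =
      (q ^ lam)⁻¹ • (1 - E.Bzero)⁻¹.mulVec (r.col l.succ y) := by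
    rw [originLift, map_add, map_smul, hcol, comp_emb_ne l.succ_ne_zero.symm, smul_zero, sub_zero,
      total_emb, Matrix.mulVec_smul, Matrix.mulVec_smul, ← smul_add]
    congr 1
    change _ + E.Bzero.mulVec _ = _
    nth_rewrite 1 [← h0]
    abel
  rw [mcRow_mk, htot, comp_succ_originLift, map_sub, map_smul, map_smul, map_smul, smul_sub,
    smul_comm (1 - q ^ lam)]

end ResidueFactorization

/-! ### Comparison of the three contributions -/

section MiddleConv

variable (r : E.ResidueFactorization) {q lam : ℂ} {κ : Type} [Fintype κ] [DecidableEq κ]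
  (v : Module.Basis κ ℂ (E.McSpace q lam))

theorem middleConv_Binf_mulVec (w : E.McSpace q lam) :
    (E.middleConv q lam v).Binf.mulVec (v.equivFun w) = v.equivFun
      (Submodule.mapQ _ _ (Matrix.toLin' (E.conv q lam).Binf) (E.invariant_Binf q lam) w) :=
  LinearMap.toMatrix_mulVec_repr v v _ w

theorem middleConv_B_mulVec (k : Fin N) (w : E.McSpace q lam) :
    ((E.middleConv q lam v).B k).mulVec (v.equivFun w) =
      v.equivFun (r.mcCol q lam k.succ (r.mcRow q lam k.succ w)) := by
  rw [← r.mapQ_B]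
  exact LinearMap.toMatrix_mulVec_repr v v _ w

/-- Here `1 - B₀ = B_∞ + ∑ Bₖ`, and in `B_∞ = q^λ - ∑ mcColₖ mcRowₖ` every term except that of index
0 cancels. -/
theorem middleConv_origin_mulVec (w : E.McSpace q lam) :
    (1 - (E.middleConv q lam v).Bzero).mulVec (v.equivFun w) =
      v.equivFun (q ^ lam • w - r.mcCol q lam 0 (r.mcRow q lam 0 w)) := by
  have hB : 1 - (E.middleConv q lam v).Bzero =
      (E.middleConv q lam v).Binf + ∑ k, (E.middleConv q lam v).B k := by
    rw [Bzero]
    abel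
  rw [hB, Matrix.add_mulVec, Matrix.sum_mulVec, middleConv_Binf_mulVec, r.mapQ_Binf]
  simp only [middleConv_B_mulVec r]
  rw [← map_sum, ← map_add, Fin.sum_univ_succ]
  congr 1
  abel

theorem isUnit_middleConv_origin (hE : IsUnit (1 - E.Bzero)) (hc : q ^ lam ≠ 0) :
    IsUnit (1 - (E.middleConv q lam v).Bzero) := by
  obtain ⟨r⟩ := E.exists_residueFactorization
  refine Matrix.mulVec_surjective_iff_isUnit.1 fun u => ?_
  obtain ⟨w, rfl⟩ := v.equivFun.surjective u
  obtain ⟨w, rfl⟩ := Submodule.mkQ_surjective _ w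
  exact ⟨_, (middleConv_origin_mulVec r v _).trans
    (congrArg v.equivFun (r.mcCol_mcRow_originLift hE hc w))⟩

theorem isUnit_middleConv_Binf (hE : IsUnit E.Binf) : IsUnit (E.middleConv q lam v).Binf := by
  refine Matrix.mulVec_surjective_iff_isUnit.1 fun u => ?_
  obtain ⟨w, rfl⟩ := v.equivFun.surjective u
  obtain ⟨w, rfl⟩ := Submodule.mkQ_surjective _ w
  -- Adding the vector with all components `h` to `w` changes `∑ Bₗ wₗ` by `h - B_∞ h`, so `1 - F̂`
  -- sends the sum to `w` as soon as `B_∞ h = ∑ Bₗ wₗ`.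
  obtain ⟨h, hh⟩ := Matrix.mulVec_surjective_iff_isUnit.2 hE (E.total w)
  refine ⟨_, (middleConv_Binf_mulVec v ((E.K ⊔ E.L q lam).mkQ (w + ∑ k, emb k h))).trans
    (congrArg v.equivFun ?_)⟩
  change (E.K ⊔ E.L q lam).mkQ ((1 - E.Fhat).mulVec (w + ∑ k, emb k h)) = _
  congr 1
  refine ext_comp fun k => ?_
  have h1 : E.total (∑ k, emb k h) = h - E.Binf.mulVec h := by
    rw [total_apply]
    simp only [comp_sum_emb]
    rw [← Matrix.sum_mulVec, sum_Bfull, Matrix.sub_mulVec, Matrix.one_mulVec]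
  rw [Matrix.sub_mulVec, Matrix.one_mulVec, map_sub, comp_Fhat, map_add, map_add, comp_sum_emb, h1,
    hh]
  abel

theorem spectralIndex_middleConv_origin :
    spectralIndex (Matrix.toLin' (1 - (E.middleConv q lam v).Bzero)) =
      spectralIndex (r.mcCol q lam 0 ∘ₗ r.mcRow q lam 0) := by
  rw [← spectralIndex_conj v.equivFun
    ((-1 : ℂ) • (r.mcCol q lam 0 ∘ₗ r.mcRow q lam 0) + algebraMap ℂ _ (q ^ lam)) _ fun w => ?_,
    spectralIndex_add_const, spectralIndex_smul _ (neg_ne_zero.2 one_ne_zero)]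
  rw [Matrix.toLin'_apply, middleConv_origin_mulVec r, LinearMap.add_apply, LinearMap.smul_apply,
    Module.algebraMap_end_apply, neg_one_smul, neg_add_eq_sub]
  rfl

theorem spectralIndex_middleConv_Binf :
    spectralIndex (Matrix.toLin' (E.middleConv q lam v).Binf) = spectralIndex
      (Submodule.mapQ _ _ (Matrix.toLin' (E.conv q lam).Binf) (E.invariant_Binf q lam)) :=
  (spectralIndex_conj v.equivFun _ _ fun w => (middleConv_Binf_mulVec v w).symm).symm

/-- Rank factorizations of the residues of the `q`-middle convolution. -/
noncomputable def mcRealization (h₁ : E.StarKer) (h₂ : E.StarIm) (hE : IsUnit (1 - E.Bzero))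
    (hc : q ^ lam ≠ 0) : ((E.middleConv q lam v).rescale hc).Realization where
  H := (1 - (E.middleConv q lam v).Bzero)⁻¹
  H_mul := Matrix.nonsing_inv_mul _
    ((Matrix.isUnit_iff_isUnit_det _).1 (isUnit_middleConv_origin v hE hc))
  mul_H := Matrix.mul_nonsing_inv _
    ((Matrix.isUnit_iff_isUnit_det _).1 (isUnit_middleConv_origin v hE hc))
  rk k := r.rk k.succ
  col k := LinearMap.toMatrix' (v.equivFun.toLinearMap ∘ₗ r.mcCol q lam k.succ)
  row k := LinearMap.toMatrix' (r.mcRow q lam k.succ ∘ₗ v.equivFun.symm.toLinearMap)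
  colInv k := LinearMap.toMatrix' (((r.mcCol q lam k.succ).exists_leftInverse_of_injective
    (LinearMap.ker_eq_bot.2 (r.mcCol_injective q lam h₁ k.succ))).choose ∘ₗ
      v.equivFun.symm.toLinearMap)
  rowInv k := LinearMap.toMatrix' (v.equivFun.toLinearMap ∘ₗ
    ((r.mcRow q lam k.succ).exists_rightInverse_of_surjective
      (LinearMap.range_eq_top.2 (r.mcRow_surjective q lam h₂ k.succ))).choose)
  col_mul_row k := by
    rw [← LinearMap.toMatrix'_comp]
    change _ = (E.middleConv q lam v).B k
    rw [← LinearMap.toMatrix'_toLin' ((E.middleConv q lam v).B k)]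
    congr 1
    refine LinearMap.ext fun u => ?_
    obtain ⟨w, rfl⟩ := v.equivFun.surjective u
    refine Eq.trans ?_ (middleConv_B_mulVec r v k w).symm
    simp
  colInv_mul k := by
    rw [← LinearMap.toMatrix'_comp, ← LinearMap.toMatrix'_id]
    congr 1
    refine LinearMap.ext fun y => ?_
    have := LinearMap.congr_fun ((r.mcCol q lam k.succ).exists_leftInverse_of_injective
      (LinearMap.ker_eq_bot.2 (r.mcCol_injective q lam h₁ k.succ))).choose_spec y
    simpa using this
  mul_rowInv k := by
    rw [← LinearMap.toMatrix'_comp, ← LinearMap.toMatrix'_id]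
    congr 1
    refine LinearMap.ext fun y => ?_
    have := LinearMap.congr_fun ((r.mcRow q lam k.succ).exists_rightInverse_of_surjective
      (LinearMap.range_eq_top.2 (r.mcRow_surjective q lam h₂ k.succ))).choose_spec y
    simpa using this

variable (h₁ : E.StarKer) (h₂ : E.StarIm) (hE : IsUnit (1 - E.Bzero)) (hc : q ^ lam ≠ 0)

/-- The pencil attached to rank factorizations of the residues of the `q`-middle convolution. -/
noncomputable def mcCore (k l : Fin N) : Matrix (Fin (r.rk k.succ)) (Fin (r.rk l.succ)) ℂ :=
  (mcRealization r v h₁ h₂ hE hc).core k l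

theorem mcCore_mulVec (k l : Fin N) (y : Fin (r.rk l.succ) → ℂ) :
    (mcCore r v h₁ h₂ hE hc k l).mulVec y =
      (q ^ lam)⁻¹ • (r.row k.succ ((1 - E.Bzero)⁻¹.mulVec (r.col l.succ y)) -
        (1 - q ^ lam) • r.row k.succ (comp k.succ (emb l.succ (r.rowInv l.succ y)))) := by
  change Matrix.mulVec (LinearMap.toMatrix' (r.mcRow q lam k.succ ∘ₗ v.equivFun.symm.toLinearMap) *
    (((1 - (E.middleConv q lam v).Bzero)⁻¹ : Matrix κ κ ℂ) *
      LinearMap.toMatrix' (v.equivFun.toLinearMap ∘ₗ r.mcCol q lam l.succ) :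
      Matrix κ (Fin (r.rk l.succ)) ℂ)) y = _
  rw [← r.mcRow_originLift hE, ← Matrix.mulVec_mulVec, ← Matrix.mulVec_mulVec,
    LinearMap.toMatrix'_mulVec, LinearMap.toMatrix'_mulVec]
  have h := (middleConv_origin_mulVec r v _).trans (congrArg v.equivFun
    (r.mcCol_mcRow_originLift hE hc (emb l.succ (r.rowInv l.succ y))))
  have hinv := Matrix.nonsing_inv_mul _
    ((Matrix.isUnit_iff_isUnit_det _).1 (isUnit_middleConv_origin v hE hc))
  have h' := congrArg (1 - (E.middleConv q lam v).Bzero)⁻¹.mulVec h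
  rw [Matrix.mulVec_mulVec, hinv, Matrix.one_mulVec] at h'
  refine (congrArg (r.mcRow q lam k.succ ∘ₗ v.equivFun.symm.toLinearMap) h'.symm).trans ?_
  simp

/-- The new matrix is `c⁻¹ (Z - (1 - c))` and the poles are divided by `c = q^λ`, which is the
situation of `pencilSol_rescale`. -/
theorem pencilSol_mcCore (a : ℂ) (j : ℕ) :
    pencilSol (fun k => (q ^ lam)⁻¹ * E.b k) (mcCore r v h₁ h₂ hE hc) a j =
      pencilSol E.b (r.core hE) a j := by
  refine pencilSol_rescale E.b hc (fun k l hkl => ?_) (fun k => ?_) a j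
  · refine Matrix.toLin'.injective (LinearMap.ext fun y => ?_)
    rw [Matrix.toLin'_apply, Matrix.toLin'_apply, mcCore_mulVec, Matrix.smul_mulVec,
      comp_emb_ne fun h => hkl (Fin.succ_injective _ h), map_zero, smul_zero, sub_zero,
      r.core_mulVec]
  · refine Matrix.toLin'.injective (LinearMap.ext fun y => ?_)
    rw [Matrix.toLin'_apply, Matrix.toLin'_apply, mcCore_mulVec, Matrix.smul_mulVec,
      Matrix.sub_mulVec, Matrix.smul_mulVec, Matrix.one_mulVec, comp_emb_self, r.row_rowInv,
      r.core_mulVec]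

theorem divisorIndex_rescale_middleConv {m' : ℕ} (v : Module.Basis (Fin m') ℂ (E.McSpace q lam))
    (hdet : ((E.middleConv q lam v).rescale hc).polyCoeff.det ≠ 0) :
    divisorIndex ((E.middleConv q lam v).rescale hc).polyCoeff =
      ∑ᶠ a, sqSum (fun j => Module.finrank ℂ
        (pencilSol (fun k => (q ^ lam)⁻¹ * E.b k) (mcCore r v h₁ h₂ hE hc) a j)) +
        ∑ k : Fin N, ((m' : ℤ) - r.rk k.succ) ^ 2 :=
  (mcRealization r v h₁ h₂ hE hc).divisorIndex_eq hdet

theorem _root_.IsFuchsianPoly.rescale {E : QEquation N ι} (hE : IsFuchsianPoly N E.polyCoeff)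
    {c : ℂ} (hc : c ≠ 0) : IsFuchsianPoly N (E.rescale hc).polyCoeff := by
  rw [isFuchsianPoly_iff] at hE ⊢
  exact hE

/-- The pencil terms coincide, after a substitution that does not affect the divisor term; only the
increments `m - rₖ` and `m' - rₖ` at the poles differ. -/
theorem divisorIndex_middleConv {m m' : ℕ} {E : QEquation N (Fin m)} (r : E.ResidueFactorization)
    (v : Module.Basis (Fin m') ℂ (E.McSpace q lam)) (h₁ : E.StarKer) (h₂ : E.StarIm)
    (hE : IsFuchsianPoly N E.polyCoeff) (hc : q ^ lam ≠ 0)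
    (hE' : IsFuchsianPoly N (E.middleConv q lam v).polyCoeff) :
    divisorIndex (E.middleConv q lam v).polyCoeff + ∑ k : Fin N, ((m : ℤ) - r.rk k.succ) ^ 2 =
      divisorIndex E.polyCoeff + ∑ k : Fin N, ((m' : ℤ) - r.rk k.succ) ^ 2 := by
  have h0 := (E.isFuchsianPoly_iff.1 hE).1
  have hF : IsFuchsianPoly N ((E.middleConv q lam v).rescale hc).polyCoeff :=
    hE'.rescale hc
  have e1 := r.divisorIndex_eq h0 hE.det_ne_zero
  have e2 := divisorIndex_rescale_middleConv r h₁ h₂ h0 hc v hF.det_ne_zero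
  rw [polyCoeff_rescale, divisorIndex_comp hE'.det_ne_zero hc] at e2
  have hpen := finsum_congr fun a => congrArg sqSum (funext fun j => congrArg
    (fun S : Submodule ℂ (∀ k : Fin N, Fin (r.rk k.succ) → LocalDual a) => Module.finrank ℂ S)
    (pencilSol_mcCore r v h₁ h₂ h0 hc a j))
  rw [hpen] at e2
  linear_combination e2 - e1

theorem isFuchsianPoly_middleConv (hE : IsFuchsianPoly N E.polyCoeff) (hc : q ^ lam ≠ 0) :
    IsFuchsianPoly N (E.middleConv q lam v).polyCoeff :=
  (isFuchsianPoly_iff _).2 ⟨isUnit_middleConv_origin v (E.isFuchsianPoly_iff.1 hE).1 hc,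
    isUnit_middleConv_Binf v (E.isFuchsianPoly_iff.1 hE).2⟩

-- If the quotient were zero, injectivity of the columns would make all the `Bₖ` vanish, against
-- (∗). A positive size is needed for the index to be well defined.
include h₁ in
theorem nontrivial_mcSpace [Nonempty ι] : Nontrivial (E.McSpace q lam) := by
  obtain ⟨r⟩ := E.exists_residueFactorization
  by_contra h
  rw [not_nontrivial_iff_subsingleton] at h
  have h0 : ∀ w : ι → ℂ, w = 0 := fun w => h₁.eq_zero_of_forall fun k => by
    rw [← r.col_row, r.mcCol_injective q lam h₁ k (Subsingleton.elim (r.mcCol q lam k (r.row k w)) _),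
      map_zero]
  exact one_ne_zero (congrFun (h0 1) (Classical.arbitrary ι))

theorem fuchsianIndex_polyCoeff {m : ℕ} (E : QEquation N (Fin m)) :
    fuchsianIndex N E.polyCoeff = spectralIndex (Matrix.toLin' (1 - E.Bzero)) +
      spectralIndex (Matrix.toLin' E.Binf) + divisorIndex E.polyCoeff - (m : ℤ) ^ 2 * N := by
  rw [fuchsianIndex, coeff_zero_polyCoeff, coeff_top_polyCoeff, map_smul,
    spectralIndex_smul _ E.prod_neg_inv_ne_zero]

theorem spectralIndex_one_sub {m : ℕ} (M : Matrix (Fin m) (Fin m) ℂ) :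
    spectralIndex (Matrix.toLin' (1 - M)) = spectralIndex (Matrix.toLin' M) := by
  have : Matrix.toLin' (1 - M) = (-1 : ℂ) • Matrix.toLin' M + algebraMap ℂ _ 1 :=
    LinearMap.ext fun w => by simp [sub_eq_neg_add]
  rw [this, spectralIndex_add_const, spectralIndex_smul _ (neg_ne_zero.2 one_ne_zero)]

theorem fuchsianIndex_middleConv {m m' : ℕ} {E : QEquation N (Fin m)}
    (v : Module.Basis (Fin m') ℂ (E.McSpace q lam)) (h₁ : E.StarKer) (h₂ : E.StarIm)
    (hE : IsFuchsianPoly N E.polyCoeff) (hc : q ^ lam ≠ 0) :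
    fuchsianIndex N (E.middleConv q lam v).polyCoeff = fuchsianIndex N E.polyCoeff := by
  obtain ⟨r⟩ := E.exists_residueFactorization
  have hd : Module.finrank ℂ (E.McSpace q lam) = m' := by
    rw [Module.finrank_eq_card_basis v, Fintype.card_fin]
  have e0 := r.spectralIndex_mcCol_mcRow q lam h₁ h₂
  have e1 := r.spectralIndex_mapQ_Binf q lam h₁ h₂
  have e2 := divisorIndex_middleConv r v h₁ h₂ hE hc (isFuchsianPoly_middleConv v hE hc)
  rw [hd, Fintype.card_fin] at e0 e1
  -- Expanding the squares at the poles exposes the cancellation of `m` and `m'` against the squares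
  -- at 0 and ∞ and against `m² N`; what is left depends on the ranks only.
  have hsum : ∀ d : ℤ, ∑ k : Fin N, (d - r.rk k.succ) ^ 2 =
      N * d ^ 2 - 2 * d * ∑ k : Fin N, (r.rk k.succ : ℤ) + ∑ k : Fin N, (r.rk k.succ : ℤ) ^ 2 := by
    intro d
    have hN : (N : ℤ) * d ^ 2 = ∑ _k : Fin N, d ^ 2 := by simp
    rw [hN, Finset.mul_sum, ← Finset.sum_sub_distrib, ← Finset.sum_add_distrib]
    exact Finset.sum_congr rfl fun k _ => by ring
  rw [hsum, hsum] at e2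
  rw [Fin.sum_univ_succ] at e1
  rw [fuchsianIndex_polyCoeff, fuchsianIndex_polyCoeff, spectralIndex_middleConv_origin r,
    spectralIndex_middleConv_Binf, spectralIndex_one_sub]
  linear_combination e0 + e1 + e2

end MiddleConv

end QEquation

theorem theorem1p11 {m N : ℕ} (hm : 0 < m) (q lam : ℂ) (hq₀ : 0 < ‖q‖) (hq₁ : ‖q‖ < 1)
    (E : QEquation N (Fin m)) (hE : IsFuchsianPoly N E.polyCoeff)
    (h₁ : E.StarKer) (h₂ : E.StarIm)
    (R : Matrix (Fin m) (Fin m) (RatFunc ℂ)) (hR : GaugeEquiv R E.coeff)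
    {m' : ℕ} (v : Module.Basis (Fin m') ℂ (E.McSpace q lam)) :
    ∃ r : ℤ, (∀ s, IsRigidityIndex R s ↔ s = r) ∧
      ∀ s, IsRigidityIndex (E.middleConv q lam v).coeff s ↔ s = r := by
  have hc : q ^ lam ≠ 0 := fun h => norm_pos_iff.1 hq₀ ((Complex.cpow_eq_zero_iff _ _).1 h).1
  have : NeZero m := ⟨hm.ne'⟩
  have hnt : Nontrivial (E.McSpace q lam) := QEquation.nontrivial_mcSpace h₁
  have : NeZero m' := ⟨by
    have := Module.finrank_pos (R := ℂ) (M := E.McSpace q lam)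
    rw [Module.finrank_eq_card_basis v, Fintype.card_fin] at this
    exact this.ne'⟩
  -- The polynomial systems cleared of denominators may still have scalar factors; the index is
  -- nevertheless computed from them.
  refine ⟨fuchsianIndex N E.polyCoeff,
    isRigidityIndex_iff hE (hR.trans E.gaugeEquiv_polyCoeff), ?_⟩
  rw [← QEquation.fuchsianIndex_middleConv v h₁ h₂ hE hc]
  exact isRigidityIndex_iff (QEquation.isFuchsianPoly_middleConv v hE hc)
    (QEquation.gaugeEquiv_polyCoeff _)
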